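/- Let $n\ge 1$ be an integer, $r\in\mathbf N\cup\{\infty\}$ with $r>2n+2$, $\mathbf T^n=\mathbf R^n/\mathbf Z^n$, and let $V:\mathbf T^n\to\mathbf R$ be of class $C^r$. Let $|\cdot|^2$ be a flat Riemannian metric on $\mathbf T^n$, i.e. the one induced by an inner product on $\mathbf R^n$, write $|p|$ also for the dual norm of a covector $p$, and put $H_\varepsilon(q,p)=\tfrac12|p|^2+\varepsilon V(q)$ on $T^*\mathbf T^n$. Let $k,T>0$, let $\Omega\in C^r(\mathbf R^+,\mathbf R^+)$, let $N(s,p_s)=\tfrac12\Omega(s)p_s^2+nkT\ln s$ be the corresponding Nosé-like (variable-mass) thermostat, and let $F_\varepsilon(s,q,p_s,p)=H_\varepsilon(q,p s^{-1})+N(s,p_s)$ be the thermostated Hamiltonian on $T^*(\mathbf R^+\times\mathbf T^n)$ with its canonical symplectic structure. Call the points at which $\dot s=\partial F_0/\partial p_s=0$ and $\dot p_s=-\partial F_0/\partial s=0$ the thermostatic equilibria of $F_0$. Then there is an open set $U\subset T^*(\mathbf R^+\times\mathbf T^n)$, whose closure contains the set of thermostatic equilibria of $F_0$, on which $F_0$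 is both Kolmogorov and iso-energetically non-degenerate. Here $F_0$ is called Kolmogorov (respectively iso-energetically) non-degenerate at a point $P$ if there are an open set $D\subset\mathbf R^{n+1}$ and a symplectic $C^r$ diffeomorphism $\Phi:\mathbf T^{n+1}\times D\to T^*(\mathbf R^+\times\mathbf T^n)$ onto an open set containing $P$, such that $F_0\circ\Phi(\theta,I)=h(I)$ depends on the actions $I$ only and, at the value $I=C$ of the actions at $P$, $$\det d\omega\ne 0\qquad\Bigl(\text{respectively }\ \det\begin{bmatrix} d\omega&\omega\\ \omega'&0\end{bmatrix}\ne 0\Bigr),\qquad \omega=\Bigl[\frac{\partial h}{\partial I_i}\Bigr],\quad d\omega=\Bigl[\frac{\partial^2h}{\partial I_i\,\partial I_j}\Bigr].$$ It is non-degenerate on $U$ if it is so at every point of $U$. -/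

import Mathlib

open scoped Matrix

namespace NoseThermostat

/-- The projection `ℝᵐ → 𝐓ᵐ = ℝᵐ/ℤᵐ`. -/
def toTorus {m : ℕ} (x : Fin m → ℝ) : UnitAddTorus (Fin m) := fun i => (x i : UnitAddCircle)

/-- Points `((s, q), (p_s, p))`. The extended phase space `T*(ℝ⁺ × 𝐓ⁿ)` is the open subset
`{0 < s}` of this space, see `physical`. -/
abbrev PhaseSpace (n : ℕ) : Type :=
  (ℝ × UnitAddTorus (Fin n)) × (ℝ × (Fin n → ℝ))

/-- The extended phase space `T*(ℝ⁺ × 𝐓ⁿ)`. -/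
def physical (n : ℕ) : Set (PhaseSpace n) := {z | 0 < z.1.1}

/-- The universal cover of `PhaseSpace n`, a linear space with linear canonical
coordinates `((s, q), (p_s, p))`. -/
abbrev PhaseCover (n : ℕ) : Type :=
  (ℝ × (Fin n → ℝ)) × (ℝ × (Fin n → ℝ))

/-- The covering map. -/
def coverProj {n : ℕ} (z : PhaseCover n) : PhaseSpace n := ((z.1.1, toTorus z.1.2), z.2)

/-- The canonical symplectic form `ds ∧ dp_s + ∑ dqᵢ ∧ dpᵢ`. -/
def phaseForm {n : ℕ} (v w : PhaseCover n) : ℝ :=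
  (v.1.1 * w.2.1 - w.1.1 * v.2.1) + (v.1.2 ⬝ᵥ w.2.2 - w.1.2 ⬝ᵥ v.2.2)

/-- The canonical symplectic form `∑ dθᵢ ∧ dIᵢ` in angle-action variables `(θ, I)`. -/
def angleActionForm {m : ℕ} (v w : (Fin m → ℝ) × (Fin m → ℝ)) : ℝ :=
  v.1 ⬝ᵥ w.2 - w.1 ⬝ᵥ v.2

/-- The mechanical Hamiltonian `H_ε(q, p) = ½ |p|² + ε V(q)`, where `|·|` is the norm on covectors
dual to the norm of the flat metric `∑ gᵢⱼ dqᵢ dqⱼ` on `𝐓ⁿ`. -/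
noncomputable def mechanical {n : ℕ} (g : Matrix (Fin n) (Fin n) ℝ)
    (V : UnitAddTorus (Fin n) → ℝ) (ε : ℝ) (q : UnitAddTorus (Fin n)) (p : Fin n → ℝ) : ℝ :=
  1 / 2 * (p ⬝ᵥ g⁻¹ *ᵥ p) + ε * V q

/-- The variable-mass thermostat `N(s, p_s) = ½ Ω(s) p_s² + n k T ln s`. -/
noncomputable def variableMassThermostat (n : ℕ) (k T : ℝ) (Ω : ℝ → ℝ) (s ps : ℝ) : ℝ :=
  1 / 2 * Ω s * ps ^ 2 + n * k * T * Real.log s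

/-- The thermostated Hamiltonian `F(s, q, p_s, p) = H(q, p s⁻¹) + N(s, p_s)`. -/
noncomputable def thermostated {n : ℕ} (H : UnitAddTorus (Fin n) → (Fin n → ℝ) → ℝ)
    (N : ℝ → ℝ → ℝ) : PhaseSpace n → ℝ :=
  fun z => H z.1.2 (z.1.1⁻¹ • z.2.2) + N z.1.1 z.2.1

/-- The thermostatic equilibria of `F`: the points of the extended phase space where
`ds/dt = ∂F/∂p_s` and `dp_s/dt = -∂F/∂s` both vanish. -/
def thermostaticEquilibria {n : ℕ} (F : PhaseSpace n → ℝ) : Set (PhaseSpace n) :=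
  {z | z ∈ physical n ∧
    HasDerivAt (fun x : ℝ => F (z.1, (x, z.2.2))) 0 z.2.1 ∧
    HasDerivAt (fun x : ℝ => F ((x, z.1.2), z.2)) 0 z.1.1}

/-- `Φ` is (the lift to universal covers of) a `C^r` symplectic diffeomorphism from
`𝐓ⁿ⁺¹ × D`, with `D ⊆ ℝⁿ⁺¹` open, onto an open subset of the extended phase space, which
transforms `F` into the function `h` of the actions alone. (A symplectic map is a local
diffeomorphism, so that openness of the image and smoothness of the inverse need not be asked.) -/
structure IsAngleActionChart {n : ℕ} (r : WithTop ℕ∞) (F : PhaseSpace n → ℝ)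
    (D : Set (Fin (n + 1) → ℝ))
    (Φ : (Fin (n + 1) → ℝ) × (Fin (n + 1) → ℝ) → PhaseCover n)
    (h : (Fin (n + 1) → ℝ) → ℝ) : Prop where
  isOpen : IsOpen D
  contDiffOn : ContDiffOn ℝ r Φ (Set.univ ×ˢ D)
  contDiffOn_action : ContDiffOn ℝ r h D
  mem_physical : ∀ z ∈ Set.univ ×ˢ D, coverProj (Φ z) ∈ physical n
  /-- `Φ` descends to a well-defined and injective map on `𝐓ⁿ⁺¹ × D`. -/
  proj_eq_iff : ∀ z ∈ Set.univ ×ˢ D, ∀ w ∈ Set.univ ×ˢ D,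
    coverProj (Φ z) = coverProj (Φ w) ↔ toTorus z.1 = toTorus w.1 ∧ z.2 = w.2
  symplectic : ∀ z ∈ Set.univ ×ˢ D, ∀ v w,
    phaseForm (fderiv ℝ Φ z v) (fderiv ℝ Φ z w) = angleActionForm v w
  energy : ∀ z ∈ Set.univ ×ˢ D, F (coverProj (Φ z)) = h z.2

/-- The frequency vector `ω = [∂h/∂Iᵢ]` at `I = C`. -/
noncomputable def frequency {m : ℕ} (h : (Fin m → ℝ) → ℝ) (C : Fin m → ℝ) : Fin m → ℝ :=
  fun i => fderiv ℝ h C (Pi.single i 1)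

/-- The Hessian matrix `dω = [∂²h/∂Iᵢ∂Iⱼ]` at `I = C`. -/
noncomputable def hessian {m : ℕ} (h : (Fin m → ℝ) → ℝ) (C : Fin m → ℝ) :
    Matrix (Fin m) (Fin m) ℝ :=
  Matrix.of fun i j => fderiv ℝ (fderiv ℝ h) C (Pi.single i 1) (Pi.single j 1)

/-- The bordered Hessian matrix `[[dω, ω], [ω', 0]]` at `I = C`. -/
noncomputable def borderedHessian {m : ℕ} (h : (Fin m → ℝ) → ℝ) (C : Fin m → ℝ) :
    Matrix (Fin m ⊕ Unit) (Fin m ⊕ Unit) ℝ :=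
  Matrix.fromBlocks (hessian h C) (Matrix.replicateCol Unit (frequency h C))
    (Matrix.replicateRow Unit (frequency h C)) 0

/-- `F` is Kolmogorov non-degenerate at `P`: near (the Liouville torus through) `P` there are
`C^r` angle-action variables for `F`, and `det dω ≠ 0` at the value of the actions at `P`. -/
def KolmogorovNondegenerateAt {n : ℕ} (r : WithTop ℕ∞) (F : PhaseSpace n → ℝ)
    (P : PhaseSpace n) : Prop :=
  ∃ D Φ h, IsAngleActionChart r F D Φ h ∧ ∃ θ, ∃ C ∈ D, coverProj (Φ (θ, C)) = P ∧
    (hessian h C).det ≠ 0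

/-- `F` is iso-energetically non-degenerate at `P`: near (the Liouville torus through) `P` there
are `C^r` angle-action variables for `F`, and the determinant of the bordered Hessian is nonzero
at the value of the actions at `P`. -/
def IsoEnergeticallyNondegenerateAt {n : ℕ} (r : WithTop ℕ∞) (F : PhaseSpace n → ℝ)
    (P : PhaseSpace n) : Prop :=
  ∃ D Φ h, IsAngleActionChart r F D Φ h ∧ ∃ θ, ∃ C ∈ D, coverProj (Φ (θ, C)) = P ∧
    (borderedHessian h C).det ≠ 0

end NoseThermostat

open NoseThermostat

/-! At `ε = 0` the potential is absent, so `q` is cyclic and `p` is conserved. Put `u = ln s`, `P =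
s p_s`, `μ(u) = Ω(e^u)^(-1/2)`, `a = |p|²`, `b = nkT`. The Hamiltonian becomes `½ e^(-2u) (a +
(P/μ)²) + b u`, which for fixed `a` has one degree of freedom; the thermostatic equilibria are `P =
0`, `a = b e^(2u)`. On the level of energy `bε + b/2`, with `R = √b e^ε` and `x = 2(u - ε)`, one has
`a + (P/μ)² = R² (1 - x) e^x`. A Morse coordinate `y` (`lobeCoord`) with `1 - y² = (1 - x) e^x`
turns the level into the circle `y² + (P/(μR))² = c²`, where `a = R²(1 - c²)`. Cycles are thus
labelled by `(ε, c)` with `0 < c < 1` and parametrized by an angle `φ`; the equilibria are the limit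
`c = 0`. From here on `ε` is this energy parameter, not the coupling of the potential.

The action is `J = ∮ P du`, and `∂J/∂ε` (`period`) and `∂J/∂a` (`drift`) are integrals over `φ` of
smooth weights, with no singularity at turning points. The map `(ε, c) ↦ (J, a)` is an injective
local diffeomorphism (`injOn_cycleMap`), so `ε = e(J, a)` and the Hamiltonian is `h(I) = b e(I₀,
|I'|²) + b/2`. The identity `du∧dP + dσ∧da = dθ∧dJ` of `exists_differentials` makes the resulting
chart symplectic (`isAngleActionChart`).

In the directions orthogonal to `I'` the Hessian of `h` is a nonzero multiple of the metric, so both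
determinants reduce to conditions on the second-order jet of `e` (`det_ne_zero_of_taylor`), and
these amount to `kolDiscr ≠ 0` and `isoDiscr ≠ 0` (`energyLevel_nondegenerate`). As `c → 0+` each
discriminant is `α + β c² + o(c²)`, with `α`, `β` polynomials in `μ` and its first four derivatives
at `ε`. If the good cycles did not accumulate at `(ε₀, 0)`, then on some open set of `ε` both
coefficients of one and the same discriminant would vanish: two differential equations for the one
function `μ`, which have no common positive solution (`not_isoDiscr_degenerate`,
`not_kolDiscr_degenerate`, `mem_closure_nondegenerate`). The set `U` consists of the points on
cycles where neither discriminant vanishes. -/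

namespace NoseThermostat

open Set Filter Topology MeasureTheory

/-! ### Smoothness of integrals depending on a parameter. -/

section ParametricIntegral

set_option linter.unusedSectionVars false

variable {E F : Type} [NormedAddCommGroup E] [NormedSpace ℝ E] [NormedAddCommGroup F]
  [NormedSpace ℝ F]

/-- Tube lemma: the bound on the compact slice over `x₀`, enlarged by `1`, persists for nearby
parameters. It is the dominating constant for continuity and differentiation under the integral. -/
theorem eventually_norm_le_of_continuousOn {U : Set E} (hU : IsOpen U) {f : E → ℝ → F}
    (hf : ContinuousOn (Function.uncurry f) (U ×ˢ univ)) (a b : ℝ) {x₀ : E} (hx : x₀ ∈ U) :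
    ∃ M : ℝ, ∀ᶠ x in 𝓝 x₀, x ∈ U ∧ ∀ t ∈ uIcc a b, ‖f x t‖ ≤ M := by
  have hc : ContinuousOn (fun t => f x₀ t) (uIcc a b) := by
    have : ContinuousOn (fun t : ℝ => (x₀, t)) (uIcc a b) := by fun_prop
    exact hf.comp this (fun t _ => ⟨hx, mem_univ _⟩)
  obtain ⟨M, hM⟩ := isCompact_uIcc.exists_bound_of_continuousOn hc
  refine ⟨M + 1, ?_⟩
  have key : ∀ᶠ x in 𝓝 x₀, ∀ t ∈ uIcc a b, x ∈ U ∧ ‖f x t‖ < M + 1 := by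
    refine isCompact_uIcc.eventually_forall_of_forall_eventually ?_
    intro t ht
    have hopen : (U ×ˢ (univ : Set ℝ)) ∈ 𝓝 (x₀, t) := (hU.prod isOpen_univ).mem_nhds ⟨hx, mem_univ _⟩
    have hcat : ContinuousAt (Function.uncurry f) (x₀, t) := hf.continuousAt hopen
    have h1 : ∀ᶠ z in 𝓝 (x₀, t), ‖Function.uncurry f z‖ < M + 1 :=
      hcat.norm.eventually_lt_const (lt_of_le_of_lt (hM t ht) (lt_add_one M))
    filter_upwards [h1, hopen] with z hz hz'
    exact ⟨hz'.1, hz⟩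
  filter_upwards [key] with x h
  exact ⟨(h a left_mem_uIcc).1, fun t ht => (h t ht).2.le⟩

theorem continuous_slice {U : Set E} {f : E → ℝ → F}
    (hf : ContinuousOn (Function.uncurry f) (U ×ˢ univ)) {x : E} (hx : x ∈ U) :
    Continuous (f x) := by
  have : ContinuousOn (fun t : ℝ => (x, t)) univ := by fun_prop
  exact continuousOn_univ.1 (hf.comp this (fun t _ => ⟨hx, mem_univ _⟩))

theorem continuousOn_intervalIntegral {U : Set E} (hU : IsOpen U) {f : E → ℝ → F}
    (hf : ContinuousOn (Function.uncurry f) (U ×ˢ univ)) (a b : ℝ) :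
    ContinuousOn (fun x => ∫ t in a..b, f x t) U := by
  intro x₀ hx
  refine ContinuousAt.continuousWithinAt ?_
  obtain ⟨M, hM⟩ := eventually_norm_le_of_continuousOn hU hf a b hx
  refine intervalIntegral.continuousAt_of_dominated_interval (bound := fun _ => M) ?_ ?_ ?_ ?_
  · filter_upwards [hM] with x h
    exact (continuous_slice hf h.1).aestronglyMeasurable
  · filter_upwards [hM] with x h
    exact Eventually.of_forall fun t ht => h.2 t (uIoc_subset_uIcc ht)
  · exact intervalIntegrable_const
  · refine Eventually.of_forall fun t _ => ?_
    have hcat : ContinuousAt (Function.uncurry f) (x₀, t) :=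
      hf.continuousAt ((hU.prod isOpen_univ).mem_nhds ⟨hx, mem_univ _⟩)
    exact ContinuousAt.comp (f := fun x => (x, t)) hcat (by fun_prop)

theorem hasFDerivAt_slice {U : Set E} (hU : IsOpen U) {f : E → ℝ → F} {n : WithTop ℕ∞} (hn : n ≠ 0)
    (hf : ContDiffOn ℝ n (Function.uncurry f) (U ×ˢ univ)) {x : E} (hx : x ∈ U) (t : ℝ) :
    HasFDerivAt (fun x => f x t)
      ((fderiv ℝ (Function.uncurry f) (x, t)).comp (ContinuousLinearMap.inl ℝ E ℝ)) x := by
  have h1 : HasFDerivAt (Function.uncurry f) (fderiv ℝ (Function.uncurry f) (x, t)) (x, t) :=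
    ((hf.contDiffAt ((hU.prod isOpen_univ).mem_nhds ⟨hx, mem_univ _⟩)).differentiableAt
      hn).hasFDerivAt
  exact HasFDerivAt.comp (f := fun x => (x, t)) x h1 (hasFDerivAt_prodMk_left x t)

theorem contDiffOn_slice_fderiv {U : Set E} (hU : IsOpen U) {f : E → ℝ → F} {n m : WithTop ℕ∞}
    (hmn : m + 1 ≤ n) (hf : ContDiffOn ℝ n (Function.uncurry f) (U ×ˢ univ)) :
    ContDiffOn ℝ m (Function.uncurry fun x t => fderiv ℝ (fun x => f x t) x) (U ×ˢ univ) := by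
  have hn : n ≠ 0 := by
    rintro rfl
    simp at hmn
  have h1 : ContDiffOn ℝ m (fun z => (fderiv ℝ (Function.uncurry f) z).comp
      (ContinuousLinearMap.inl ℝ E ℝ)) (U ×ˢ univ) :=
    (hf.fderiv_of_isOpen (hU.prod isOpen_univ) hmn).clm_comp contDiffOn_const
  refine h1.congr ?_
  rintro ⟨x, t⟩ ⟨hx, -⟩
  exact (hasFDerivAt_slice hU hn hf hx t).fderiv

theorem hasFDerivAt_intervalIntegral {U : Set E} (hU : IsOpen U) {f : E → ℝ → F}
    (hf : ContDiffOn ℝ 1 (Function.uncurry f) (U ×ˢ univ)) (a b : ℝ) {x₀ : E} (hx : x₀ ∈ U) :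
    HasFDerivAt (fun x => ∫ t in a..b, f x t)
      (∫ t in a..b, fderiv ℝ (fun x => f x t) x₀) x₀ := by
  have hc := hf.continuousOn
  have hc' : ContinuousOn (Function.uncurry fun x t => fderiv ℝ (fun x => f x t) x)
    (U ×ˢ univ) := (contDiffOn_slice_fderiv hU (m := 0) (by simp) hf).continuousOn
  obtain ⟨M, hM⟩ := eventually_norm_le_of_continuousOn hU hc' a b hx
  refine intervalIntegral.hasFDerivAt_integral_of_dominated_of_fderiv_le (bound := fun _ => M)
    (F' := fun x t => fderiv ℝ (fun x => f x t) x) hM ?_ ?_ ?_ ?_ ?_ ?_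
  · filter_upwards [hM] with x h
    exact (continuous_slice hc h.1).aestronglyMeasurable
  · exact (continuous_slice hc hx).intervalIntegrable _ _
  · exact (continuous_slice hc' hx).aestronglyMeasurable
  · exact Eventually.of_forall fun t ht x h => h.2 t (uIoc_subset_uIcc ht)
  · exact intervalIntegrable_const
  · refine Eventually.of_forall fun t _ x h => ?_
    exact (hasFDerivAt_slice hU one_ne_zero hf h.1 t).differentiableAt.hasFDerivAt

/-- The target space is quantified inside the induction because the derivative of the integrand
takes values in a space of linear maps. -/
theorem contDiffOn_nat_intervalIntegral {U : Set E} (hU : IsOpen U) (n : ℕ) (a b : ℝ) :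
    ∀ {F : Type} [NormedAddCommGroup F] [NormedSpace ℝ F] {f : E → ℝ → F},
    ContDiffOn ℝ n (Function.uncurry f) (U ×ˢ univ) →
    ContDiffOn ℝ n (fun x => ∫ t in a..b, f x t) U := by
  induction n with
  | zero =>
    intro F _ _ f hf
    simp only [Nat.cast_zero, contDiffOn_zero] at hf ⊢
    exact continuousOn_intervalIntegral hU hf a b
  | succ n ih =>
    intro F _ _ f hf
    have h1 : ContDiffOn ℝ 1 (Function.uncurry f) (U ×ˢ univ) := by
      refine hf.of_le ?_
      push_cast
      exact le_add_self
    have hd := fun x hx => hasFDerivAt_intervalIntegral hU h1 a b (x₀ := x) hx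
    push_cast
    rw [contDiffOn_succ_iff_fderiv_of_isOpen hU]
    refine ⟨fun x hx => (hd x hx).differentiableAt.differentiableWithinAt, by simp, ?_⟩
    have := ih (contDiffOn_slice_fderiv hU (m := n) (by push_cast; rfl) hf)
    exact this.congr fun x hx => (hd x hx).fderiv

theorem contDiffOn_intervalIntegral {U : Set E} (hU : IsOpen U) (n : ℕ∞) (a b : ℝ)
    {f : E → ℝ → F} (hf : ContDiffOn ℝ n (Function.uncurry f) (U ×ˢ univ)) :
    ContDiffOn ℝ n (fun x => ∫ t in a..b, f x t) U := by
  rw [contDiffOn_iff_forall_nat_le]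
  intro m hm
  exact contDiffOn_nat_intervalIntegral hU m a b (hf.of_le (by exact_mod_cast hm))

/-- The substitution `t ↦ z.1 * t` makes the interval constant and moves the upper limit into the
integrand. -/
theorem contDiffOn_primitive {U : Set E} (hU : IsOpen U) (n : ℕ∞)
    {f : E → ℝ → ℝ} (hf : ContDiffOn ℝ n (Function.uncurry f) (U ×ˢ univ)) :
    ContDiffOn ℝ n (fun z : ℝ × E => ∫ t in (0 : ℝ)..z.1, f z.2 t) (univ ×ˢ U) := by
  have h : ContDiffOn ℝ n (fun z : ℝ × E => ∫ t in (0 : ℝ)..1, f z.2 (z.1 * t))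
      (univ ×ˢ U) := by
    refine contDiffOn_intervalIntegral (isOpen_univ.prod hU) n 0 1
      (f := fun (z : ℝ × E) t => f z.2 (z.1 * t)) ?_
    have : ContDiffOn ℝ n (fun w : (ℝ × E) × ℝ => (w.1.2, w.1.1 * w.2))
        ((univ ×ˢ U) ×ˢ univ) := by fun_prop
    exact hf.comp this (fun w hw => ⟨hw.1.2, mem_univ _⟩)
  refine (contDiffOn_fst.mul h).congr ?_
  intro z hz
  have := intervalIntegral.smul_integral_comp_mul_left (f := f z.2) (a := 0) (b := 1) z.1
  simp only [smul_eq_mul, mul_zero, mul_one] at this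
  exact this.symm

/-- The derivative of `(φ, x) ↦ ∫₀^φ f x t dt`. -/
theorem fderiv_primitive {U : Set E} (hU : IsOpen U) {f : E → ℝ → ℝ}
    (hf : ContDiffOn ℝ 1 (Function.uncurry f) (U ×ˢ univ)) {φ : ℝ} {x : E} (hx : x ∈ U)
    (δ : ℝ) (ξ : E) :
    fderiv ℝ (fun z : ℝ × E => ∫ t in (0 : ℝ)..z.1, f z.2 t) (φ, x) (δ, ξ) =
      f x φ * δ + ∫ t in (0 : ℝ)..φ, fderiv ℝ (fun x => f x t) x ξ := by
  have hd : HasFDerivAt (fun z : ℝ × E => ∫ t in (0 : ℝ)..z.1, f z.2 t)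
      (fderiv ℝ (fun z : ℝ × E => ∫ t in (0 : ℝ)..z.1, f z.2 t) (φ, x)) (φ, x) :=
    (((contDiffOn_primitive hU 1 hf).contDiffAt
      ((isOpen_univ.prod hU).mem_nhds ⟨mem_univ _, hx⟩)).differentiableAt
      one_ne_zero).hasFDerivAt
  have e1 : fderiv ℝ (fun z : ℝ × E => ∫ t in (0 : ℝ)..z.1, f z.2 t) (φ, x) (1, 0) = f x φ := by
    have h1 : HasDerivAt (fun s : ℝ => (s, x)) ((1 : ℝ), (0 : E)) φ :=
      (hasDerivAt_id φ).prodMk (hasDerivAt_const φ x)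
    have h2 := hd.comp_hasDerivAt φ h1
    have hc := continuous_slice hf.continuousOn hx
    exact h2.unique (intervalIntegral.integral_hasDerivAt_right (hc.intervalIntegrable _ _)
      hc.aestronglyMeasurable.stronglyMeasurableAtFilter hc.continuousAt)
  have e2 : fderiv ℝ (fun z : ℝ × E => ∫ t in (0 : ℝ)..z.1, f z.2 t) (φ, x) (0, ξ) =
      ∫ t in (0 : ℝ)..φ, fderiv ℝ (fun x => f x t) x ξ := by
    have h2 := hd.comp x (hasFDerivAt_prodMk_right φ x)
    have h3 := h2.unique (hasFDerivAt_intervalIntegral hU hf 0 φ hx)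
    have h4 := congrArg (fun L : E →L[ℝ] ℝ => L ξ) h3
    have hc' : Continuous (fun t => fderiv ℝ (fun x => f x t) x) :=
      continuous_slice (contDiffOn_slice_fderiv hU (m := 0) (by simp) hf).continuousOn hx
    simp only [ContinuousLinearMap.comp_apply, ContinuousLinearMap.inr_apply] at h4
    rw [h4, ContinuousLinearMap.intervalIntegral_apply (hc'.intervalIntegrable _ _)]
  have : ((δ, ξ) : ℝ × E) = δ • ((1 : ℝ), (0 : E)) + (0, ξ) := by simp
  rw [this, map_add, map_smul, e1, e2, smul_eq_mul, mul_comm]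

end ParametricIntegral

/-! ### Inverse function theorem for maps with a given left inverse. -/

section Inverse

variable {E : Type} [NormedAddCommGroup E] [NormedSpace ℝ E] [FiniteDimensional ℝ E]

theorem exists_equiv_fderiv {f : E → E} {x : E} (hf : DifferentiableAt ℝ f x)
    (hd : Function.Injective (fderiv ℝ f x)) :
    ∃ e : E ≃L[ℝ] E, HasFDerivAt f (e : E →L[ℝ] E) x := by
  let e := (LinearEquiv.ofInjectiveEndo (fderiv ℝ f x : E →ₗ[ℝ] E) hd).toContinuousLinearEquiv
  refine ⟨e, ?_⟩
  have : (e : E →L[ℝ] E) = fderiv ℝ f x := by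
    ext y
    rfl
  rw [this]
  exact hf.hasFDerivAt

/-- Near `f x` the local inverse of the inverse function theorem takes values in `U`, where `g`
undoes `f`; hence `g` coincides with it and inherits its smoothness. -/
theorem isOpen_image_and_contDiffOn_inverse {f g : E → E} {U : Set E} (hU : IsOpen U)
    {n : WithTop ℕ∞} (hn : n ≠ 0) (hf : ContDiffOn ℝ n f U) (hg : LeftInvOn g f U)
    (hd : ∀ x ∈ U, Function.Injective (fderiv ℝ f x)) :
    IsOpen (f '' U) ∧ ContDiffOn ℝ n g (f '' U) := by
  have : CompleteSpace E := FiniteDimensional.complete ℝ E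
  have key : ∀ x ∈ U, f '' U ∈ 𝓝 (f x) ∧ ContDiffAt ℝ n g (f x) := by
    intro x hx
    have hfx := hf.contDiffAt (hU.mem_nhds hx)
    obtain ⟨e, he⟩ := exists_equiv_fderiv (hfx.differentiableAt hn) (hd x hx)
    let h := hfx.toOpenPartialHomeomorph f he hn
    have hcoe : (h : E → E) = f := hfx.toOpenPartialHomeomorph_coe he hn
    have hxs : x ∈ h.source := hfx.mem_toOpenPartialHomeomorph_source he hn
    have hV : h '' (h.source ∩ U) ∈ 𝓝 (h x) :=
      (h.isOpen_image_source_inter hU).mem_nhds ⟨x, ⟨hxs, hx⟩, rfl⟩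
    rw [hcoe] at hV
    refine ⟨mem_of_superset hV (image_mono inter_subset_right), ?_⟩
    have hloc := hfx.to_localInverse he hn
    refine hloc.congr_of_eventuallyEq ?_
    filter_upwards [hV]
    rintro _ ⟨w, ⟨hw, hwU⟩, rfl⟩
    rw [hg hwU]
    have := h.left_inv hw
    rw [hcoe] at this
    exact this.symm
  refine ⟨isOpen_iff_mem_nhds.2 ?_, ?_⟩
  · rintro _ ⟨x, hx, rfl⟩
    exact (key x hx).1
  · rintro _ ⟨x, hx, rfl⟩
    exact (key x hx).2.contDiffWithinAt

end Inverse

/-! ### The Morse coordinate of the potential well and its inverse. -/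

/-- The function `(1 - (1 - x) eˣ) / x²`, extended smoothly to `x = 0`. -/
noncomputable def lobeQuot (x : ℝ) : ℝ := ∫ t in (0 : ℝ)..1, t * Real.exp (x * t)

/-- An antiderivative of `x² t e^(xt)` is `(xt - 1) e^(xt)`. The integral form makes positivity and
smoothness at the removable singularity evident, so that a smooth square root can be taken. -/
theorem sq_mul_lobeQuot (x : ℝ) : x ^ 2 * lobeQuot x = 1 - (1 - x) * Real.exp x := by
  have h : ∀ t ∈ uIcc (0 : ℝ) 1, HasDerivAt (fun t => (x * t - 1) * Real.exp (x * t))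
      (x ^ 2 * (t * Real.exp (x * t))) t := by
    intro t _
    have h1 : HasDerivAt (fun t : ℝ => x * t) x t := by simpa using (hasDerivAt_id t).const_mul x
    refine ((h1.sub_const 1).mul h1.exp).congr_deriv ?_
    ring
  have := intervalIntegral.integral_eq_sub_of_hasDerivAt h
    (Continuous.intervalIntegrable (by fun_prop) _ _)
  rw [intervalIntegral.integral_const_mul] at this
  rw [lobeQuot, this]
  simp
  ring

theorem lobeQuot_pos (x : ℝ) : 0 < lobeQuot x := by
  refine intervalIntegral.intervalIntegral_pos_of_pos_on
    (Continuous.intervalIntegrable (by fun_prop) _ _) (fun t ht => ?_) one_pos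
  exact mul_pos ht.1 (Real.exp_pos _)

theorem contDiff_lobeQuot {n : ℕ∞} : ContDiff ℝ n lobeQuot := by
  rw [← contDiffOn_univ]
  refine contDiffOn_intervalIntegral isOpen_univ n 0 1
    (f := fun x t => t * Real.exp (x * t)) (ContDiff.contDiffOn ?_)
  have : ContDiff ℝ n (fun z : ℝ × ℝ => z.2 * Real.exp (z.1 * z.2)) := by fun_prop
  exact this

/-- The coordinate `y` with `1 - y² = (1 - x) eˣ` and the sign of `x`. -/
noncomputable def lobeCoord (x : ℝ) : ℝ := x * √(lobeQuot x)

theorem lobeCoord_sq (x : ℝ) : lobeCoord x ^ 2 = 1 - (1 - x) * Real.exp x := by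
  rw [lobeCoord, mul_pow, Real.sq_sqrt (lobeQuot_pos x).le, sq_mul_lobeQuot]

theorem contDiff_lobeCoord {n : ℕ∞} : ContDiff ℝ n lobeCoord :=
  contDiff_id.mul (contDiff_lobeQuot.sqrt fun x => (lobeQuot_pos x).ne')

theorem lobeCoord_zero : lobeCoord 0 = 0 := by simp [lobeCoord]

theorem hasDerivAt_lobeCoord (x : ℝ) : HasDerivAt lobeCoord (deriv lobeCoord x) x :=
  ((contDiff_lobeCoord (n := 1)).differentiable one_ne_zero x).hasDerivAt

theorem lobeCoord_mul_deriv (x : ℝ) :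
    2 * lobeCoord x * deriv lobeCoord x = x * Real.exp x := by
  have h1 := (hasDerivAt_lobeCoord x).pow 2
  have h2 : HasDerivAt (fun x => 1 - (1 - x) * Real.exp x) (x * Real.exp x) x := by
    refine ((((hasDerivAt_id x).const_sub 1).mul (Real.hasDerivAt_exp x)).const_sub 1).congr_deriv
      ?_
    simp only [id]
    ring
  have h3 : (lobeCoord ^ 2 : ℝ → ℝ) = fun x => 1 - (1 - x) * Real.exp x :=
    funext fun x => lobeCoord_sq x
  rw [h3] at h1
  simpa using h1.unique h2

/-- Away from `0` the factor `x` cancels from `lobeCoord_mul_deriv`; at `0` that relation is void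
and the derivative is `√(lobeQuot 0)`. -/
theorem deriv_lobeCoord_pos (x : ℝ) : 0 < deriv lobeCoord x := by
  by_cases hx : x = 0
  · subst hx
    have h1 : HasDerivAt lobeCoord (√(lobeQuot 0)) 0 := by
      have h2 : HasDerivAt (fun x => √(lobeQuot x)) (deriv (fun x => √(lobeQuot x)) 0) 0 :=
        (((contDiff_lobeQuot (n := 1)).sqrt fun x => (lobeQuot_pos x).ne').differentiable
          one_ne_zero 0).hasDerivAt
      refine ((hasDerivAt_id (0 : ℝ)).mul h2).congr_deriv ?_
      simp
    rw [h1.deriv]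
    exact Real.sqrt_pos.2 (lobeQuot_pos 0)
  · have h1 := lobeCoord_mul_deriv x
    have hs := Real.sqrt_pos.2 (lobeQuot_pos x)
    have h2 : x * (2 * √(lobeQuot x) * deriv lobeCoord x) = x * Real.exp x := by
      rw [← h1, lobeCoord]
      ring
    have h3 := mul_left_cancel₀ hx h2
    have h4 : 0 < 2 * √(lobeQuot x) * deriv lobeCoord x := h3 ▸ Real.exp_pos x
    exact (pos_iff_pos_of_mul_pos h4).1 (by positivity)

theorem strictMono_lobeCoord : StrictMono lobeCoord := strictMono_of_deriv_pos deriv_lobeCoord_pos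

/-- The coordinate equals `1` at `x = 1`, and its square `1 - (1 - x) e^x` tends to `1` as `x → -∞`;
the intermediate value theorem does the rest. -/
theorem exists_lobeCoord_eq {y : ℝ} (hy : y ∈ Ioo (-1 : ℝ) 1) : ∃ x < 1, lobeCoord x = y := by
  have h1 : lobeCoord 1 = 1 := by
    have h := lobeCoord_sq 1
    have h2 : 0 < lobeCoord 1 := by
      have := strictMono_lobeCoord one_pos
      rwa [lobeCoord_zero] at this
    have h3 : (lobeCoord 1 - 1) * (lobeCoord 1 + 1) = 0 := by linear_combination h
    rcases mul_eq_zero.1 h3 with h4 | h4 <;> linarith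
  have h2 : Tendsto (fun x : ℝ => (1 + x) * Real.exp (-x)) atTop (𝓝 0) := by
    have e1 := Real.tendsto_pow_mul_exp_neg_atTop_nhds_zero 1
    have e0 := Real.tendsto_pow_mul_exp_neg_atTop_nhds_zero 0
    refine ((e0.add e1).congr fun x => ?_).trans (by simp)
    ring
  have hy2 : 0 < 1 - y ^ 2 := by nlinarith [hy.1, hy.2]
  obtain ⟨x, hx, hx0⟩ := ((h2.eventually_lt_const hy2).and (eventually_gt_atTop 0)).exists
  have h3 : lobeCoord (-x) < y := by
    have e1 := lobeCoord_sq (-x)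
    have e2 : lobeCoord (-x) < 0 := by
      have := strictMono_lobeCoord (neg_neg_of_pos hx0)
      rwa [lobeCoord_zero] at this
    simp only [sub_neg_eq_add] at e1
    by_contra h
    nlinarith
  have hc : ContinuousOn lobeCoord (Icc (-x) 1) :=
    (contDiff_lobeCoord (n := 0)).continuous.continuousOn
  obtain ⟨w, hw, hwy⟩ := intermediate_value_Ioo (by linarith) hc ⟨h3, by rw [h1]; exact hy.2⟩
  exact ⟨w, hw.2, hwy⟩

/-- The inverse of `lobeCoord`. -/
noncomputable def lobe : ℝ → ℝ := Function.invFun lobeCoord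

theorem lobe_lobeCoord (x : ℝ) : lobe (lobeCoord x) = x :=
  Function.leftInverse_invFun strictMono_lobeCoord.injective x

theorem lobeCoord_lobe {y : ℝ} (hy : y ∈ Ioo (-1 : ℝ) 1) : lobeCoord (lobe y) = y := by
  obtain ⟨x, -, hx⟩ := exists_lobeCoord_eq hy
  exact Function.invFun_eq ⟨x, hx⟩

theorem lobe_zero : lobe 0 = 0 := by
  have := lobe_lobeCoord 0
  rwa [lobeCoord_zero] at this

theorem contDiffOn_lobe {n : ℕ∞} : ContDiffOn ℝ n lobe (Ioo (-1) 1) := by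
  -- The inverse function theorem needs a nonzero order, hence `n + 1`, which is lowered afterwards.
  have hmain : ContDiffOn ℝ ((n + 1 : ℕ∞) : WithTop ℕ∞) lobe (lobeCoord '' univ) := by
    refine (isOpen_image_and_contDiffOn_inverse isOpen_univ (n := ((n + 1 : ℕ∞) : WithTop ℕ∞))
      (by simp) contDiff_lobeCoord.contDiffOn (fun x _ => lobe_lobeCoord x) fun x _ => ?_).2
    have h : fderiv ℝ lobeCoord x 1 = deriv lobeCoord x := rfl
    rw [injective_iff_map_eq_zero]
    intro t ht
    have e : fderiv ℝ lobeCoord x t = t * deriv lobeCoord x := by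
      rw [← h, ← smul_eq_mul, ← map_smul, smul_eq_mul, mul_one]
    rw [e] at ht
    exact (mul_eq_zero.1 ht).resolve_right (deriv_lobeCoord_pos x).ne'
  refine (hmain.of_le (by exact_mod_cast le_self_add)).mono ?_
  intro y hy
  obtain ⟨x, -, hx⟩ := exists_lobeCoord_eq hy
  exact ⟨x, mem_univ _, hx⟩

theorem one_sub_sq_eq {y : ℝ} (hy : y ∈ Ioo (-1 : ℝ) 1) :
    1 - y ^ 2 = (1 - lobe y) * Real.exp (lobe y) := by
  have := lobeCoord_sq (lobe y)
  rw [lobeCoord_lobe hy] at this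
  linarith

theorem contDiffOn_iterate_deriv_lobe (k : ℕ) {n : ℕ∞} :
    ContDiffOn ℝ n (deriv^[k] lobe) (Ioo (-1) 1) := by
  induction k generalizing n with
  | zero => exact contDiffOn_lobe
  | succ k ih =>
    rw [Function.iterate_succ_apply']
    exact (ih (n := n + 1)).deriv_of_isOpen isOpen_Ioo (by push_cast; rfl)

theorem hasDerivAt_iterate_deriv_lobe (k : ℕ) {y : ℝ} (hy : y ∈ Ioo (-1 : ℝ) 1) :
    HasDerivAt (deriv^[k] lobe) (deriv^[k + 1] lobe y) y := by
  rw [Function.iterate_succ_apply']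
  exact (((contDiffOn_iterate_deriv_lobe k (n := 1)).contDiffAt
    (isOpen_Ioo.mem_nhds hy)).differentiableAt one_ne_zero).hasDerivAt

theorem hasDerivAt_lobe {y : ℝ} (hy : y ∈ Ioo (-1 : ℝ) 1) :
    HasDerivAt lobe (deriv lobe y) y :=
  hasDerivAt_iterate_deriv_lobe 0 hy

theorem deriv_lobe_pos {y : ℝ} (hy : y ∈ Ioo (-1 : ℝ) 1) : 0 < deriv lobe y := by
  have h1 := (hasDerivAt_lobeCoord (lobe y)).comp y (hasDerivAt_lobe hy)
  have h2 : HasDerivAt (lobeCoord ∘ lobe) 1 y := by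
    refine (hasDerivAt_id y).congr_of_eventuallyEq ?_
    filter_upwards [isOpen_Ioo.mem_nhds hy] with w hw
    exact lobeCoord_lobe hw
  have h3 := h1.unique h2
  exact (pos_iff_pos_of_mul_pos (by rw [h3]; exact one_pos)).1 (deriv_lobeCoord_pos _)

/-- This differential equation, together with `lobe 0 = 0` and the sign of the derivative,
determines all Taylor coefficients of `lobe` at `0`. -/
theorem lobe_mul_deriv {y : ℝ} (hy : y ∈ Ioo (-1 : ℝ) 1) :
    lobe y * deriv lobe y * Real.exp (lobe y) = 2 * y := by
  have h1 := (hasDerivAt_lobeCoord (lobe y)).comp y (hasDerivAt_lobe hy)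
  have h2 : HasDerivAt (lobeCoord ∘ lobe) 1 y := by
    refine (hasDerivAt_id y).congr_of_eventuallyEq ?_
    filter_upwards [isOpen_Ioo.mem_nhds hy] with w hw
    exact lobeCoord_lobe hw
  have h3 := h1.unique h2
  have h4 := lobeCoord_mul_deriv (lobe y)
  rw [lobeCoord_lobe hy] at h4
  linear_combination 2 * y * h3 - deriv lobe y * h4

/-- `v' e^{2v} = (1 - y²) v' + y` for `v = lobe / 2`. -/
theorem deriv_lobe_mul_exp {y : ℝ} (hy : y ∈ Ioo (-1 : ℝ) 1) :
    deriv lobe y * Real.exp (lobe y) = (1 - y ^ 2) * deriv lobe y + 2 * y := by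
  rw [one_sub_sq_eq hy, ← lobe_mul_deriv hy]
  ring

/-! ### Averages over a cycle and their expansion at `c = 0`. -/

/-- The average of `sin²ᵏ φ f(c cos φ)` over a period, up to the factor `2π`. -/
noncomputable def avg (k : ℕ) (f : ℝ → ℝ) (c : ℝ) : ℝ :=
  ∫ t in (0 : ℝ)..(2 * Real.pi), Real.sin t ^ (2 * k) * f (c * Real.cos t)

theorem mul_cos_mem_Ioo {c : ℝ} (hc : c ∈ Ioo (-1 : ℝ) 1) (t : ℝ) :
    c * Real.cos t ∈ Ioo (-1 : ℝ) 1 := by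
  rw [mem_Ioo, ← abs_lt, abs_mul]
  exact (mul_le_of_le_one_right (abs_nonneg c) (Real.abs_cos_le_one t)).trans_lt (abs_lt.2 hc)

theorem contDiffOn_avg_integrand {n : ℕ∞} (k : ℕ) {f : ℝ → ℝ}
    (hf : ContDiffOn ℝ n f (Ioo (-1) 1)) :
    ContDiffOn ℝ n (Function.uncurry fun c t : ℝ => Real.sin t ^ (2 * k) * f (c * Real.cos t))
      (Ioo (-1) 1 ×ˢ univ) := by
  have h1 : ContDiff ℝ n (fun z : ℝ × ℝ => z.1 * Real.cos z.2) := by fun_prop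
  have h2 : ContDiff ℝ n (fun z : ℝ × ℝ => Real.sin z.2 ^ (2 * k)) := by fun_prop
  exact h2.contDiffOn.mul (hf.comp h1.contDiffOn fun z hz => mul_cos_mem_Ioo hz.1 z.2)

theorem continuousOn_avg (k : ℕ) {f : ℝ → ℝ} (hf : ContinuousOn f (Ioo (-1) 1)) :
    ContinuousOn (avg k f) (Ioo (-1) 1) :=
  continuousOn_intervalIntegral isOpen_Ioo
    (f := fun c t => Real.sin t ^ (2 * k) * f (c * Real.cos t))
    (contDiffOn_avg_integrand (n := 0) k (by simpa using hf)).continuousOn _ _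

theorem hasDerivAt_avg' (k : ℕ) {f : ℝ → ℝ} (hf : ContDiffOn ℝ 1 f (Ioo (-1) 1)) {c : ℝ}
    (hc : c ∈ Ioo (-1 : ℝ) 1) :
    HasDerivAt (avg k f) (∫ t in (0 : ℝ)..(2 * Real.pi),
      Real.sin t ^ (2 * k) * (deriv f (c * Real.cos t) * Real.cos t)) c := by
  have hci := contDiffOn_avg_integrand (n := 1) k hf
  have h := (hasFDerivAt_intervalIntegral isOpen_Ioo hci 0 (2 * Real.pi) hc).hasDerivAt
  refine h.congr_deriv ?_
  have hc' := continuous_slice (contDiffOn_slice_fderiv isOpen_Ioo (m := 0) (by simp)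
    hci).continuousOn hc
  rw [ContinuousLinearMap.intervalIntegral_apply (hc'.intervalIntegrable _ _)]
  refine intervalIntegral.integral_congr fun t _ => ?_
  have hy := mul_cos_mem_Ioo hc t
  have h1 : HasDerivAt f (deriv f (c * Real.cos t)) (c * Real.cos t) :=
    ((hf.contDiffAt (isOpen_Ioo.mem_nhds hy)).differentiableAt one_ne_zero).hasDerivAt
  have h2 : HasDerivAt (fun c : ℝ => c * Real.cos t) (Real.cos t) c := by
    simpa using (hasDerivAt_id c).mul_const (Real.cos t)
  exact ((h1.comp c h2).const_mul _).deriv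

/-- Integration by parts with the periodic primitive `sin^(2k+1) t · f(c cos t)`: a factor `cos t`
is traded for `c` and a derivative of `f`. This keeps every expression even in `c`. -/
theorem integral_deriv_mul_cos (k : ℕ) {f : ℝ → ℝ} (hf : ContDiffOn ℝ 1 f (Ioo (-1) 1)) {c : ℝ}
    (hc : c ∈ Ioo (-1 : ℝ) 1) :
    ∫ t in (0 : ℝ)..(2 * Real.pi), Real.sin t ^ (2 * k) * (f (c * Real.cos t) * Real.cos t) =
      c / (2 * k + 1) * avg (k + 1) (deriv f) c := by
  have hcf : Continuous fun t => f (c * Real.cos t) :=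
    hf.continuousOn.comp_continuous (by fun_prop) (mul_cos_mem_Ioo hc)
  have hcf' : Continuous fun t => deriv f (c * Real.cos t) :=
    (hf.continuousOn_deriv_of_isOpen isOpen_Ioo le_rfl).comp_continuous (by fun_prop)
      (mul_cos_mem_Ioo hc)
  have hA : Continuous fun t => Real.sin t ^ (2 * k) * (f (c * Real.cos t) * Real.cos t) :=
    (Real.continuous_sin.pow _).mul (hcf.mul Real.continuous_cos)
  have hB : Continuous fun t => Real.sin t ^ (2 * (k + 1)) * deriv f (c * Real.cos t) :=
    (Real.continuous_sin.pow _).mul hcf'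
  have hA' := (continuous_const (y := 2 * (k : ℝ) + 1)).fun_mul hA
  have hB' := (continuous_const (y := c)).fun_mul hB
  have hd : ∀ t ∈ uIcc (0 : ℝ) (2 * Real.pi),
      HasDerivAt (fun t => Real.sin t ^ (2 * k + 1) * f (c * Real.cos t))
        ((2 * k + 1) * (Real.sin t ^ (2 * k) * (f (c * Real.cos t) * Real.cos t)) -
          c * (Real.sin t ^ (2 * (k + 1)) * deriv f (c * Real.cos t))) t := by
    intro t _
    have h1 : HasDerivAt f (deriv f (c * Real.cos t)) (c * Real.cos t) :=
      ((hf.contDiffAt (isOpen_Ioo.mem_nhds (mul_cos_mem_Ioo hc t))).differentiableAt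
        one_ne_zero).hasDerivAt
    have h2 := h1.comp t ((Real.hasDerivAt_cos t).const_mul c)
    refine (((Real.hasDerivAt_sin t).pow (2 * k + 1)).mul h2).congr_deriv ?_
    simp only [Function.comp_apply, Pi.pow_apply, Nat.add_sub_cancel]
    push_cast
    ring
  have h := intervalIntegral.integral_eq_sub_of_hasDerivAt hd
    ((hA'.sub hB').intervalIntegrable _ _)
  rw [intervalIntegral.integral_sub (hA'.intervalIntegrable _ _) (hB'.intervalIntegrable _ _),
    intervalIntegral.integral_const_mul,
    intervalIntegral.integral_const_mul] at h
  simp only [Real.sin_two_pi, Real.sin_zero, ne_eq, Nat.add_eq_zero_iff, one_ne_zero, and_false,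
    not_false_eq_true, zero_pow, zero_mul, sub_zero] at h
  rw [avg]
  have : (2 * (k : ℝ) + 1) ≠ 0 := by positivity
  rw [div_mul_eq_mul_div, eq_div_iff this]
  linear_combination h

theorem hasDerivAt_avg (k : ℕ) {f : ℝ → ℝ} (hf : ContDiffOn ℝ 2 f (Ioo (-1) 1)) {c : ℝ}
    (hc : c ∈ Ioo (-1 : ℝ) 1) :
    HasDerivAt (avg k f) (c / (2 * k + 1) * avg (k + 1) (deriv^[2] f) c) c := by
  refine (hasDerivAt_avg' k (hf.of_le (by norm_num)) hc).congr_deriv ?_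
  rw [integral_deriv_mul_cos k (hf.deriv_of_isOpen isOpen_Ioo (by norm_num)) hc]
  rfl

/-- `g(c) = α + β c² + o(c²)` as `c → 0+`. -/
def EvenJet (g : ℝ → ℝ) (α β : ℝ) : Prop :=
  Tendsto (fun c => (g c - α) / c ^ 2) (𝓝[>] 0) (𝓝 β)

theorem EvenJet.tendsto {g : ℝ → ℝ} {α β : ℝ} (h : EvenJet g α β) : Tendsto g (𝓝[>] 0) (𝓝 α) := by
  have h1 : Tendsto (fun c : ℝ => c ^ 2) (𝓝[>] 0) (𝓝 0) := by
    have : Tendsto (fun c : ℝ => c ^ 2) (𝓝 0) (𝓝 (0 ^ 2)) := (continuous_pow 2).tendsto 0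
    simpa using this.mono_left nhdsWithin_le_nhds
  have h2 := (h.mul h1).add_const α
  simp only [mul_zero, zero_add] at h2
  refine h2.congr' ?_
  filter_upwards [self_mem_nhdsWithin] with c hc
  have : c ≠ 0 := ne_of_gt hc
  field_simp
  ring

theorem EvenJet.congr {g h : ℝ → ℝ} {α β α' β' : ℝ} (hg : EvenJet g α β) (hgh : g = h)
    (hα : α = α') (hβ : β = β') : EvenJet h α' β' := by
  subst hgh hα hβ
  exact hg

theorem EvenJet.add {g h : ℝ → ℝ} {α β α' β' : ℝ} (hg : EvenJet g α β) (hh : EvenJet h α' β') :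
    EvenJet (fun c => g c + h c) (α + α') (β + β') := by
  refine (Tendsto.add hg hh).congr fun c => ?_
  ring

theorem EvenJet.sub {g h : ℝ → ℝ} {α β α' β' : ℝ} (hg : EvenJet g α β) (hh : EvenJet h α' β') :
    EvenJet (fun c => g c - h c) (α - α') (β - β') := by
  refine (Tendsto.sub hg hh).congr fun c => ?_
  ring

theorem EvenJet.mul {g h : ℝ → ℝ} {α β α' β' : ℝ} (hg : EvenJet g α β) (hh : EvenJet h α' β') :
    EvenJet (fun c => g c * h c) (α * α') (α * β' + β * α') := by
  refine ((hg.tendsto.mul hh).add (Tendsto.mul_const α' hg)).congr fun c => ?_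
  ring

theorem evenJet_one_sub_sq : EvenJet (fun c => 1 - c ^ 2) 1 (-1) := by
  refine tendsto_const_nhds.congr' ?_
  filter_upwards [self_mem_nhdsWithin] with c hc
  have : c ≠ 0 := ne_of_gt hc
  field_simp
  ring

/-- If either coefficient is nonzero, the function has no zeros in some right neighbourhood of `0`.
Zeros accumulating at `0` suffice, which matters because only the product of the two discriminants
is known to vanish. -/
theorem EvenJet.eq_zero_of_frequently {g : ℝ → ℝ} {α β : ℝ} (h : EvenJet g α β)
    (hz : ∃ᶠ c in 𝓝[>] 0, g c = 0) : α = 0 ∧ β = 0 := by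
  have hα : α = 0 := by
    by_contra hne
    exact hz (h.tendsto.eventually_ne hne)
  refine ⟨hα, ?_⟩
  subst hα
  by_contra hne
  refine hz ?_
  filter_upwards [Tendsto.eventually_ne h hne] with c hc h0
  simp [h0] at hc

/-- One application of l'Hôpital's rule: by `hasDerivAt_avg` the derivative carries a factor `c`,
which cancels against that of `2c`. -/
theorem evenJet_avg (k : ℕ) {f : ℝ → ℝ} (hf : ContDiffOn ℝ 2 f (Ioo (-1) 1)) :
    EvenJet (avg k f) (avg k f 0) (1 / (2 * (2 * k + 1)) * avg (k + 1) (deriv^[2] f) 0) := by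
  have h0 : (0 : ℝ) ∈ Ioo (-1 : ℝ) 1 := by norm_num
  have hf2 : ContDiffOn ℝ 0 (deriv^[2] f) (Ioo (-1) 1) :=
    (hf.deriv_of_isOpen isOpen_Ioo (m := 1) (by norm_num)).deriv_of_isOpen isOpen_Ioo
      (by norm_num)
  have hnear : ∀ᶠ c in 𝓝[>] (0 : ℝ), c ∈ Ioo (-1 : ℝ) 1 :=
    nhdsWithin_le_nhds (isOpen_Ioo.mem_nhds h0)
  have hc : ContinuousAt (avg k f) 0 :=
    (continuousOn_avg k hf.continuousOn).continuousAt (isOpen_Ioo.mem_nhds h0)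
  have hc2 : ContinuousAt (avg (k + 1) (deriv^[2] f)) 0 :=
    (continuousOn_avg (k + 1) hf2.continuousOn).continuousAt (isOpen_Ioo.mem_nhds h0)
  refine HasDerivAt.lhopital_zero_nhdsGT
    (f' := fun c => c / (2 * k + 1) * avg (k + 1) (deriv^[2] f) c) (g' := fun c => 2 * c)
    ?_ ?_ ?_ ?_ ?_ ?_
  · filter_upwards [hnear] with c h
    exact (hasDerivAt_avg k hf h).sub_const _
  · filter_upwards with c
    simpa using hasDerivAt_pow 2 c
  · filter_upwards [self_mem_nhdsWithin] with c h
    have : (0 : ℝ) < c := h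
    positivity
  · have := (hc.tendsto.sub_const (avg k f 0)).mono_left (nhdsWithin_le_nhds (s := Ioi 0))
    simpa using this
  · have : Tendsto (fun c : ℝ => c ^ 2) (𝓝 0) (𝓝 (0 ^ 2)) := (continuous_pow 2).tendsto 0
    simpa using this.mono_left nhdsWithin_le_nhds
  · have h1 := (hc2.tendsto.const_mul (1 / (2 * (2 * (k : ℝ) + 1)))).mono_left
      (nhdsWithin_le_nhds (s := Ioi 0))
    refine h1.congr' ?_
    filter_upwards [self_mem_nhdsWithin] with c h
    have : c ≠ 0 := ne_of_gt h
    field_simp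

theorem integral_sin_pow_add_two (m : ℕ) :
    ∫ t in (0 : ℝ)..(2 * Real.pi), Real.sin t ^ (m + 2) =
      (m + 1) / (m + 2) * ∫ t in (0 : ℝ)..(2 * Real.pi), Real.sin t ^ m := by
  rw [integral_sin_pow]
  simp

theorem avg_at_zero (f : ℝ → ℝ) : avg 0 f 0 = 2 * Real.pi * f 0 ∧ avg 1 f 0 = Real.pi * f 0 ∧
    avg 2 f 0 = 3 / 4 * Real.pi * f 0 := by
  have h1 := integral_sin_pow_add_two 0
  have h2 := integral_sin_pow_add_two 2
  simp only [avg, zero_mul, intervalIntegral.integral_mul_const]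
  norm_num at h1 h2 ⊢
  rw [h2, h1]
  exact Or.inl (by ring)

/-! ### Taylor coefficients of the weights at the equilibrium. -/

theorem hasDerivAt_eq_zero_of_eqOn {U : Set ℝ} (hU : IsOpen U) {F : ℝ → ℝ} {F' y : ℝ}
    (h0 : ∀ y ∈ U, F y = 0) (hy : y ∈ U) (h : HasDerivAt F F' y) : F' = 0 := by
  have h1 : HasDerivAt F 0 y := by
    refine (hasDerivAt_const y (0 : ℝ)).congr_of_eventuallyEq ?_
    filter_upwards [hU.mem_nhds hy] with w hw
    exact h0 w hw
  exact h.unique h1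

/-- The derivatives at the origin of a solution of `x x' eˣ = 2y`. -/
theorem jet_of_mul_deriv_mul_exp {U : Set ℝ} (hU : IsOpen U) (h0U : (0 : ℝ) ∈ U)
    {x0 x1 x2 x3 x4 x5 x6 : ℝ → ℝ}
    (h0 : ∀ y ∈ U, HasDerivAt x0 (x1 y) y) (h1 : ∀ y ∈ U, HasDerivAt x1 (x2 y) y)
    (h2 : ∀ y ∈ U, HasDerivAt x2 (x3 y) y) (h3 : ∀ y ∈ U, HasDerivAt x3 (x4 y) y)
    (h4 : ∀ y ∈ U, HasDerivAt x4 (x5 y) y) (h5 : ∀ y ∈ U, HasDerivAt x5 (x6 y) y)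
    (hx0 : x0 0 = 0) (hx1 : 0 < x1 0)
    (hode : ∀ y ∈ U, x0 y * x1 y * Real.exp (x0 y) = 2 * y) :
    x1 0 ^ 2 = 2 ∧ x2 0 = -4 / 3 ∧ x3 0 = 11 / 6 * x1 0 ∧ x4 0 = -344 / 45 ∧
      x5 0 = 769 / 36 * x1 0 := by
  have e1 : ∀ y ∈ U, (x1 y * x1 y + x0 y * x2 y + x0 y * x1 y ^ 2) * Real.exp (x0 y) - 2 = 0 := by
    intro y hy
    refine hasDerivAt_eq_zero_of_eqOn hU
      (F := fun y => x0 y * x1 y * Real.exp (x0 y) - 2 * y)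
      (fun w hw => by simp [hode w hw]) hy
      (((((h0 y hy).fun_mul (h1 y hy)).fun_mul (h0 y hy).exp).fun_sub
        ((hasDerivAt_id y).const_mul 2)).congr_deriv ?_)
    ring
  -- The nonvanishing exponential is divided out here, so that all further derivatives of the
  -- equation are polynomial relations.
  have e2 : ∀ y ∈ U,
      3 * (x0 y * x1 y * x2 y) + x0 y * x1 y ^ 3 + x0 y * x3 y + 3 * (x1 y * x2 y) + 2 * x1 y ^
        3 = 0 := by
    intro y hy
    refine (mul_eq_zero.1 (hasDerivAt_eq_zero_of_eqOn hU
      (F := fun y => (x1 y * x1 y + x0 y * x2 y + x0 y * x1 y ^ 2) * Real.exp (x0 y) - 2) e1 hy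
      (((((((h1 y hy).fun_mul (h1 y hy)).fun_add ((h0 y hy).fun_mul (h2 y hy))).fun_add
        ((h0 y hy).fun_mul ((h1 y hy).fun_pow 2))).fun_mul (h0 y hy).exp).sub_const 2).congr_deriv
        (f' := (_ : ℝ)) (g' := (3 * (x0 y * x1 y * x2 y) + x0 y * x1 y ^ 3 + x0 y * x3 y + 3 * (x1 y * x2 y) + 2 * x1
            y ^ 3) * Real.exp (x0 y)) ?_))).resolve_right (Real.exp_ne_zero _)
    simp only [Nat.cast_ofNat, Nat.add_one_sub_one]
    ring
  have e3 : ∀ y ∈ U,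
      3 * (x0 y * x1 y * x3 y) + 3 * (x0 y * x1 y ^ 2 * x2 y) + 3 * (x0 y * x2 y ^ 2) + x0 y *
        x4 y + 4 * (x1 y * x3 y) + 9 * (x1 y ^ 2 * x2 y) + x1 y ^ 4 + 3 * x2 y ^ 2 = 0 := by
    intro y hy
    refine hasDerivAt_eq_zero_of_eqOn hU e2 hy (HasDerivAt.congr_deriv
      ((((((((h0 y hy).fun_mul (h1 y hy)).fun_mul (h2 y hy)).const_mul (3)).fun_add ((h0 y
        hy).fun_mul ((h1 y hy).fun_pow 3))).fun_add ((h0 y hy).fun_mul (h3 y hy))).fun_add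
        (((h1 y hy).fun_mul (h2 y hy)).const_mul (3))).fun_add (((h1 y hy).fun_pow 3).const_mul
        (2))) ?_)
    simp only [Nat.cast_ofNat, Nat.add_one_sub_one]
    ring
  have e4 : ∀ y ∈ U,
      6 * (x0 y * x1 y * x2 y ^ 2) + 3 * (x0 y * x1 y * x4 y) + 3 * (x0 y * x1 y ^ 2 * x3 y) +
        9 * (x0 y * x2 y * x3 y) + x0 y * x5 y + 21 * (x1 y * x2 y ^ 2) + 5 * (x1 y * x4 y) +
        12 * (x1 y ^ 2 * x3 y) + 7 * (x1 y ^ 3 * x2 y) + 10 * (x2 y * x3 y) = 0 := by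
    intro y hy
    refine hasDerivAt_eq_zero_of_eqOn hU e3 hy (HasDerivAt.congr_deriv
      (((((((((((h0 y hy).fun_mul (h1 y hy)).fun_mul (h3 y hy)).const_mul (3)).fun_add ((((h0 y
        hy).fun_mul ((h1 y hy).fun_pow 2)).fun_mul (h2 y hy)).const_mul (3))).fun_add (((h0 y
        hy).fun_mul ((h2 y hy).fun_pow 2)).const_mul (3))).fun_add ((h0 y hy).fun_mul (h4 y
        hy))).fun_add (((h1 y hy).fun_mul (h3 y hy)).const_mul (4))).fun_add ((((h1 y
        hy).fun_pow 2).fun_mul (h2 y hy)).const_mul (9))).fun_add ((h1 y hy).fun_pow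
        4)).fun_add (((h2 y hy).fun_pow 2).const_mul (3))) ?_)
    simp only [Nat.cast_ofNat, Nat.add_one_sub_one]
    ring
  have e5 : ∀ y ∈ U,
      18 * (x0 y * x1 y * x2 y * x3 y) + 3 * (x0 y * x1 y * x5 y) + 3 * (x0 y * x1 y ^ 2 * x4
        y) + 12 * (x0 y * x2 y * x4 y) + 6 * (x0 y * x2 y ^ 3) + 9 * (x0 y * x3 y ^ 2) + x0 y *
        x6 y + 75 * (x1 y * x2 y * x3 y) + 6 * (x1 y * x5 y) + 27 * (x1 y ^ 2 * x2 y ^ 2) + 15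
        * (x1 y ^ 2 * x4 y) + 10 * (x1 y ^ 3 * x3 y) + 15 * (x2 y * x4 y) + 21 * x2 y ^ 3 + 10
        * x3 y ^ 2 = 0 := by
    intro y hy
    refine hasDerivAt_eq_zero_of_eqOn hU e4 hy (HasDerivAt.congr_deriv
      (((((((((((((h0 y hy).fun_mul (h1 y hy)).fun_mul ((h2 y hy).fun_pow 2)).const_mul
        (6)).fun_add ((((h0 y hy).fun_mul (h1 y hy)).fun_mul (h4 y hy)).const_mul (3))).fun_add
        ((((h0 y hy).fun_mul ((h1 y hy).fun_pow 2)).fun_mul (h3 y hy)).const_mul (3))).fun_add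
        ((((h0 y hy).fun_mul (h2 y hy)).fun_mul (h3 y hy)).const_mul (9))).fun_add ((h0 y
        hy).fun_mul (h5 y hy))).fun_add (((h1 y hy).fun_mul ((h2 y hy).fun_pow 2)).const_mul
        (21))).fun_add (((h1 y hy).fun_mul (h4 y hy)).const_mul (5))).fun_add ((((h1 y
        hy).fun_pow 2).fun_mul (h3 y hy)).const_mul (12))).fun_add ((((h1 y hy).fun_pow
        3).fun_mul (h2 y hy)).const_mul (7))).fun_add (((h2 y hy).fun_mul (h3 y hy)).const_mul
        (10))) ?_)
    simp only [Nat.cast_ofNat, Nat.add_one_sub_one]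
    ring
  have f1 := e1 0 h0U
  have f2 := e2 0 h0U
  have f3 := e3 0 h0U
  have f4 := e4 0 h0U
  have f5 := e5 0 h0U
  rw [hx0] at f1 f2 f3 f4 f5
  simp only [zero_mul, mul_zero, zero_add, add_zero, Real.exp_zero, mul_one] at f1 f2 f3 f4 f5
  -- At the origin all terms with `x0` drop out. The first relation gives `x1 0 ^ 2 = 2`; each later
  -- one is linear in the newest derivative, with coefficient a multiple of `x1 0`.
  have hne : x1 0 ≠ 0 := hx1.ne'
  have g1 : x1 0 ^ 2 = 2 := by linear_combination f1
  have g2 : x2 0 = -4 / 3 := by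
    refine mul_left_cancel₀ hne ?_
    linear_combination f2 / 3 - 2 / 3 * x1 0 * g1
  rw [g2] at f3 f4 f5
  have g3 : x3 0 = 11 / 6 * x1 0 := by
    refine mul_left_cancel₀ hne ?_
    linear_combination f3 / 4 + (1 - x1 0 ^ 2 / 4) * g1 - g1 / 3
  rw [g3] at f4 f5
  have g4 : x4 0 = -344 / 45 := by
    refine mul_left_cancel₀ hne ?_
    linear_combination f4 / 5 + x1 0 * (-22 / 5 + 28 / 15) * g1
  rw [g4] at f5
  refine ⟨g1, g2, g3, g4, ?_⟩
  refine mul_left_cancel₀ hne ?_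
  linear_combination f5 / 6 + (232 / 27 - 55 / 18 * x1 0 ^ 2) * g1

/-- The Birkhoff weight `μ(ε + x(y)/2) (x'(y)/2) e^{l x(y)}`. -/
noncomputable def weight (μ : ℝ → ℝ) (l ε y : ℝ) : ℝ :=
  μ (ε + lobe y / 2) * (deriv lobe y / 2) * Real.exp (l * lobe y)

/-- The second and the fourth derivative of `(g₀ x' / 2) e^{l x}`, where `gᵢ' = gᵢ₊₁ x' / 2`. -/
theorem iterate_deriv_mul_exp {U : Set ℝ} (hU : IsOpen U) (l : ℝ)
    {x0 x1 x2 x3 x4 x5 g0 g1 g2 g3 g4 : ℝ → ℝ}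
    (h0 : ∀ y ∈ U, HasDerivAt x0 (x1 y) y) (h1 : ∀ y ∈ U, HasDerivAt x1 (x2 y) y)
    (h2 : ∀ y ∈ U, HasDerivAt x2 (x3 y) y) (h3 : ∀ y ∈ U, HasDerivAt x3 (x4 y) y)
    (h4 : ∀ y ∈ U, HasDerivAt x4 (x5 y) y)
    (k0 : ∀ y ∈ U, HasDerivAt g0 (g1 y * (x1 y / 2)) y)
    (k1 : ∀ y ∈ U, HasDerivAt g1 (g2 y * (x1 y / 2)) y)
    (k2 : ∀ y ∈ U, HasDerivAt g2 (g3 y * (x1 y / 2)) y)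
    (k3 : ∀ y ∈ U, HasDerivAt g3 (g4 y * (x1 y / 2)) y) :
    EqOn (deriv^[2] fun y => g0 y * (x1 y / 2) * Real.exp (l * x0 y))
      (fun y => (
        (3/2) * l * (g0 y * x1 y * x2 y) + (1/2) * l ^ 2 * (g0 y * x1 y ^ 3) + (1/2) * (g0 y *
          x3 y) + (1/2) * l * (g1 y * x1 y ^ 3) + (3/4) * (g1 y * x1 y * x2 y) + (1/8) * (g2 y
          * x1 y ^ 3)) * Real.exp (l * x0 y)) U ∧
    EqOn (deriv^[4] fun y => g0 y * (x1 y / 2) * Real.exp (l * x0 y))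
      (fun y => (
        (5/2) * l * (g0 y * x1 y * x4 y) + 5 * l * (g0 y * x2 y * x3 y) + (15/2) * l ^ 2 * (g0
          y * x1 y * x2 y ^ 2) + 5 * l ^ 2 * (g0 y * x1 y ^ 2 * x3 y) + 5 * l ^ 3 * (g0 y * x1
          y ^ 3 * x2 y) + (1/2) * l ^ 4 * (g0 y * x1 y ^ 5) + (1/2) * (g0 y * x5 y) + (15/2) *
          l * (g1 y * x1 y * x2 y ^ 2) + 5 * l * (g1 y * x1 y ^ 2 * x3 y) + (15/2) * l ^ 2 *
          (g1 y * x1 y ^ 3 * x2 y) + l ^ 3 * (g1 y * x1 y ^ 5) + (5/4) * (g1 y * x1 y * x4 y) +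
          (5/2) * (g1 y * x2 y * x3 y) + (15/4) * l * (g2 y * x1 y ^ 3 * x2 y) + (3/4) * l ^ 2
          * (g2 y * x1 y ^ 5) + (15/8) * (g2 y * x1 y * x2 y ^ 2) + (5/4) * (g2 y * x1 y ^ 2 *
          x3 y) + (1/4) * l * (g3 y * x1 y ^ 5) + (5/8) * (g3 y * x1 y ^ 3 * x2 y) + (1/32) *
          (g4 y * x1 y ^ 5)) * Real.exp (l * x0 y)) U := by
  -- With the factor `e^(l x)` kept outside, differentiation acts on the prefactor by `p ↦ p' + l x'
  -- p`.
  have step : ∀ {f p : ℝ → ℝ} {q : ℝ → ℝ},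
      EqOn f (fun y => p y * Real.exp (l * x0 y)) U →
      (∀ y ∈ U, HasDerivAt p (q y - l * x1 y * p y) y) →
      EqOn (deriv f) (fun y => q y * Real.exp (l * x0 y)) U := by
    intro f p q hf hp y hy
    have e : f =ᶠ[𝓝 y] fun y => p y * Real.exp (l * x0 y) := by
      filter_upwards [hU.mem_nhds hy] with w hw
      exact hf hw
    rw [e.deriv_eq]
    refine (((hp y hy).fun_mul ((h0 y hy).const_mul l).exp).congr_deriv ?_).deriv
    ring
  have s0 : EqOn (fun y => g0 y * (x1 y / 2) * Real.exp (l * x0 y))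
      (fun y => (
        (1/2) * (g0 y * x1 y)) * Real.exp (l * x0 y)) U := by
    intro y _
    ring_nf
  have s1 := step (q := fun y =>
      (1/2) * l * (g0 y * x1 y ^ 2) + (1/2) * (g0 y * x2 y) + (1/4) * (g1 y * x1 y ^ 2)) s0 (fun y hy => HasDerivAt.congr_deriv
      (((k0 y hy).fun_mul (h1 y hy)).const_mul ((1/2))) (by
        ring))
  have s2 := step (q := fun y =>
      (3/2) * l * (g0 y * x1 y * x2 y) + (1/2) * l ^ 2 * (g0 y * x1 y ^ 3) + (1/2) * (g0 y * x3
        y) + (1/2) * l * (g1 y * x1 y ^ 3) + (3/4) * (g1 y * x1 y * x2 y) + (1/8) * (g2 y * x1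
        y ^ 3)) s1 (fun y hy => HasDerivAt.congr_deriv
      (((((k0 y hy).fun_mul ((h1 y hy).fun_pow 2)).const_mul ((1/2) * l)).fun_add (((k0 y
        hy).fun_mul (h2 y hy)).const_mul ((1/2)))).fun_add (((k1 y hy).fun_mul ((h1 y
        hy).fun_pow 2)).const_mul ((1/4)))) (by
        simp only [Nat.cast_ofNat, Nat.add_one_sub_one]
        ring))
  have s3 := step (q := fun y =>
      2 * l * (g0 y * x1 y * x3 y) + (3/2) * l * (g0 y * x2 y ^ 2) + 3 * l ^ 2 * (g0 y * x1 y ^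
        2 * x2 y) + (1/2) * l ^ 3 * (g0 y * x1 y ^ 4) + (1/2) * (g0 y * x4 y) + 3 * l * (g1 y *
        x1 y ^ 2 * x2 y) + (3/4) * l ^ 2 * (g1 y * x1 y ^ 4) + g1 y * x1 y * x3 y + (3/4) * (g1
        y * x2 y ^ 2) + (3/8) * l * (g2 y * x1 y ^ 4) + (3/4) * (g2 y * x1 y ^ 2 * x2 y) +
        (1/16) * (g3 y * x1 y ^ 4)) s2 (fun y hy => HasDerivAt.congr_deriv
      (((((((((k0 y hy).fun_mul (h1 y hy)).fun_mul (h2 y hy)).const_mul ((3/2) * l)).fun_add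
        (((k0 y hy).fun_mul ((h1 y hy).fun_pow 3)).const_mul ((1/2) * l ^ 2))).fun_add (((k0 y
        hy).fun_mul (h3 y hy)).const_mul ((1/2)))).fun_add (((k1 y hy).fun_mul ((h1 y
        hy).fun_pow 3)).const_mul ((1/2) * l))).fun_add ((((k1 y hy).fun_mul (h1 y hy)).fun_mul
        (h2 y hy)).const_mul ((3/4)))).fun_add (((k2 y hy).fun_mul ((h1 y hy).fun_pow
        3)).const_mul ((1/8)))) (by
        simp only [Nat.cast_ofNat, Nat.add_one_sub_one]
        ring))
  have s4 := step (q := fun y =>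
      (5/2) * l * (g0 y * x1 y * x4 y) + 5 * l * (g0 y * x2 y * x3 y) + (15/2) * l ^ 2 * (g0 y
        * x1 y * x2 y ^ 2) + 5 * l ^ 2 * (g0 y * x1 y ^ 2 * x3 y) + 5 * l ^ 3 * (g0 y * x1 y ^
        3 * x2 y) + (1/2) * l ^ 4 * (g0 y * x1 y ^ 5) + (1/2) * (g0 y * x5 y) + (15/2) * l *
        (g1 y * x1 y * x2 y ^ 2) + 5 * l * (g1 y * x1 y ^ 2 * x3 y) + (15/2) * l ^ 2 * (g1 y *
        x1 y ^ 3 * x2 y) + l ^ 3 * (g1 y * x1 y ^ 5) + (5/4) * (g1 y * x1 y * x4 y) + (5/2) *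
        (g1 y * x2 y * x3 y) + (15/4) * l * (g2 y * x1 y ^ 3 * x2 y) + (3/4) * l ^ 2 * (g2 y *
        x1 y ^ 5) + (15/8) * (g2 y * x1 y * x2 y ^ 2) + (5/4) * (g2 y * x1 y ^ 2 * x3 y) +
        (1/4) * l * (g3 y * x1 y ^ 5) + (5/8) * (g3 y * x1 y ^ 3 * x2 y) + (1/32) * (g4 y * x1
        y ^ 5)) s3 (fun y hy => HasDerivAt.congr_deriv
      (((((((((((((((k0 y hy).fun_mul (h1 y hy)).fun_mul (h3 y hy)).const_mul (2 * l)).fun_add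
        (((k0 y hy).fun_mul ((h2 y hy).fun_pow 2)).const_mul ((3/2) * l))).fun_add ((((k0 y
        hy).fun_mul ((h1 y hy).fun_pow 2)).fun_mul (h2 y hy)).const_mul (3 * l ^ 2))).fun_add
        (((k0 y hy).fun_mul ((h1 y hy).fun_pow 4)).const_mul ((1/2) * l ^ 3))).fun_add (((k0 y
        hy).fun_mul (h4 y hy)).const_mul ((1/2)))).fun_add ((((k1 y hy).fun_mul ((h1 y
        hy).fun_pow 2)).fun_mul (h2 y hy)).const_mul (3 * l))).fun_add (((k1 y hy).fun_mul ((h1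
        y hy).fun_pow 4)).const_mul ((3/4) * l ^ 2))).fun_add (((k1 y hy).fun_mul (h1 y
        hy)).fun_mul (h3 y hy))).fun_add (((k1 y hy).fun_mul ((h2 y hy).fun_pow 2)).const_mul
        ((3/4)))).fun_add (((k2 y hy).fun_mul ((h1 y hy).fun_pow 4)).const_mul ((3/8) *
        l))).fun_add ((((k2 y hy).fun_mul ((h1 y hy).fun_pow 2)).fun_mul (h2 y hy)).const_mul
        ((3/4)))).fun_add (((k3 y hy).fun_mul ((h1 y hy).fun_pow 4)).const_mul ((1/16)))) (by
        simp only [Nat.cast_ofNat, Nat.add_one_sub_one]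
        ring))
  exact ⟨s2, s4⟩

theorem contDiffOn_weight {n : ℕ∞} {μ : ℝ → ℝ} (hμ : ContDiff ℝ n μ) (l : ℝ) :
    ContDiffOn ℝ n (Function.uncurry (weight μ l)) (univ ×ˢ Ioo (-1) 1) := by
  have h1 : ContDiffOn ℝ n (fun z : ℝ × ℝ => lobe z.2) (univ ×ˢ Ioo (-1) 1) :=
    contDiffOn_lobe.comp contDiffOn_snd fun z hz => hz.2
  have h2 : ContDiffOn ℝ n (fun z : ℝ × ℝ => deriv lobe z.2) (univ ×ˢ Ioo (-1) 1) :=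
    (contDiffOn_iterate_deriv_lobe 1).comp contDiffOn_snd fun z hz => hz.2
  have h3 : ContDiffOn ℝ n (fun z : ℝ × ℝ => z.1 + lobe z.2 / 2) (univ ×ˢ Ioo (-1) 1) :=
    contDiffOn_fst.add (h1.div_const 2)
  exact ((hμ.comp_contDiffOn h3).mul (h2.div_const 2)).mul ((contDiffOn_const.mul h1).exp)

theorem contDiffOn_weight_right {n : ℕ∞} {μ : ℝ → ℝ} (hμ : ContDiff ℝ n μ) (l ε : ℝ) :
    ContDiffOn ℝ n (weight μ l ε) (Ioo (-1) 1) := by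
  have h : ContDiffOn ℝ n (fun y : ℝ => (ε, y)) (Ioo (-1) 1) := by fun_prop
  exact (contDiffOn_weight hμ l).comp h fun y hy => ⟨mem_univ _, hy⟩

theorem contDiff_iterate_deriv {n : ℕ} {μ : ℝ → ℝ} (k : ℕ) (hμ : ContDiff ℝ (n + k : ℕ) μ) :
    ContDiff ℝ n (deriv^[k] μ) := by
  induction k generalizing n with
  | zero => simpa using hμ
  | succ k ih =>
    rw [Function.iterate_succ_apply']
    have h1 : ContDiff ℝ ((n + 1 : ℕ) : WithTop ℕ∞) (deriv^[k] μ) := by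
      refine ih ?_
      rwa [add_assoc, add_comm 1 k]
    exact_mod_cast (contDiff_succ_iff_deriv.1 (by exact_mod_cast h1)).2.2

theorem hasDerivAt_iterate_deriv {μ : ℝ → ℝ} {N : ℕ} (hμ : ContDiff ℝ N μ) {k : ℕ} (hk : k < N)
    (u : ℝ) : HasDerivAt (deriv^[k] μ) (deriv^[k + 1] μ u) u := by
  rw [Function.iterate_succ_apply']
  have h : ContDiff ℝ 1 (deriv^[k] μ) :=
    contDiff_iterate_deriv k (hμ.of_le (by norm_cast; omega))
  exact (h.differentiable one_ne_zero u).hasDerivAt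

theorem weight_zero (μ : ℝ → ℝ) (l ε : ℝ) : weight μ l ε 0 = deriv lobe 0 / 2 * μ ε := by
  simp [weight, lobe_zero]
  ring

/-- The second and the fourth derivative of the weights at the origin. -/
theorem iterate_deriv_weight_zero {μ : ℝ → ℝ} (hμ : ContDiff ℝ 4 μ) (l ε : ℝ) :
    deriv^[2] (weight μ l ε) 0 = deriv lobe 0 * ((l ^ 2 - 2 * l + 11 / 12) * μ ε +
      (l - 1) * deriv^[1] μ ε + 1 / 4 * deriv^[2] μ ε) ∧
    deriv^[4] (weight μ l ε) 0 = deriv lobe 0 *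
      ((2 * l ^ 4 - 40 / 3 * l ^ 3 + 95 / 3 * l ^ 2 - 94 / 3 * l + 769 / 72) * μ ε +
        (4 * l ^ 3 - 20 * l ^ 2 + 95 / 3 * l - 47 / 3) * deriv^[1] μ ε +
        (3 * l ^ 2 - 10 * l + 95 / 12) * deriv^[2] μ ε + (l - 5 / 3) * deriv^[3] μ ε +
        1 / 8 * deriv^[4] μ ε) := by
  have h0 : (0 : ℝ) ∈ Ioo (-1 : ℝ) 1 := by norm_num
  obtain ⟨s1, s2, s3, s4, s5⟩ := jet_of_mul_deriv_mul_exp isOpen_Ioo h0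
    (fun y => hasDerivAt_iterate_deriv_lobe 0)
    (fun y => hasDerivAt_iterate_deriv_lobe 1) (fun y => hasDerivAt_iterate_deriv_lobe 2)
    (fun y => hasDerivAt_iterate_deriv_lobe 3) (fun y => hasDerivAt_iterate_deriv_lobe 4)
    (fun y => hasDerivAt_iterate_deriv_lobe 5) lobe_zero (deriv_lobe_pos h0)
    fun y => lobe_mul_deriv
  have hg : ∀ k < 4, ∀ y ∈ Ioo (-1 : ℝ) 1, HasDerivAt (fun y => deriv^[k] μ (ε + lobe y / 2))
      (deriv^[k + 1] μ (ε + lobe y / 2) * (deriv lobe y / 2)) y := by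
    intro k hk y hy
    exact (hasDerivAt_iterate_deriv (N := 4) hμ hk _).comp y
      (((hasDerivAt_lobe hy).div_const 2).const_add ε)
  obtain ⟨d2, d4⟩ := iterate_deriv_mul_exp isOpen_Ioo l
    (fun y => hasDerivAt_iterate_deriv_lobe 0)
    (fun y => hasDerivAt_iterate_deriv_lobe 1) (fun y => hasDerivAt_iterate_deriv_lobe 2)
    (fun y => hasDerivAt_iterate_deriv_lobe 3) (fun y => hasDerivAt_iterate_deriv_lobe 4)
    (hg 0 (by norm_num)) (hg 1 (by norm_num)) (hg 2 (by norm_num)) (hg 3 (by norm_num))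
  have d2 := d2 h0
  have d4 := d4 h0
  simp only [lobe_zero, Function.iterate_zero, id, Function.iterate_succ, Function.comp_apply,
    mul_zero, Real.exp_zero, mul_one, zero_div, add_zero, zero_add] at *
  constructor
  · refine d2.trans ?_
    rw [s2, s3]
    linear_combination (l ^ 2 / 2 * μ ε + l / 2 * deriv μ ε + deriv (deriv μ) ε / 8) *
      deriv lobe 0 * s1
  · refine d4.trans ?_
    rw [s2, s3, s4, s5]
    set s := deriv lobe 0
    -- Since `s² = 2`, odd powers of `s` reduce to multiples of `s`, which is the common factor of
    -- the formula.
    have s3 : s ^ 3 = 2 * s := by linear_combination s * s1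
    have s5 : s ^ 5 = 4 * s := by linear_combination s * (s ^ 2 + 2) * s1
    ring_nf
    rw [s5, s3]
    ring

/-! ### The two discriminants and their behaviour near the equilibria. -/

/-- The obstruction to iso-energetic non-degeneracy. -/
noncomputable def isoDiscr (μ : ℝ → ℝ) (ε c : ℝ) : ℝ :=
  (1 - c ^ 2) * avg 1 (deriv^[2] (weight μ 0 ε)) c - avg 0 (weight μ 0 ε) c

/-- The obstruction to Kolmogorov non-degeneracy. -/
noncomputable def kolDiscr (μ : ℝ → ℝ) (ε c : ℝ) : ℝ :=
  (avg 0 (weight μ 1 ε) c + avg 0 (weight (deriv μ) 1 ε) c +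
      (1 - c ^ 2) * avg 1 (deriv^[2] (weight μ 1 ε)) c) * isoDiscr μ ε c -
    (1 - c ^ 2) * (avg 1 (deriv^[2] (weight μ 1 ε)) c * avg 1 (deriv^[2] (weight μ 1 ε)) c)

theorem evenJet_avg_zero_weight {μ : ℝ → ℝ} (hμ : ContDiff ℝ 4 μ) (l ε : ℝ) :
    EvenJet (avg 0 (weight μ l ε)) (Real.pi * deriv lobe 0 * μ ε)
      (1 / 2 * Real.pi * deriv^[2] (weight μ l ε) 0) := by
  have hw := contDiffOn_weight_right (n := 2) (hμ.of_le (by norm_num)) l ε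
  refine (evenJet_avg 0 hw).congr rfl ?_ ?_
  · rw [(avg_at_zero _).1, weight_zero]
    ring
  · rw [zero_add, (avg_at_zero _).2.1]
    norm_num
    ring

theorem evenJet_avg_one_weight {μ : ℝ → ℝ} (hμ : ContDiff ℝ 4 μ) (l ε : ℝ) :
    EvenJet (avg 1 (deriv^[2] (weight μ l ε))) (Real.pi * deriv^[2] (weight μ l ε) 0)
      (1 / 8 * Real.pi * deriv^[4] (weight μ l ε) 0) := by
  have hw := contDiffOn_weight_right (n := 4) hμ l ε
  have hw2 : ContDiffOn ℝ 2 (deriv^[2] (weight μ l ε)) (Ioo (-1) 1) :=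
    (hw.deriv_of_isOpen isOpen_Ioo (m := 3) (by norm_num)).deriv_of_isOpen isOpen_Ioo
      (by norm_num)
  refine (evenJet_avg 1 hw2).congr rfl (avg_at_zero _).2.1 ?_
  rw [(avg_at_zero _).2.2, ← Function.iterate_add_apply]
  norm_num
  ring

theorem evenJet_isoDiscr {μ : ℝ → ℝ} (hμ : ContDiff ℝ 4 μ) (ε : ℝ) :
    EvenJet (isoDiscr μ ε)
      (Real.pi * deriv lobe 0 / 2 *
        (-1 / 6 * μ ε - 2 * deriv^[1] μ ε + 1 / 2 * deriv^[2] μ ε))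
      (Real.pi * deriv lobe 0 / 2 *
        (-23 / 288 * μ ε - 11 / 12 * deriv^[1] μ ε + 59 / 48 * deriv^[2] μ ε -
          5 / 12 * deriv^[3] μ ε + 1 / 32 * deriv^[4] μ ε)) := by
  obtain ⟨w2, w4⟩ := iterate_deriv_weight_zero hμ 0 ε
  refine ((evenJet_one_sub_sq.mul (evenJet_avg_one_weight hμ 0 ε)).sub
    (evenJet_avg_zero_weight hμ 0 ε)).congr rfl ?_ ?_
  · rw [w2]
    ring
  · rw [w2, w4]
    ring

/-- Five derivatives are asked of `μ` because a weight built on `deriv μ` enters, and its jet is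
taken from the lemma for four times differentiable functions. -/
theorem evenJet_kolDiscr {μ : ℝ → ℝ} (hμ : ContDiff ℝ 5 μ) (ε : ℝ) :
    EvenJet (kolDiscr μ ε)
      ((Real.pi * deriv lobe 0 / 2) ^ 2 *
        (-1 / 3 * μ ε ^ 2 - 4 * μ ε * deriv^[1] μ ε + μ ε * deriv^[2] μ ε -
          4 * deriv^[1] μ ε ^ 2))
      ((Real.pi * deriv lobe 0 / 2) ^ 2 *
        (-7 / 48 * μ ε ^ 2 - 11 / 6 * μ ε * deriv^[1] μ ε + 53 / 24 * μ ε * deriv^[2] μ ε -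
          5 / 6 * μ ε * deriv^[3] μ ε + 1 / 16 * μ ε * deriv^[4] μ ε -
          5 / 3 * deriv^[1] μ ε ^ 2 + 2 * deriv^[1] μ ε * deriv^[2] μ ε -
          deriv^[1] μ ε * deriv^[3] μ ε + 5 / 8 * deriv^[2] μ ε ^ 2)) := by
  have h4 : ContDiff ℝ 4 μ := hμ.of_le (by norm_num)
  have h4' : ContDiff ℝ 4 (deriv μ) := contDiff_iterate_deriv (n := 4) 1 hμ
  obtain ⟨w2, w4⟩ := iterate_deriv_weight_zero h4 1 ε
  obtain ⟨v2, -⟩ := iterate_deriv_weight_zero h4' 1 ε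
  have hB := evenJet_avg_one_weight h4 1 ε
  refine (((((evenJet_avg_zero_weight h4 1 ε).add (evenJet_avg_zero_weight h4' 1 ε)).add
    (evenJet_one_sub_sq.mul hB)).mul (evenJet_isoDiscr h4 ε)).sub
    (evenJet_one_sub_sq.mul (hB.mul hB))).congr rfl ?_ ?_
  · rw [w2]
    simp only [Function.iterate_succ, Function.iterate_zero, Function.comp_apply, id]
    ring
  · rw [w2, w4, v2]
    simp only [Function.iterate_succ, Function.iterate_zero, Function.comp_apply, id]
    ring

/-- The first equation and its two derivatives allow `m2`, `m3`, `m4` to be eliminated from the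
second one. What remains is of first order with constant coefficients, and its solutions,
exponentials of rate `-1/13`, do not satisfy the first equation. -/
theorem not_isoDiscr_degenerate {m0 m1 m2 m3 m4 : ℝ → ℝ} {W : Set ℝ} (hW : IsOpen W)
    (h0 : ∀ u, HasDerivAt m0 (m1 u) u) (h1 : ∀ u, HasDerivAt m1 (m2 u) u)
    (h2 : ∀ u, HasDerivAt m2 (m3 u) u) (h3 : ∀ u, HasDerivAt m3 (m4 u) u)
    (e0 : ∀ u ∈ W, -1 / 6 * m0 u - 2 * m1 u + 1 / 2 * m2 u = 0)
    (e1 : ∀ u ∈ W, -23 / 288 * m0 u - 11 / 12 * m1 u + 59 / 48 * m2 u - 5 / 12 * m3 u +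
      1 / 32 * m4 u = 0) {u : ℝ} (hu : u ∈ W) : m0 u = 0 := by
  have d1 : ∀ u ∈ W, -1 / 6 * m1 u - 2 * m2 u + 1 / 2 * m3 u = 0 := fun u hu =>
    hasDerivAt_eq_zero_of_eqOn hW e0 hu
      ((((h0 u).const_mul (-1 / 6)).fun_sub ((h1 u).const_mul 2)).fun_add
        ((h2 u).const_mul (1 / 2)))
  have d2 : ∀ u ∈ W, -1 / 6 * m2 u - 2 * m3 u + 1 / 2 * m4 u = 0 := fun u hu =>
    hasDerivAt_eq_zero_of_eqOn hW d1 hu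
      ((((h1 u).const_mul (-1 / 6)).fun_sub ((h2 u).const_mul 2)).fun_add
        ((h3 u).const_mul (1 / 2)))
  have d3 : ∀ u ∈ W, m0 u + 13 * m1 u = 0 := by
    intro u hu
    have a0 := e0 u hu
    have a1 := e1 u hu
    have a2 := d1 u hu
    have a3 := d2 u hu
    linarith
  have d4 : m1 u + 13 * m2 u = 0 :=
    hasDerivAt_eq_zero_of_eqOn hW d3 hu ((h0 u).fun_add ((h1 u).const_mul 13))
  have a0 := e0 u hu
  have a1 := d3 u hu
  linarith

/-- The equations are homogeneous, so they are rewritten for `x = m1 / m0`. The first and its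
derivatives express `m2`, `m3`, `m4` as polynomials in `x` times `m0`; the second then becomes a
quartic equation for `x`. Differentiating the quartic along `x' = 3x² + 4x + 1/3` shows that `x` is
also a root of its derivative or of this polynomial, and neither has a real root in common with the
quartic. -/
theorem not_kolDiscr_degenerate {m0 m1 m2 m3 m4 : ℝ → ℝ} {W : Set ℝ} (hW : IsOpen W)
    (hpos : ∀ u, 0 < m0 u)
    (h0 : ∀ u, HasDerivAt m0 (m1 u) u) (h1 : ∀ u, HasDerivAt m1 (m2 u) u)
    (h2 : ∀ u, HasDerivAt m2 (m3 u) u) (h3 : ∀ u, HasDerivAt m3 (m4 u) u)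
    (e0 : ∀ u ∈ W, -1 / 3 * m0 u ^ 2 - 4 * m0 u * m1 u + m0 u * m2 u - 4 * m1 u ^ 2 = 0)
    (e1 : ∀ u ∈ W, -7 / 48 * m0 u ^ 2 - 11 / 6 * m0 u * m1 u + 53 / 24 * m0 u * m2 u -
      5 / 6 * m0 u * m3 u + 1 / 16 * m0 u * m4 u - 5 / 3 * m1 u ^ 2 + 2 * m1 u * m2 u -
      m1 u * m3 u + 5 / 8 * m2 u ^ 2 = 0) {u : ℝ} (hu : u ∈ W) : False := by
  have hx : ∀ u, HasDerivAt (fun u => m1 u / m0 u) ((m2 u * m0 u - m1 u * m1 u) / m0 u ^ 2) u :=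
    fun u => (h1 u).fun_div (h0 u) (hpos u).ne'
  have d1 : ∀ u ∈ W, -1 / 3 * (2 * (m0 u * m1 u)) - 4 * (m1 u * m1 u + m0 u * m2 u) +
      (m1 u * m2 u + m0 u * m3 u) - 4 * (2 * (m1 u * m2 u)) = 0 := fun u hu =>
    hasDerivAt_eq_zero_of_eqOn hW e0 hu
      ((((((h0 u).fun_pow 2).const_mul (-1 / 3)).fun_sub
        (((h0 u).const_mul 4).fun_mul (h1 u))).fun_add ((h0 u).fun_mul (h2 u))).fun_sub
        (((h1 u).fun_pow 2).const_mul 4) |>.congr_deriv (by push_cast; ring))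
  have d2 : ∀ u ∈ W, -1 / 3 * (2 * (m1 u * m1 u + m0 u * m2 u)) -
      4 * (2 * (m1 u * m2 u) + (m1 u * m2 u + m0 u * m3 u)) +
      (m2 u * m2 u + m1 u * m3 u + (m1 u * m3 u + m0 u * m4 u)) -
      4 * (2 * (m2 u * m2 u + m1 u * m3 u)) = 0 := fun u hu =>
    hasDerivAt_eq_zero_of_eqOn hW d1 hu
      (((((((h0 u).fun_mul (h1 u)).const_mul 2).const_mul (-1 / 3)).fun_sub
        ((((h1 u).fun_mul (h1 u)).fun_add ((h0 u).fun_mul (h2 u))).const_mul 4)).fun_add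
        (((h1 u).fun_mul (h2 u)).fun_add ((h0 u).fun_mul (h3 u)))).fun_sub
        ((((h1 u).fun_mul (h2 u)).const_mul 2).const_mul 4) |>.congr_deriv (by ring))
  have s : ∀ u ∈ W, m1 u = m1 u / m0 u * m0 u ∧
      m2 u = (4 * (m1 u / m0 u) ^ 2 + 4 * (m1 u / m0 u) + 1 / 3) * m0 u := by
    intro u hu
    have hne := (hpos u).ne'
    refine ⟨by field_simp, ?_⟩
    have := e0 u hu
    field_simp
    linarith
  have p : ∀ u ∈ W, 9 * (m1 u / m0 u) ^ 4 + 24 * (m1 u / m0 u) ^ 3 + 30 * (m1 u / m0 u) ^ 2 +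
      18 * (m1 u / m0 u) + 1 = 0 := by
    intro u hu
    have hne := (hpos u).ne'
    obtain ⟨s1, s2⟩ := s u hu
    have a1 := d1 u hu
    have a2 := d2 u hu
    have a3 := e1 u hu
    set x := m1 u / m0 u
    rw [s1, s2] at a1
    have s3 : m3 u = (2 / 3 * x + 4 * x ^ 2 + 4 * (4 * x ^ 2 + 4 * x + 1 / 3) +
        7 * x * (4 * x ^ 2 + 4 * x + 1 / 3)) * m0 u := by
      refine mul_left_cancel₀ hne ?_
      linear_combination a1
    rw [s1, s2, s3] at a2
    set y := 4 * x ^ 2 + 4 * x + 1 / 3 with hy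
    set z := 2 / 3 * x + 4 * x ^ 2 + 4 * y + 7 * x * y with hz
    have s4 : m4 u = (2 / 3 * (x ^ 2 + y) + 12 * x * y + 4 * z + 6 * x * z + 7 * y ^ 2) *
        m0 u := by
      refine mul_left_cancel₀ hne ?_
      linear_combination a2
    rw [s1, s2, s3, s4] at a3
    refine mul_left_cancel₀ (pow_ne_zero 2 hne) ?_
    rw [hz, hy] at a3
    linear_combination (-18) * a3
  have hne := (hpos u).ne'
  have q : (36 * (m1 u / m0 u) ^ 3 + 72 * (m1 u / m0 u) ^ 2 + 60 * (m1 u / m0 u) + 18) *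
      ((m2 u * m0 u - m1 u * m1 u) / m0 u ^ 2) = 0 :=
    hasDerivAt_eq_zero_of_eqOn hW p hu
      ((((((hx u).fun_pow 4).const_mul 9).fun_add (((hx u).fun_pow 3).const_mul 24)).fun_add
        (((hx u).fun_pow 2).const_mul 30)).fun_add ((hx u).const_mul 18) |>.add_const 1
        |>.congr_deriv (by push_cast; ring))
  obtain ⟨s1, s2⟩ := s u hu
  have hp := p u hu
  have e : (m2 u * m0 u - m1 u * m1 u) / m0 u ^ 2 =
      3 * (m1 u / m0 u) ^ 2 + 4 * (m1 u / m0 u) + 1 / 3 := by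
    rw [s2]
    field_simp
    ring
  rw [e] at q
  set x := m1 u / m0 u
  rcases mul_eq_zero.1 q with q | q
  -- Remainder of the quartic modulo its derivative.
  · have r1 : 3 * x ^ 2 + 7 / 2 * x - 2 = 0 := by
      linear_combination hp - (x / 4 + 1 / 6) * q
    nlinarith [sq_nonneg x]
  -- Remainder of the quartic modulo `3x² + 4x + 1/3`; its root `-2/3` makes this polynomial equal
  -- to `-1`.
  · have r1 : -2 / 3 * x - 4 / 9 = 0 := by
      linear_combination hp - (3 * x ^ 2 + 4 * x + 13 / 3) * q
    have r2 : x = -2 / 3 := by linarith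
    rw [r2] at q
    norm_num at q

/-- The points where neither obstruction vanishes accumulate at the equilibria `c = 0`. -/
theorem mem_closure_nondegenerate {μ : ℝ → ℝ} (hμ : ContDiff ℝ 5 μ) (hpos : ∀ u, 0 < μ u)
    (ε₀ : ℝ) : (ε₀, (0 : ℝ)) ∈ closure {x : ℝ × ℝ | x.2 ∈ Ioo (0 : ℝ) 1 ∧
      isoDiscr μ x.1 x.2 ≠ 0 ∧ kolDiscr μ x.1 x.2 ≠ 0} := by
  have h4 : ContDiff ℝ 4 μ := hμ.of_le (by norm_num)
  have hd : ∀ k < 5, ∀ u, HasDerivAt (deriv^[k] μ) (deriv^[k + 1] μ u) u :=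
    fun k hk u => hasDerivAt_iterate_deriv (N := 5) hμ hk u
  have hcont : ∀ k < 5, Continuous (deriv^[k] μ) := fun k hk =>
    continuous_iff_continuousAt.2 fun u => (hd k hk u).continuousAt
  have c0 : Continuous μ := hcont 0 (by norm_num)
  have c1 := hcont 1 (by norm_num)
  have c2 := hcont 2 (by norm_num)
  have c3 := hcont 3 (by norm_num)
  have c4 := hcont 4 (by norm_num)
  by_contra hcl
  obtain ⟨δ, hδ, hball⟩ := Metric.mem_nhds_iff.1 (isOpen_compl_iff.2 isClosed_closure |>.mem_nhds hcl)
  have hzero : ∀ ε ∈ Metric.ball ε₀ δ, ∀ᶠ c in 𝓝[>] (0 : ℝ),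
      isoDiscr μ ε c = 0 ∨ kolDiscr μ ε c = 0 := by
    intro ε hε
    have h1 : Ioo (0 : ℝ) (min δ 1) ∈ 𝓝[>] (0 : ℝ) := Ioo_mem_nhdsGT (by positivity)
    filter_upwards [h1] with c hc
    have hmem : (ε, c) ∈ Metric.ball (ε₀, (0 : ℝ)) δ := by
      rw [← ball_prod_same]
      refine ⟨hε, ?_⟩
      rw [Metric.mem_ball, Real.dist_eq, sub_zero, abs_of_pos hc.1]
      exact hc.2.trans_le (min_le_left _ _)
    have hn := fun h => hball hmem (subset_closure h)
    by_contra hne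
    push Not at hne
    exact hn ⟨⟨hc.1, hc.2.trans_le (min_le_right _ _)⟩, hne⟩
  have hs : Real.pi * deriv lobe 0 / 2 ≠ 0 := by
    have := deriv_lobe_pos (y := 0) (by norm_num)
    positivity
  -- The energies at which the jet of `isoDiscr` vanishes. `A` is closed, so either it contains the
  -- whole ball or its complement in the ball is open and nonempty, which leaves an open set on
  -- which one pair of differential equations holds.
  let A : Set ℝ := {ε | -1 / 6 * μ ε - 2 * deriv^[1] μ ε + 1 / 2 * deriv^[2] μ ε = 0 ∧
    -23 / 288 * μ ε - 11 / 12 * deriv^[1] μ ε + 59 / 48 * deriv^[2] μ ε -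
          5 / 12 * deriv^[3] μ ε + 1 / 32 * deriv^[4] μ ε = 0}
  have hA : IsClosed A := by
    refine IsClosed.inter (isClosed_eq ?_ continuous_const) (isClosed_eq ?_ continuous_const)
    · fun_prop
    · fun_prop
  have hK : ∀ ε ∈ Metric.ball ε₀ δ \ A,
      (-1 / 3 * μ ε ^ 2 - 4 * μ ε * deriv^[1] μ ε + μ ε * deriv^[2] μ ε -
          4 * deriv^[1] μ ε ^ 2 = 0) ∧
      (-7 / 48 * μ ε ^ 2 - 11 / 6 * μ ε * deriv^[1] μ ε + 53 / 24 * μ ε * deriv^[2] μ ε -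
          5 / 6 * μ ε * deriv^[3] μ ε + 1 / 16 * μ ε * deriv^[4] μ ε -
          5 / 3 * deriv^[1] μ ε ^ 2 + 2 * deriv^[1] μ ε * deriv^[2] μ ε -
          deriv^[1] μ ε * deriv^[3] μ ε + 5 / 8 * deriv^[2] μ ε ^ 2 = 0) := by
    rintro ε ⟨hε, hεA⟩
    rcases frequently_or_distrib.1 (hzero ε hε).frequently with h | h
    · obtain ⟨a, b⟩ := (evenJet_isoDiscr h4 ε).eq_zero_of_frequently h
      exact absurd ⟨(mul_eq_zero.1 a).resolve_left hs, (mul_eq_zero.1 b).resolve_left hs⟩ hεA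
    · obtain ⟨a, b⟩ := (evenJet_kolDiscr hμ ε).eq_zero_of_frequently h
      exact ⟨(mul_eq_zero.1 a).resolve_left (pow_ne_zero 2 hs),
        (mul_eq_zero.1 b).resolve_left (pow_ne_zero 2 hs)⟩
  by_cases hsub : Metric.ball ε₀ δ ⊆ A
  · refine (hpos ε₀).ne' (not_isoDiscr_degenerate Metric.isOpen_ball
      (hd 0 (by norm_num)) (hd 1 (by norm_num)) (hd 2 (by norm_num)) (hd 3 (by norm_num))
      (fun u hu => (hsub hu).1) (fun u hu => (hsub hu).2) (Metric.mem_ball_self hδ))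
  · obtain ⟨u, hu, huA⟩ := not_subset.1 hsub
    exact not_kolDiscr_degenerate (Metric.isOpen_ball.sdiff hA) hpos
      (hd 0 (by norm_num)) (hd 1 (by norm_num)) (hd 2 (by norm_num)) (hd 3 (by norm_num))
      (fun u hu => (hK u hu).1) (fun u hu => (hK u hu).2) ⟨hu, huA⟩

/-! ### Derivatives of weights and averages, and exact integral identities. -/

theorem hasDerivAt_weight_left {μ : ℝ → ℝ} (hμ : ContDiff ℝ 1 μ) (l ε y : ℝ) :
    HasDerivAt (fun ε => weight μ l ε y) (weight (deriv μ) l ε y) ε := by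
  have h1 : HasDerivAt μ (deriv μ (ε + lobe y / 2)) (ε + lobe y / 2) :=
    (hμ.differentiable one_ne_zero _).hasDerivAt
  have h2 := h1.comp ε ((hasDerivAt_id ε).add_const (lobe y / 2))
  refine ((h2.mul_const (deriv lobe y / 2)).mul_const (Real.exp (l * lobe y))).congr_deriv ?_
  rw [mul_one]
  rfl

theorem hasDerivAt_weight_right {μ : ℝ → ℝ} (hμ : ContDiff ℝ 1 μ) (l ε : ℝ) {y : ℝ}
    (hy : y ∈ Ioo (-1 : ℝ) 1) : HasDerivAt (weight μ l ε)
      ((deriv μ (ε + lobe y / 2) * (deriv lobe y / 2) ^ 2 +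
        μ (ε + lobe y / 2) * (deriv^[2] lobe y / 2) +
        l * deriv lobe y * (μ (ε + lobe y / 2) * (deriv lobe y / 2))) *
          Real.exp (l * lobe y)) y := by
  have h1 : HasDerivAt μ (deriv μ (ε + lobe y / 2)) (ε + lobe y / 2) :=
    (hμ.differentiable one_ne_zero _).hasDerivAt
  have h2 := h1.comp y (((hasDerivAt_lobe hy).div_const 2).const_add ε)
  have h3 : HasDerivAt (deriv lobe) (deriv^[2] lobe y) y := hasDerivAt_iterate_deriv_lobe 1 hy
  refine ((h2.mul (h3.div_const 2)).mul ((hasDerivAt_lobe hy).const_mul l).exp).congr_deriv ?_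
  simp only [Function.comp_apply, Pi.mul_apply]
  ring

theorem hasFDerivAt_of_partial {f : ℝ × ℝ → ℝ} {x : ℝ × ℝ} {p q : ℝ}
    (hf : DifferentiableAt ℝ f x) (h1 : HasDerivAt (fun s => f (s, x.2)) p x.1)
    (h2 : HasDerivAt (fun s => f (x.1, s)) q x.2) :
    HasFDerivAt f (p • ContinuousLinearMap.fst ℝ ℝ ℝ + q • ContinuousLinearMap.snd ℝ ℝ ℝ) x := by
  refine hf.hasFDerivAt.congr_fderiv ?_
  have e1 : fderiv ℝ f x (1, 0) = p :=
    (hf.hasFDerivAt.comp_hasDerivAt x.1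
      ((hasDerivAt_id x.1).prodMk (hasDerivAt_const x.1 x.2))).unique h1
  have e2 : fderiv ℝ f x (0, 1) = q :=
    (hf.hasFDerivAt.comp_hasDerivAt x.2
      ((hasDerivAt_const x.2 x.1).prodMk (hasDerivAt_id x.2))).unique h2
  ext
  · simpa using e1
  · simpa using e2

theorem contDiffOn_weight_mul_cos {n : ℕ∞} {μ : ℝ → ℝ} (hμ : ContDiff ℝ n μ) (l : ℝ) :
    ContDiffOn ℝ n (Function.uncurry fun (x : ℝ × ℝ) (t : ℝ) => weight μ l x.1 (x.2 * Real.cos t))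
      ((univ ×ˢ Ioo (-1) 1) ×ˢ univ) := by
  have h1 : ContDiff ℝ n (fun z : (ℝ × ℝ) × ℝ => (z.1.1, z.1.2 * Real.cos z.2)) := by fun_prop
  exact (contDiffOn_weight hμ l).comp h1.contDiffOn
    fun z hz => ⟨mem_univ _, mul_cos_mem_Ioo hz.1.2 z.2⟩

theorem contDiffOn_avg_weight {n : ℕ∞} {μ : ℝ → ℝ} (hμ : ContDiff ℝ n μ) (k : ℕ) (l : ℝ) :
    ContDiffOn ℝ n (fun x : ℝ × ℝ => avg k (weight μ l x.1) x.2) (univ ×ˢ Ioo (-1) 1) := by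
  have h1 : ContDiff ℝ n (fun z : (ℝ × ℝ) × ℝ => Real.sin z.2 ^ (2 * k)) := by fun_prop
  exact contDiffOn_intervalIntegral (isOpen_univ.prod isOpen_Ioo) n _ _
    (f := fun (x : ℝ × ℝ) t => Real.sin t ^ (2 * k) * weight μ l x.1 (x.2 * Real.cos t))
    (h1.contDiffOn.mul (contDiffOn_weight_mul_cos hμ l))

theorem fderiv_weight_mul_cos {μ : ℝ → ℝ} (hμ : ContDiff ℝ 1 μ) (l ε : ℝ) {c : ℝ}
    (hc : c ∈ Ioo (-1 : ℝ) 1) (t : ℝ) (ξ : ℝ × ℝ) :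
    fderiv ℝ (fun x : ℝ × ℝ => weight μ l x.1 (x.2 * Real.cos t)) (ε, c) ξ =
      weight (deriv μ) l ε (c * Real.cos t) * ξ.1 +
        deriv (weight μ l ε) (c * Real.cos t) * Real.cos t * ξ.2 := by
  have hd : DifferentiableAt ℝ (fun x : ℝ × ℝ => weight μ l x.1 (x.2 * Real.cos t)) (ε, c) :=
    (hasFDerivAt_slice (isOpen_univ.prod isOpen_Ioo) one_ne_zero
      (contDiffOn_weight_mul_cos (n := 1) hμ l) ⟨mem_univ _, hc⟩ t).differentiableAt
  have h2 : HasDerivAt (fun s => weight μ l ε (s * Real.cos t))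
      (deriv (weight μ l ε) (c * Real.cos t) * Real.cos t) c := by
    have e : HasDerivAt (fun s : ℝ => s * Real.cos t) (Real.cos t) c := by
      simpa using (hasDerivAt_id c).mul_const (Real.cos t)
    exact ((hasDerivAt_weight_right hμ l ε (mul_cos_mem_Ioo hc t)).differentiableAt.hasDerivAt).comp
      c e
  rw [(hasFDerivAt_of_partial hd (hasDerivAt_weight_left hμ l ε (c * Real.cos t)) h2).fderiv]
  simp

theorem hasFDerivAt_avg_weight {μ : ℝ → ℝ} (hμ : ContDiff ℝ 1 μ) (k : ℕ) (l ε : ℝ) {c : ℝ}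
    (hc : c ∈ Ioo (-1 : ℝ) 1) :
    HasFDerivAt (fun x : ℝ × ℝ => avg k (weight μ l x.1) x.2)
      (avg k (weight (deriv μ) l ε) c • ContinuousLinearMap.fst ℝ ℝ ℝ +
        (∫ t in (0 : ℝ)..(2 * Real.pi),
          Real.sin t ^ (2 * k) * (deriv (weight μ l ε) (c * Real.cos t) * Real.cos t)) •
          ContinuousLinearMap.snd ℝ ℝ ℝ) (ε, c) := by
  have hd : DifferentiableAt ℝ (fun x : ℝ × ℝ => avg k (weight μ l x.1) x.2) (ε, c) :=
    ((contDiffOn_avg_weight (n := 1) hμ k l).contDiffAt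
      ((isOpen_univ.prod isOpen_Ioo).mem_nhds ⟨mem_univ _, hc⟩)).differentiableAt one_ne_zero
  refine hasFDerivAt_of_partial hd ?_ (hasDerivAt_avg' k (contDiffOn_weight_right (n := 1) hμ l ε) hc)
  have hci : ContDiffOn ℝ 1 (Function.uncurry fun ε t : ℝ =>
      Real.sin t ^ (2 * k) * weight μ l ε (c * Real.cos t)) (univ ×ˢ univ) := by
    have h1 : ContDiff ℝ 1 (fun z : ℝ × ℝ => (z.1, c * Real.cos z.2)) := by fun_prop
    have h2 : ContDiff ℝ 1 (fun z : ℝ × ℝ => Real.sin z.2 ^ (2 * k)) := by fun_prop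
    exact h2.contDiffOn.mul ((contDiffOn_weight (n := 1) hμ l).comp h1.contDiffOn
      fun z _ => ⟨mem_univ _, mul_cos_mem_Ioo hc z.2⟩)
  have h := (hasFDerivAt_intervalIntegral isOpen_univ hci 0 (2 * Real.pi)
    (mem_univ ε)).hasDerivAt
  refine h.congr_deriv ?_
  have hc' := continuous_slice (contDiffOn_slice_fderiv isOpen_univ (m := 0) (by simp)
    hci).continuousOn (mem_univ ε)
  rw [ContinuousLinearMap.intervalIntegral_apply (hc'.intervalIntegrable _ _)]
  refine intervalIntegral.integral_congr fun t _ => ?_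
  exact ((hasDerivAt_weight_left hμ l ε _).const_mul _).deriv

theorem weight_pos {μ : ℝ → ℝ} (hpos : ∀ u, 0 < μ u) (l ε : ℝ) {y : ℝ} (hy : y ∈ Ioo (-1 : ℝ) 1) :
    0 < weight μ l ε y :=
  mul_pos (mul_pos (hpos _) (half_pos (deriv_lobe_pos hy))) (Real.exp_pos _)

theorem continuous_weight_mul_cos {μ : ℝ → ℝ} (hμ : Continuous μ) (l ε : ℝ) {c : ℝ}
    (hc : c ∈ Ioo (-1 : ℝ) 1) : Continuous fun t => weight μ l ε (c * Real.cos t) :=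
  (contDiffOn_weight_right (n := 0) (contDiff_zero.2 hμ) l ε).continuousOn.comp_continuous
    (by fun_prop) (mul_cos_mem_Ioo hc)

theorem avg_zero_weight_pos {μ : ℝ → ℝ} (hμ : Continuous μ) (hpos : ∀ u, 0 < μ u) (l ε : ℝ) {c : ℝ}
    (hc : c ∈ Ioo (-1 : ℝ) 1) : 0 < avg 0 (weight μ l ε) c := by
  have h := continuous_weight_mul_cos hμ l ε hc
  refine intervalIntegral.intervalIntegral_pos_of_pos_on ?_ (fun t _ => ?_) (by positivity)
  · simpa using h.intervalIntegrable _ _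
  · simpa using weight_pos hpos l ε (mul_cos_mem_Ioo hc t)

/-- It comes from the differential equation of `lobe`. It removes the exponential: weights with `l =
1` and `l = 0` become comparable, and suitable combinations of their integrals become exact. -/
theorem weight_one_eq (μ : ℝ → ℝ) (ε : ℝ) {y : ℝ} (hy : y ∈ Ioo (-1 : ℝ) 1) :
    weight μ 1 ε y = (1 - y ^ 2) * weight μ 0 ε y + y * μ (ε + lobe y / 2) := by
  have h := deriv_lobe_mul_exp hy
  simp only [weight, one_mul, zero_mul, Real.exp_zero, mul_one]
  linear_combination μ (ε + lobe y / 2) / 2 * h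

theorem deriv_weight_zero {μ : ℝ → ℝ} (hμ : ContDiff ℝ 1 μ) (ε : ℝ) {y : ℝ}
    (hy : y ∈ Ioo (-1 : ℝ) 1) : deriv (weight μ 0 ε) y =
      deriv μ (ε + lobe y / 2) * (deriv lobe y / 2) ^ 2 +
        μ (ε + lobe y / 2) * (deriv^[2] lobe y / 2) := by
  rw [(hasDerivAt_weight_right hμ 0 ε hy).deriv]
  simp

theorem deriv_weight_one {μ : ℝ → ℝ} (hμ : ContDiff ℝ 1 μ) (ε : ℝ) {y : ℝ}
    (hy : y ∈ Ioo (-1 : ℝ) 1) : deriv (weight μ 1 ε) y =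
      (1 - y ^ 2) * deriv (weight μ 0 ε) y - 2 * y * weight μ 0 ε y + μ (ε + lobe y / 2) +
        y * (deriv μ (ε + lobe y / 2) * (deriv lobe y / 2)) := by
  have h1 := (hasDerivAt_weight_right hμ 0 ε hy).differentiableAt.hasDerivAt
  have h2 : HasDerivAt μ (deriv μ (ε + lobe y / 2)) (ε + lobe y / 2) :=
    (hμ.differentiable one_ne_zero _).hasDerivAt
  have h3 := h2.comp y (((hasDerivAt_lobe hy).div_const 2).const_add ε)
  have h4 := ((((hasDerivAt_id y).fun_pow 2).const_sub 1).fun_mul h1).fun_add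
    ((hasDerivAt_id y).fun_mul h3)
  have h5 : weight μ 1 ε =ᶠ[𝓝 y] fun y => (1 - y ^ 2) * weight μ 0 ε y +
      y * μ (ε + lobe y / 2) := by
    filter_upwards [isOpen_Ioo.mem_nhds hy] with w hw
    exact weight_one_eq μ ε hw
  rw [h5.deriv_eq]
  refine h4.deriv.trans ?_
  simp only [id, Function.comp_apply]
  push_cast
  ring

theorem hasDerivAt_comp_mul_cos {f : ℝ → ℝ} {f' c t : ℝ} (h : HasDerivAt f f' (c * Real.cos t)) :
    HasDerivAt (fun t => f (c * Real.cos t)) (-(f' * (c * Real.sin t))) t := by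
  refine (h.comp t ((Real.hasDerivAt_cos t).const_mul c)).congr_deriv ?_
  ring

/-- The `(ε, c)` component of the closedness of the symplectic form. -/
theorem integral_closed {μ : ℝ → ℝ} (hμ : ContDiff ℝ 1 μ) (ε : ℝ) {c : ℝ}
    (hc : c ∈ Ioo (-1 : ℝ) 1) (φ : ℝ) :
    -(∫ t in (0 : ℝ)..φ, deriv (weight μ 1 ε) (c * Real.cos t) * Real.cos t) -
      c * ((∫ t in (0 : ℝ)..φ, weight μ 0 ε (c * Real.cos t)) -
        ∫ t in (0 : ℝ)..φ, weight (deriv μ) 0 ε (c * Real.cos t)) +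
      (1 - c ^ 2) * (∫ t in (0 : ℝ)..φ, deriv (weight μ 0 ε) (c * Real.cos t) * Real.cos t) =
    μ (ε + lobe (c * Real.cos φ) / 2) * Real.sin φ *
      (deriv lobe (c * Real.cos φ) / 2 * (c * Real.cos φ) - 1) := by
  have hμ' : Continuous (deriv μ) := hμ.continuous_deriv le_rfl
  have hcd : ∀ l, Continuous fun t => deriv (weight μ l ε) (c * Real.cos t) * Real.cos t :=
    fun l => (((contDiffOn_weight_right (n := 1) hμ l ε).continuousOn_deriv_of_isOpen isOpen_Ioo
      le_rfl).comp_continuous (by fun_prop) (mul_cos_mem_Ioo hc)).mul Real.continuous_cos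
  have i1 := (hcd 1).intervalIntegrable (μ := volume) 0 φ
  have i2 := (hcd 0).intervalIntegrable (μ := volume) 0 φ
  have i3 := (continuous_weight_mul_cos hμ.continuous 0 ε hc).intervalIntegrable (μ := volume) 0 φ
  have i4 := (continuous_weight_mul_cos hμ' 0 ε hc).intervalIntegrable (μ := volume) 0 φ
  have i1n : IntervalIntegrable (fun t => -(deriv (weight μ 1 ε) (c * Real.cos t) * Real.cos t))
      volume 0 φ := i1.neg
  rw [← intervalIntegral.integral_sub i3 i4, ← intervalIntegral.integral_const_mul,
    ← intervalIntegral.integral_const_mul, ← intervalIntegral.integral_neg,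
    ← intervalIntegral.integral_sub i1n ((i3.sub i4).const_mul c),
    ← intervalIntegral.integral_add (i1n.sub ((i3.sub i4).const_mul c)) (i2.const_mul _)]
  -- The integrand is the derivative of the explicit right-hand side, which vanishes at `0` because
  -- of its factor `sin`.
  have hd : ∀ t ∈ uIcc (0 : ℝ) φ, HasDerivAt (fun t => μ (ε + lobe (c * Real.cos t) / 2) *
      Real.sin t * (deriv lobe (c * Real.cos t) / 2 * (c * Real.cos t) - 1))
      (-(deriv (weight μ 1 ε) (c * Real.cos t) * Real.cos t) -
        c * (weight μ 0 ε (c * Real.cos t) - weight (deriv μ) 0 ε (c * Real.cos t)) +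
        (1 - c ^ 2) * (deriv (weight μ 0 ε) (c * Real.cos t) * Real.cos t)) t := by
    intro t _
    have hy := mul_cos_mem_Ioo hc t
    have h2 : HasDerivAt μ (deriv μ (ε + lobe (c * Real.cos t) / 2))
        (ε + lobe (c * Real.cos t) / 2) := (hμ.differentiable one_ne_zero _).hasDerivAt
    have h3 := h2.comp (c * Real.cos t) (((hasDerivAt_lobe hy).div_const 2).const_add ε)
    have h4 : HasDerivAt (deriv lobe) (deriv^[2] lobe (c * Real.cos t)) (c * Real.cos t) :=
      hasDerivAt_iterate_deriv_lobe 1 hy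
    have h5 := ((h4.div_const 2).fun_mul (hasDerivAt_id _)).sub_const 1
    refine (((hasDerivAt_comp_mul_cos h3).fun_mul (Real.hasDerivAt_sin t)).fun_mul
      (hasDerivAt_comp_mul_cos h5)).congr_deriv ?_
    rw [deriv_weight_one hμ ε hy, deriv_weight_zero hμ ε hy]
    simp only [weight, zero_mul, Real.exp_zero, mul_one, id, Function.comp_apply]
    have hsc := Real.sin_sq_add_cos_sq t
    set v := deriv lobe (c * Real.cos t)
    set v2 := deriv^[2] lobe (c * Real.cos t)
    set m := μ (ε + lobe (c * Real.cos t) / 2)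
    set m' := deriv μ (ε + lobe (c * Real.cos t) / 2)
    have hs2 : Real.sin t ^ 2 = 1 - Real.cos t ^ 2 := by linear_combination hsc
    ring_nf
    simp only [hs2]
    ring
  have hint := (i1n.sub ((i3.sub i4).const_mul c)).add (i2.const_mul (1 - c ^ 2))
  rw [intervalIntegral.integral_eq_sub_of_hasDerivAt hd hint]
  simp

theorem avg_zero_eq (f : ℝ → ℝ) (c : ℝ) :
    avg 0 f c = ∫ t in (0 : ℝ)..(2 * Real.pi), f (c * Real.cos t) := by
  simp [avg]

/-- Integrate the derivative of `sin t cos t f(c cos t)` over a period. The identity yields the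
`c`-derivative of the action. -/
theorem two_mul_avg_one_add {f : ℝ → ℝ} (hf : ContDiffOn ℝ 1 f (Ioo (-1) 1)) {c : ℝ}
    (hc : c ∈ Ioo (-1 : ℝ) 1) :
    2 * avg 1 f c + c * (∫ t in (0 : ℝ)..(2 * Real.pi),
      Real.sin t ^ (2 * 1) * (deriv f (c * Real.cos t) * Real.cos t)) = avg 0 f c := by
  have hcf : Continuous fun t => f (c * Real.cos t) :=
    hf.continuousOn.comp_continuous (by fun_prop) (mul_cos_mem_Ioo hc)
  have hcf' : Continuous fun t => deriv f (c * Real.cos t) :=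
    (hf.continuousOn_deriv_of_isOpen isOpen_Ioo le_rfl).comp_continuous (by fun_prop)
      (mul_cos_mem_Ioo hc)
  have i0 := hcf.intervalIntegrable (μ := volume) 0 (2 * Real.pi)
  have i1 := ((Real.continuous_sin.fun_pow (2 * 1)).fun_mul hcf).intervalIntegrable (μ := volume)
    0 (2 * Real.pi)
  have i2 := ((Real.continuous_sin.fun_pow (2 * 1)).fun_mul
    (hcf'.fun_mul Real.continuous_cos)).intervalIntegrable (μ := volume) 0 (2 * Real.pi)
  have hd : ∀ t ∈ uIcc (0 : ℝ) (2 * Real.pi),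
      HasDerivAt (fun t => Real.sin t * Real.cos t * f (c * Real.cos t))
      (f (c * Real.cos t) - 2 * (Real.sin t ^ (2 * 1) * f (c * Real.cos t)) -
        c * (Real.sin t ^ (2 * 1) * (deriv f (c * Real.cos t) * Real.cos t))) t := by
    intro t _
    have h1 : HasDerivAt f (deriv f (c * Real.cos t)) (c * Real.cos t) :=
      ((hf.contDiffAt (isOpen_Ioo.mem_nhds (mul_cos_mem_Ioo hc t))).differentiableAt
        one_ne_zero).hasDerivAt
    refine (((Real.hasDerivAt_sin t).fun_mul (Real.hasDerivAt_cos t)).fun_mul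
      (hasDerivAt_comp_mul_cos h1)).congr_deriv ?_
    linear_combination f (c * Real.cos t) * Real.sin_sq_add_cos_sq t
  have h := intervalIntegral.integral_eq_sub_of_hasDerivAt hd
    ((i0.sub (i1.const_mul 2)).sub (i2.const_mul c))
  rw [intervalIntegral.integral_sub (i0.sub (i1.const_mul 2)) (i2.const_mul c),
    intervalIntegral.integral_sub i0 (i1.const_mul 2), intervalIntegral.integral_const_mul,
    intervalIntegral.integral_const_mul] at h
  simp only [Real.sin_two_pi, Real.sin_zero, zero_mul, sub_zero] at h
  rw [avg_zero_eq, avg]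
  linear_combination -h

/-- Integrate the derivative of `c sin t μ(u(t))`, with `u` the logarithm of `s` along the cycle,
over a period. The identity yields the `ε`-derivative of the action. -/
theorem sq_mul_avg_one_weight {μ : ℝ → ℝ} (hμ : ContDiff ℝ 1 μ) (ε : ℝ) {c : ℝ}
    (hc : c ∈ Ioo (-1 : ℝ) 1) :
    c ^ 2 * (avg 1 (weight μ 0 ε) c + avg 1 (weight (deriv μ) 0 ε) c) =
      avg 0 (weight μ 1 ε) c - (1 - c ^ 2) * avg 0 (weight μ 0 ε) c := by
  have hμ' : Continuous (deriv μ) := hμ.continuous_deriv le_rfl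
  have c0 := continuous_weight_mul_cos hμ.continuous 0 ε hc
  have c0' := continuous_weight_mul_cos hμ' 0 ε hc
  have i0 := c0.intervalIntegrable (μ := volume) 0 (2 * Real.pi)
  have i1 := (continuous_weight_mul_cos hμ.continuous 1 ε hc).intervalIntegrable (μ := volume) 0
    (2 * Real.pi)
  have j0 := ((Real.continuous_sin.fun_pow (2 * 1)).fun_mul c0).intervalIntegrable (μ := volume) 0
    (2 * Real.pi)
  have j1 := ((Real.continuous_sin.fun_pow (2 * 1)).fun_mul c0').intervalIntegrable (μ := volume) 0
    (2 * Real.pi)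
  have hd : ∀ t ∈ uIcc (0 : ℝ) (2 * Real.pi),
      HasDerivAt (fun t => c * (Real.sin t * μ (ε + lobe (c * Real.cos t) / 2)))
      (weight μ 1 ε (c * Real.cos t) - (1 - c ^ 2) * weight μ 0 ε (c * Real.cos t) -
        c ^ 2 * (Real.sin t ^ (2 * 1) * weight μ 0 ε (c * Real.cos t) +
          Real.sin t ^ (2 * 1) * weight (deriv μ) 0 ε (c * Real.cos t))) t := by
    intro t _
    have hy := mul_cos_mem_Ioo hc t
    have h2 : HasDerivAt μ (deriv μ (ε + lobe (c * Real.cos t) / 2))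
        (ε + lobe (c * Real.cos t) / 2) := (hμ.differentiable one_ne_zero _).hasDerivAt
    have h3 := h2.comp (c * Real.cos t) (((hasDerivAt_lobe hy).div_const 2).const_add ε)
    refine (((Real.hasDerivAt_sin t).fun_mul (hasDerivAt_comp_mul_cos h3)).const_mul
      c).congr_deriv ?_
    rw [weight_one_eq μ ε hy]
    simp only [weight, zero_mul, Real.exp_zero, mul_one, Function.comp_apply]
    linear_combination c ^ 2 * μ (ε + lobe (c * Real.cos t) / 2) *
      (deriv lobe (c * Real.cos t) / 2) * Real.sin_sq_add_cos_sq t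
  have h := intervalIntegral.integral_eq_sub_of_hasDerivAt hd
    ((i1.sub (i0.const_mul _)).sub ((j0.add j1).const_mul _))
  rw [intervalIntegral.integral_sub (i1.sub (i0.const_mul _)) ((j0.add j1).const_mul _),
    intervalIntegral.integral_sub i1 (i0.const_mul _), intervalIntegral.integral_const_mul,
    intervalIntegral.integral_const_mul, intervalIntegral.integral_add j0 j1] at h
  simp only [Real.sin_two_pi, Real.sin_zero, zero_mul, mul_zero, sub_zero] at h
  rw [avg_zero_eq, avg_zero_eq, avg, avg]
  linear_combination -h

/-! ### Action, angle and the symplectic form for one degree of freedom. -/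

/-- The radius `√b e^ε` of momentum at the equilibrium of energy `b ε + b / 2`. -/
noncomputable def rad (b ε : ℝ) : ℝ := √b * Real.exp ε

/-- Integrals of the weights along the arc `0 ≤ t ≤ φ` of the cycle `(ε, c)`; the arguments are
`(φ, ε, c)`. -/
noncomputable def arc (μ : ℝ → ℝ) (l : ℝ) (z : ℝ × ℝ × ℝ) : ℝ :=
  ∫ t in (0 : ℝ)..z.1, weight μ l z.2.1 (z.2.2 * Real.cos t)

/-- The square `a` of the momentum on the cycle `(ε, c)`. -/
noncomputable def momSq (b : ℝ) (x : ℝ × ℝ) : ℝ := rad b x.1 ^ 2 * (1 - x.2 ^ 2)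

/-- The action `J` of the cycle `(ε, c)`. -/
noncomputable def action (b : ℝ) (μ : ℝ → ℝ) (x : ℝ × ℝ) : ℝ :=
  rad b x.1 * x.2 ^ 2 * avg 1 (weight μ 0 x.1) x.2

/-- The partial derivative of the action with respect to `ε` at fixed `a`. -/
noncomputable def period (b : ℝ) (μ : ℝ → ℝ) (x : ℝ × ℝ) : ℝ :=
  rad b x.1 * avg 0 (weight μ 1 x.1) x.2

/-- The partial derivative of the action with respect to `a` at fixed `ε`. -/
noncomputable def drift (b : ℝ) (μ : ℝ → ℝ) (x : ℝ × ℝ) : ℝ :=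
  -(avg 0 (weight μ 0 x.1) x.2 / (2 * rad b x.1))

/-- The angle conjugate to the action. -/
noncomputable def angle (b : ℝ) (μ : ℝ → ℝ) (z : ℝ × ℝ × ℝ) : ℝ :=
  rad b z.2.1 * arc μ 1 z / period b μ z.2

/-- The function `σ` such that `σ ∇a` is the displacement of the fibre angles. -/
noncomputable def angleShift (b : ℝ) (μ : ℝ → ℝ) (z : ℝ × ℝ × ℝ) : ℝ :=
  angle b μ z * drift b μ z.2 + arc μ 0 z / (2 * rad b z.2.1)

/-- `ln s` in terms of `(φ, ε, c)`. -/
noncomputable def logS (z : ℝ × ℝ × ℝ) : ℝ := z.2.1 + lobe (z.2.2 * Real.cos z.1) / 2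

/-- `s p_s` in terms of `(φ, ε, c)`. -/
noncomputable def logMom (b : ℝ) (μ : ℝ → ℝ) (z : ℝ × ℝ × ℝ) : ℝ :=
  μ (logS z) * -(rad b z.2.1 * z.2.2 * Real.sin z.1)

theorem rad_pos {b : ℝ} (hb : 0 < b) (ε : ℝ) : 0 < rad b ε :=
  mul_pos (Real.sqrt_pos.2 hb) (Real.exp_pos ε)

theorem hasDerivAt_rad (b ε : ℝ) : HasDerivAt (rad b) (rad b ε) ε :=
  (Real.hasDerivAt_exp ε).const_mul √b

theorem contDiff_rad {n : WithTop ℕ∞} (b : ℝ) : ContDiff ℝ n (rad b) :=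
  contDiff_const.mul Real.contDiff_exp

theorem hasFDerivAt_rad_fst (b : ℝ) (x : ℝ × ℝ) :
    HasFDerivAt (fun x : ℝ × ℝ => rad b x.1) (rad b x.1 • ContinuousLinearMap.fst ℝ ℝ ℝ) x :=
  (hasDerivAt_rad b x.1).comp_hasFDerivAt x hasFDerivAt_fst

theorem hasFDerivAt_momSq (b : ℝ) (x : ℝ × ℝ) :
    HasFDerivAt (momSq b) ((2 * momSq b x) • ContinuousLinearMap.fst ℝ ℝ ℝ +
      (-(2 * rad b x.1 ^ 2 * x.2)) • ContinuousLinearMap.snd ℝ ℝ ℝ) x := by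
  refine (((hasFDerivAt_rad_fst b x).pow 2).mul
    ((hasFDerivAt_snd.pow 2).const_sub 1)).congr_fderiv ?_
  ext <;> simp [momSq] <;> ring

section

variable {b : ℝ} {μ : ℝ → ℝ}

theorem period_pos (hb : 0 < b) (hμ : Continuous μ) (hpos : ∀ u, 0 < μ u) {x : ℝ × ℝ}
    (hx : x.2 ∈ Ioo (-1 : ℝ) 1) : 0 < period b μ x :=
  mul_pos (rad_pos hb _) (avg_zero_weight_pos hμ hpos 1 x.1 hx)

/-- The differential is arranged as `dJ = T dε + K da`, with `T` the period, `K` the drift and `da`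
the differential of `momSq`; this form is what inverting for `ε` and the symplectic identity
require. -/
theorem hasFDerivAt_action (hb : 0 < b) (hμ : ContDiff ℝ 1 μ) {x : ℝ × ℝ}
    (hx : x.2 ∈ Ioo (-1 : ℝ) 1) :
    HasFDerivAt (action b μ) (period b μ x • ContinuousLinearMap.fst ℝ ℝ ℝ +
      drift b μ x • ((2 * momSq b x) • ContinuousLinearMap.fst ℝ ℝ ℝ +
      (-(2 * rad b x.1 ^ 2 * x.2)) • ContinuousLinearMap.snd ℝ ℝ ℝ)) x := by
  have hR := (rad_pos hb x.1).ne'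
  refine (((hasFDerivAt_rad_fst b x).mul (hasFDerivAt_snd.pow 2)).mul
    (hasFDerivAt_avg_weight hμ 1 0 x.1 hx)).congr_fderiv ?_
  have h1 := sq_mul_avg_one_weight hμ x.1 hx
  have h2 := two_mul_avg_one_add (contDiffOn_weight_right (n := 1) hμ 0 x.1) hx
  ext
  · simp [momSq, period, drift]
    field_simp
    linear_combination h1
  · simp only [mul_one] at h2
    simp [drift]
    generalize (∫ t in (0 : ℝ)..2 * Real.pi,
      Real.sin t ^ 2 * (deriv (weight μ 0 x.1) (x.2 * Real.cos t) * Real.cos t)) = I at h2 ⊢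
    field_simp
    linear_combination x.2 * h2

theorem hasFDerivAt_period (hμ : ContDiff ℝ 1 μ) {x : ℝ × ℝ} (hx : x.2 ∈ Ioo (-1 : ℝ) 1) :
    HasFDerivAt (period b μ)
      ((rad b x.1 * (avg 0 (weight μ 1 x.1) x.2 + avg 0 (weight (deriv μ) 1 x.1) x.2)) •
        ContinuousLinearMap.fst ℝ ℝ ℝ +
      (rad b x.1 * ∫ t in (0 : ℝ)..(2 * Real.pi),
        deriv (weight μ 1 x.1) (x.2 * Real.cos t) * Real.cos t) •
        ContinuousLinearMap.snd ℝ ℝ ℝ) x := by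
  refine ((hasFDerivAt_rad_fst b x).mul (hasFDerivAt_avg_weight hμ 0 1 x.1 hx)).congr_fderiv ?_
  ext <;> simp
  ring

theorem hasFDerivAt_drift (hb : 0 < b) (hμ : ContDiff ℝ 1 μ) {x : ℝ × ℝ}
    (hx : x.2 ∈ Ioo (-1 : ℝ) 1) :
    HasFDerivAt (drift b μ)
      (((avg 0 (weight μ 0 x.1) x.2 - avg 0 (weight (deriv μ) 0 x.1) x.2) / (2 * rad b x.1)) •
        ContinuousLinearMap.fst ℝ ℝ ℝ +
      (-((∫ t in (0 : ℝ)..(2 * Real.pi),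
        deriv (weight μ 0 x.1) (x.2 * Real.cos t) * Real.cos t) / (2 * rad b x.1))) •
        ContinuousLinearMap.snd ℝ ℝ ℝ) x := by
  have hR := (rad_pos hb x.1).ne'
  have hinv : HasFDerivAt (fun x : ℝ × ℝ => (2 * rad b x.1)⁻¹)
      ((-(2 * rad b x.1)⁻¹) • ContinuousLinearMap.fst ℝ ℝ ℝ) x := by
    have h := (((hasDerivAt_rad b x.1).const_mul 2).inv (by positivity)).comp_hasFDerivAt x
      (hasFDerivAt_fst (𝕜 := ℝ) (E := ℝ) (F := ℝ) (p := x))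
    refine h.congr_fderiv ?_
    congr 1
    field_simp
  have h := ((hasFDerivAt_avg_weight hμ 0 0 x.1 hx).mul hinv).neg
  refine (h.congr_of_eventuallyEq (Eventually.of_forall fun y => ?_)).congr_fderiv ?_
  · simp [drift, div_eq_mul_inv]
  · ext
    · simp
      field_simp
      ring
    · simp
      field_simp

theorem contDiffOn_action {n : ℕ∞} (hμ : ContDiff ℝ n μ) :
    ContDiffOn ℝ n (action b μ) (univ ×ˢ Ioo (-1) 1) :=
  ((((contDiff_rad b).comp contDiff_fst).mul (contDiff_snd.pow 2)).contDiffOn).mul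
    (contDiffOn_avg_weight hμ 1 0)

theorem contDiffOn_period {n : ℕ∞} (hμ : ContDiff ℝ n μ) :
    ContDiffOn ℝ n (period b μ) (univ ×ˢ Ioo (-1) 1) :=
  (((contDiff_rad b).comp contDiff_fst).contDiffOn).mul (contDiffOn_avg_weight hμ 0 1)

theorem contDiffOn_drift {n : ℕ∞} (hb : 0 < b) (hμ : ContDiff ℝ n μ) :
    ContDiffOn ℝ n (drift b μ) (univ ×ˢ Ioo (-1) 1) :=
  ((contDiffOn_avg_weight hμ 0 0).div
    (contDiff_const.mul ((contDiff_rad b).comp contDiff_fst)).contDiffOn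
    fun x _ => (mul_pos two_pos (rad_pos hb x.1)).ne').neg

theorem contDiff_momSq {n : WithTop ℕ∞} : ContDiff ℝ n (momSq b) :=
  (((contDiff_rad b).comp contDiff_fst).pow 2).mul (contDiff_const.sub (contDiff_snd.pow 2))

theorem contDiffOn_arc {n : ℕ∞} (hμ : ContDiff ℝ n μ) (l : ℝ) :
    ContDiffOn ℝ n (arc μ l) (univ ×ˢ (univ ×ˢ Ioo (-1) 1)) :=
  contDiffOn_primitive (isOpen_univ.prod isOpen_Ioo) n
    (f := fun (x : ℝ × ℝ) t => weight μ l x.1 (x.2 * Real.cos t))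
    (contDiffOn_weight_mul_cos hμ l)

theorem contDiffOn_angle {n : ℕ∞} (hb : 0 < b) (hμ : ContDiff ℝ n μ) (hpos : ∀ u, 0 < μ u) :
    ContDiffOn ℝ n (angle b μ) (univ ×ˢ (univ ×ˢ Ioo (-1) 1)) :=
  ((((contDiff_rad b).comp (contDiff_fst.comp contDiff_snd)).contDiffOn).mul
    (contDiffOn_arc hμ 1)).div
    ((contDiffOn_period hμ).comp contDiffOn_snd fun _ hz => hz.2)
    fun _ hz => (period_pos hb hμ.continuous hpos hz.2.2).ne'

theorem contDiffOn_angleShift {n : ℕ∞} (hb : 0 < b) (hμ : ContDiff ℝ n μ) (hpos : ∀ u, 0 < μ u) :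
    ContDiffOn ℝ n (angleShift b μ) (univ ×ˢ (univ ×ˢ Ioo (-1) 1)) :=
  ((contDiffOn_angle hb hμ hpos).mul
    ((contDiffOn_drift hb hμ).comp contDiffOn_snd fun _ hz => hz.2)).add
    ((contDiffOn_arc hμ 0).div
      (contDiff_const.mul ((contDiff_rad b).comp (contDiff_fst.comp contDiff_snd))).contDiffOn
      fun z _ => (mul_pos two_pos (rad_pos hb z.2.1)).ne')

theorem contDiffOn_logS {n : ℕ∞} : ContDiffOn ℝ n logS (univ ×ˢ (univ ×ˢ Ioo (-1) 1)) := by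
  have h1 : ContDiff ℝ n (fun z : ℝ × ℝ × ℝ => z.2.2 * Real.cos z.1) := by fun_prop
  have h2 : ContDiff ℝ n (fun z : ℝ × ℝ × ℝ => z.2.1) := by fun_prop
  exact h2.contDiffOn.add ((contDiffOn_lobe.comp h1.contDiffOn
    fun z hz => mul_cos_mem_Ioo hz.2.2 z.1).div_const 2)

theorem contDiffOn_logMom {n : ℕ∞} (hμ : ContDiff ℝ n μ) :
    ContDiffOn ℝ n (logMom b μ) (univ ×ˢ (univ ×ˢ Ioo (-1) 1)) := by
  have h1 : ContDiff ℝ n (fun z : ℝ × ℝ × ℝ => rad b z.2.1) :=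
    (contDiff_rad b).comp (contDiff_fst.comp contDiff_snd)
  have h2 : ContDiff ℝ n (fun z : ℝ × ℝ × ℝ => -(rad b z.2.1 * z.2.2 * Real.sin z.1)) := by
    fun_prop
  exact (hμ.comp_contDiffOn contDiffOn_logS).mul h2.contDiffOn

theorem hasFDerivAt_arc (hμ : ContDiff ℝ 1 μ) (l : ℝ) {φ ε c : ℝ} (hc : c ∈ Ioo (-1 : ℝ) 1) :
    ∃ L : ℝ × ℝ × ℝ →L[ℝ] ℝ, HasFDerivAt (arc μ l) L (φ, ε, c) ∧ ∀ v, L v =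
      weight μ l ε (c * Real.cos φ) * v.1 +
        ((∫ t in (0 : ℝ)..φ, weight (deriv μ) l ε (c * Real.cos t)) * v.2.1 +
        (∫ t in (0 : ℝ)..φ, deriv (weight μ l ε) (c * Real.cos t) * Real.cos t) * v.2.2) := by
  have hmem : (φ, ε, c) ∈ (univ : Set ℝ) ×ˢ ((univ : Set ℝ) ×ˢ Ioo (-1 : ℝ) 1) :=
    ⟨mem_univ _, mem_univ _, hc⟩
  refine ⟨_, (((contDiffOn_arc (n := 1) hμ l).contDiffAt ((isOpen_univ.prod
    (isOpen_univ.prod isOpen_Ioo)).mem_nhds hmem)).differentiableAt one_ne_zero).hasFDerivAt,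
    fun v => ?_⟩
  refine (fderiv_primitive (isOpen_univ.prod isOpen_Ioo) (contDiffOn_weight_mul_cos (n := 1) hμ l)
    (φ := φ) (x := (ε, c)) ⟨mem_univ _, hc⟩ v.1 v.2).trans ?_
  have i1 := (continuous_weight_mul_cos (hμ.continuous_deriv le_rfl) l ε hc).intervalIntegrable
    (μ := volume) 0 φ
  have i2 : IntervalIntegrable (fun t => deriv (weight μ l ε) (c * Real.cos t) * Real.cos t)
      volume 0 φ :=
    ((((contDiffOn_weight_right (n := 1) hμ l ε).continuousOn_deriv_of_isOpen isOpen_Ioo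
      le_rfl).comp_continuous (by fun_prop) (mul_cos_mem_Ioo hc)).mul
      Real.continuous_cos).intervalIntegrable _ _
  simp only [fderiv_weight_mul_cos hμ l ε hc]
  rw [intervalIntegral.integral_add (i1.mul_const _) (i2.mul_const _),
    intervalIntegral.integral_mul_const, intervalIntegral.integral_mul_const]

theorem hasFDerivAt_logS {φ ε c : ℝ} (hc : c ∈ Ioo (-1 : ℝ) 1) :
    ∃ L : ℝ × ℝ × ℝ →L[ℝ] ℝ, HasFDerivAt logS L (φ, ε, c) ∧ ∀ v, L v =
      v.2.1 + deriv lobe (c * Real.cos φ) / 2 * (Real.cos φ * v.2.2 - c * Real.sin φ * v.1) := by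
  have hsnd : HasFDerivAt (fun z : ℝ × ℝ × ℝ => z.2) (ContinuousLinearMap.snd ℝ ℝ (ℝ × ℝ))
    (φ, ε, c) := hasFDerivAt_snd
  have hfst : HasFDerivAt (fun z : ℝ × ℝ × ℝ => z.1) (ContinuousLinearMap.fst ℝ ℝ (ℝ × ℝ))
    (φ, ε, c) := hasFDerivAt_fst
  have hε : HasFDerivAt (fun z : ℝ × ℝ × ℝ => z.2.1) _ (φ, ε, c) := hasFDerivAt_fst.comp _ hsnd
  have hcc : HasFDerivAt (fun z : ℝ × ℝ × ℝ => z.2.2) _ (φ, ε, c) := hasFDerivAt_snd.comp _ hsnd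
  have hyd := hcc.mul ((Real.hasDerivAt_cos φ).comp_hasFDerivAt _ hfst)
  have hxd := ((hasDerivAt_lobe (mul_cos_mem_Ioo hc φ)).div_const 2).comp_hasFDerivAt (φ, ε, c) hyd
  refine ⟨_, hε.add hxd, fun v => ?_⟩
  simp
  ring

theorem hasFDerivAt_logMom (hμ : ContDiff ℝ 1 μ) {φ ε c : ℝ} {lu : ℝ × ℝ × ℝ →L[ℝ] ℝ}
    (hu : HasFDerivAt logS lu (φ, ε, c)) :
    ∃ L : ℝ × ℝ × ℝ →L[ℝ] ℝ, HasFDerivAt (logMom b μ) L (φ, ε, c) ∧ ∀ v, L v =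
      deriv μ (logS (φ, ε, c)) * -(rad b ε * c * Real.sin φ) * lu v - μ (logS (φ, ε, c)) * rad b ε *
        (c * Real.sin φ * v.2.1 + Real.sin φ * v.2.2 + c * Real.cos φ * v.1) := by
  have hsnd : HasFDerivAt (fun z : ℝ × ℝ × ℝ => z.2) (ContinuousLinearMap.snd ℝ ℝ (ℝ × ℝ))
    (φ, ε, c) := hasFDerivAt_snd
  have hfst : HasFDerivAt (fun z : ℝ × ℝ × ℝ => z.1) (ContinuousLinearMap.fst ℝ ℝ (ℝ × ℝ))
    (φ, ε, c) := hasFDerivAt_fst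
  have hcc : HasFDerivAt (fun z : ℝ × ℝ × ℝ => z.2.2) _ (φ, ε, c) := hasFDerivAt_snd.comp _ hsnd
  have hRd := (hasFDerivAt_rad_fst b (ε, c)).comp (φ, ε, c) hsnd
  have hμd : HasDerivAt μ (deriv μ (logS (φ, ε, c))) (logS (φ, ε, c)) :=
    (hμ.differentiable one_ne_zero _).hasDerivAt
  have hw := ((hRd.mul hcc).mul ((Real.hasDerivAt_sin φ).comp_hasFDerivAt _ hfst)).neg
  refine ⟨_, (hμd.comp_hasFDerivAt (φ, ε, c) hu).mul hw, fun v => ?_⟩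
  simp
  ring

/-- Only the values of the differential on vectors matter later. They are given after multiplication
by the denominator, so that the symplectic identity can be checked polynomially. -/
theorem hasFDerivAt_angle (hb : 0 < b) (hμ : ContDiff ℝ 1 μ) (hpos : ∀ u, 0 < μ u)
    {φ ε c : ℝ} (hc : c ∈ Ioo (-1 : ℝ) 1) {A T : ℝ × ℝ × ℝ →L[ℝ] ℝ}
    (hA : HasFDerivAt (arc μ 1) A (φ, ε, c))
    (hT : HasFDerivAt (fun z : ℝ × ℝ × ℝ => period b μ z.2) T (φ, ε, c)) :
    ∃ L : ℝ × ℝ × ℝ →L[ℝ] ℝ, HasFDerivAt (angle b μ) L (φ, ε, c) ∧ ∀ v,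
      period b μ (ε, c) * L v = rad b ε * (arc μ 1 (φ, ε, c) * v.2.1 + A v) -
        angle b μ (φ, ε, c) * T v := by
  have hsnd : HasFDerivAt (fun z : ℝ × ℝ × ℝ => z.2) (ContinuousLinearMap.snd ℝ ℝ (ℝ × ℝ))
    (φ, ε, c) := hasFDerivAt_snd
  have hT0 : 0 < period b μ (ε, c) := period_pos hb hμ.continuous hpos hc
  have hRd := (hasFDerivAt_rad_fst b (ε, c)).comp (φ, ε, c) hsnd
  have hTinv := (hasDerivAt_inv hT0.ne').comp_hasFDerivAt (φ, ε, c) hT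
  refine ⟨_, (hRd.mul hA).mul hTinv, fun v => ?_⟩
  simp [angle]
  field_simp
  ring

theorem hasFDerivAt_angleShift (hb : 0 < b)
    {φ ε c : ℝ} {A K Θ : ℝ × ℝ × ℝ →L[ℝ] ℝ}
    (hA : HasFDerivAt (arc μ 0) A (φ, ε, c))
    (hK : HasFDerivAt (fun z : ℝ × ℝ × ℝ => drift b μ z.2) K (φ, ε, c))
    (hΘ : HasFDerivAt (angle b μ) Θ (φ, ε, c)) :
    ∃ L : ℝ × ℝ × ℝ →L[ℝ] ℝ, HasFDerivAt (angleShift b μ) L (φ, ε, c) ∧ ∀ v,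
      2 * rad b ε * L v = 2 * rad b ε * (Θ v * drift b μ (ε, c) + angle b μ (φ, ε, c) * K v) +
        A v - arc μ 0 (φ, ε, c) * v.2.1 := by
  have hsnd : HasFDerivAt (fun z : ℝ × ℝ × ℝ => z.2) (ContinuousLinearMap.snd ℝ ℝ (ℝ × ℝ))
    (φ, ε, c) := hasFDerivAt_snd
  have hR : 0 < rad b ε := rad_pos hb ε
  have hRd := ((hasFDerivAt_rad_fst b (ε, c)).comp (φ, ε, c) hsnd).const_mul 2
  have hRinv := (hasDerivAt_inv (mul_pos two_pos hR).ne').comp_hasFDerivAt (φ, ε, c) hRd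
  refine ⟨_, (hΘ.mul hK).add (hA.mul hRinv), fun v => ?_⟩
  simp
  field_simp
  ring

/-- The differentials of the coordinates, and the canonical form in terms of angle, action and
momentum. -/
theorem exists_differentials (hb : 0 < b) (hμ : ContDiff ℝ 1 μ) (hpos : ∀ u, 0 < μ u)
    {φ ε c : ℝ} (hc : c ∈ Ioo (-1 : ℝ) 1) :
    ∃ lu lP lσ lΘ : ℝ × ℝ × ℝ →L[ℝ] ℝ, ∃ lJ la : ℝ × ℝ →L[ℝ] ℝ,
      HasFDerivAt logS lu (φ, ε, c) ∧ HasFDerivAt (logMom b μ) lP (φ, ε, c) ∧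
      HasFDerivAt (angleShift b μ) lσ (φ, ε, c) ∧ HasFDerivAt (angle b μ) lΘ (φ, ε, c) ∧
      HasFDerivAt (action b μ) lJ (ε, c) ∧ HasFDerivAt (momSq b) la (ε, c) ∧
      (∀ v, lJ v = period b μ (ε, c) * v.1 + drift b μ (ε, c) * la v) ∧
      (∀ v, la v = 2 * momSq b (ε, c) * v.1 - 2 * rad b ε ^ 2 * c * v.2) ∧
      0 < lΘ (1, 0) ∧
      ∀ v w, (lu v * lP w - lu w * lP v) + (lσ v * la w.2 - lσ w * la v.2) =
        lΘ v * lJ w.2 - lΘ w * lJ v.2 := by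
  have hR : 0 < rad b ε := rad_pos hb ε
  have hT : 0 < period b μ (ε, c) := period_pos hb hμ.continuous hpos hc
  have hy := mul_cos_mem_Ioo hc φ
  have hsnd : HasFDerivAt (fun z : ℝ × ℝ × ℝ => z.2) (ContinuousLinearMap.snd ℝ ℝ (ℝ × ℝ))
    (φ, ε, c) := hasFDerivAt_snd
  obtain ⟨A0, hA0, vA0⟩ := hasFDerivAt_arc hμ 0 (φ := φ) (ε := ε) hc
  obtain ⟨A1, hA1, vA1⟩ := hasFDerivAt_arc hμ 1 (φ := φ) (ε := ε) hc
  obtain ⟨lu, hu, vu⟩ := hasFDerivAt_logS (φ := φ) (ε := ε) hc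
  obtain ⟨lP, hP, vP⟩ := hasFDerivAt_logMom (b := b) hμ hu
  obtain ⟨lΘ, hΘ, vΘ⟩ := hasFDerivAt_angle hb hμ hpos hc hA1
    (HasFDerivAt.comp (g := period b μ) (f := fun z : ℝ × ℝ × ℝ => z.2) (φ, ε, c)
      (hasFDerivAt_period hμ (x := (ε, c)) hc) hsnd)
  obtain ⟨lσ, hσ, vσ⟩ := hasFDerivAt_angleShift hb hA0
    (HasFDerivAt.comp (g := drift b μ) (f := fun z : ℝ × ℝ × ℝ => z.2) (φ, ε, c)
      (hasFDerivAt_drift hb hμ (x := (ε, c)) hc) hsnd) hΘ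
  refine ⟨lu, lP, lσ, lΘ, _, _, hu, hP, hσ, hΘ, hasFDerivAt_action hb hμ (x := (ε, c)) hc,
    hasFDerivAt_momSq b (ε, c), fun v => ?_, fun v => ?_, ?_, fun v w => ?_⟩
  · simp
    ring
  · simp
    ring
  · have hW := weight_pos hpos 1 ε hy
    have h := vΘ (1, 0)
    simp [vA1] at h
    refine (pos_iff_pos_of_mul_pos ?_).1 hT
    rw [h]
    positivity
  -- `c1` is closedness along the arc up to `φ`. `c2` is the same over a full turn, needed because
  -- the angle is normalized by the period, which itself depends on the cycle.
  · have c1 := integral_closed hμ ε hc φ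
    have c2 := integral_closed hμ ε hc (2 * Real.pi)
    have w1 := weight_one_eq μ ε hy
    have w0 : weight μ 0 ε (c * Real.cos φ) = μ (ε + lobe (c * Real.cos φ) / 2) *
      (deriv lobe (c * Real.cos φ) / 2) := by simp [weight]
    have tv := vΘ v
    have tw := vΘ w
    have sv := vσ v
    have sw := vσ w
    have hsc := Real.sin_sq_add_cos_sq φ
    rw [vP, vP, vu, vu]
    simp only [vA0, vA1, w1] at tv tw sv sw
    simp only [Real.sin_two_pi, Real.cos_two_pi, mul_zero, zero_mul, mul_one, ← avg_zero_eq] at c2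
    simp only [arc] at tv tw sv sw
    simp only [add_apply, smul_apply,
      ContinuousLinearMap.comp_apply, ContinuousLinearMap.coe_fst', ContinuousLinearMap.coe_snd',
      smul_eq_mul, logS, momSq] at tv tw sv sw ⊢
    generalize (∫ t in (0 : ℝ)..(2 * Real.pi), deriv (weight μ 0 ε) (c * Real.cos t) * Real.cos t)
      = I0 at *
    generalize (∫ t in (0 : ℝ)..(2 * Real.pi), deriv (weight μ 1 ε) (c * Real.cos t) * Real.cos t)
      = I1 at *
    generalize (∫ t in (0 : ℝ)..φ, deriv (weight μ 0 ε) (c * Real.cos t) * Real.cos t) = C0 at *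
    generalize (∫ t in (0 : ℝ)..φ, deriv (weight μ 1 ε) (c * Real.cos t) * Real.cos t) = C1 at *
    generalize (∫ t in (0 : ℝ)..φ, weight μ 0 ε (c * Real.cos t)) = Q0 at *
    generalize (∫ t in (0 : ℝ)..φ, weight μ 1 ε (c * Real.cos t)) = Q1 at *
    generalize (∫ t in (0 : ℝ)..φ, weight (deriv μ) 0 ε (c * Real.cos t)) = E0 at *
    generalize (∫ t in (0 : ℝ)..φ, weight (deriv μ) 1 ε (c * Real.cos t)) = E1 at *
    rw [w0] at tv tw sv sw
    clear w0 w1 vA0 vA1 vΘ vσ vu vP hA0 hA1 hu hP hΘ hσ hsnd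
    generalize avg 0 (weight μ 0 ε) c = B0 at *
    generalize avg 0 (weight μ 1 ε) c = B1 at *
    generalize avg 0 (weight (deriv μ) 0 ε) c = B0' at *
    generalize avg 0 (weight (deriv μ) 1 ε) c = B1' at *
    generalize μ (ε + lobe (c * Real.cos φ) / 2) = m at *
    generalize deriv μ (ε + lobe (c * Real.cos φ) / 2) = m' at *
    generalize deriv lobe (c * Real.cos φ) / 2 = x' at *
    generalize period b μ (ε, c) = T at *
    generalize drift b μ (ε, c) = K at *
    generalize angle b μ (φ, ε, c) = Θ at *
    generalize lΘ v = Θv at *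
    generalize lΘ w = Θw at *
    generalize lσ v = σv at *
    generalize lσ w = σw at *
    generalize rad b ε = R at *
    generalize Real.cos φ = co at *
    generalize Real.sin φ = si at *
    obtain ⟨v1, v2, v3⟩ := v
    obtain ⟨w1, w2, w3⟩ := w
    dsimp only at *
    clear hc hpos hμ hb hy
    have sv' : 2 * R * σv = 2 * R * (Θv * K) + Θ * ((B0 - B0') * v2 - I0 * v3) +
        (m * x' * v1 + (E0 * v2 + C0 * v3)) - Q0 * v2 := by
      rw [sv]
      field_simp
      ring
    have sw' : 2 * R * σw = 2 * R * (Θw * K) + Θ * ((B0 - B0') * w2 - I0 * w3) +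
        (m * x' * w1 + (E0 * w2 + C0 * w3)) - Q0 * w2 := by
      rw [sw]
      field_simp
      ring
    -- The `dε∧dc` component is settled by `c1` minus the angle times `c2`; the components
    -- containing `dφ` need only `sin² + cos² = 1`.
    linear_combination (R * (1 - c ^ 2) * w2 - R * c * w3) * sv' -
      (R * (1 - c ^ 2) * v2 - R * c * v3) * sw' - w2 * tv + v2 * tw -
      R * (v2 * w3 - w2 * v3) * c1 + R * Θ * (v2 * w3 - w2 * v3) * c2 +
      m * x' * R * c * (v1 * w3 - w1 * v3) * hsc + m * x' * R * c ^ 2 * (v1 * w2 - w1 * v2) * hsc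

end

/-! ### Geometry of the cycles: energy, periodicity, and reaching every point once. -/

section

variable {b : ℝ} {μ : ℝ → ℝ}

theorem rad_sq (hb : 0 < b) (ε : ℝ) : rad b ε ^ 2 = b * Real.exp (2 * ε) := by
  rw [rad, mul_pow, Real.sq_sqrt hb.le, ← Real.exp_nat_mul, Nat.cast_two]

theorem momSq_pos (hb : 0 < b) {x : ℝ × ℝ} (hx : x.2 ∈ Ioo (-1 : ℝ) 1) : 0 < momSq b x :=
  mul_pos (pow_pos (rad_pos hb _) 2) (sub_pos.2 ((sq_lt_one_iff_abs_lt_one _).2 (abs_lt.2 hx)))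

/-- The energy on the cycle `(ε, c)`. -/
theorem energy_eq (hb : 0 < b) (hpos : ∀ u, 0 < μ u) {z : ℝ × ℝ × ℝ} (hz : z.2.2 ∈ Ioo (-1 : ℝ) 1) :
    1 / 2 * Real.exp (-(2 * logS z)) * (momSq b z.2 + (logMom b μ z / μ (logS z)) ^ 2) +
      b * logS z = b * z.2.1 + b / 2 := by
  obtain ⟨φ, ε, c⟩ := z
  have hy := mul_cos_mem_Ioo hz φ
  have h1 := one_sub_sq_eq hy
  have hw : logMom b μ (φ, ε, c) / μ (logS (φ, ε, c)) = -(rad b ε * c * Real.sin φ) := by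
    rw [logMom, mul_div_cancel_left₀ _ (hpos _).ne']
  have hsum : momSq b (ε, c) + (-(rad b ε * c * Real.sin φ)) ^ 2 =
      rad b ε ^ 2 * (1 - (c * Real.cos φ) ^ 2) := by
    simp only [momSq]
    linear_combination rad b ε ^ 2 * c ^ 2 * Real.sin_sq_add_cos_sq φ
  rw [hw, hsum, rad_sq hb]
  dsimp only at h1 ⊢
  rw [h1]
  have he : Real.exp (-(2 * logS (φ, ε, c))) * (Real.exp (2 * ε) *
      Real.exp (lobe (c * Real.cos φ))) = 1 := by
    rw [← Real.exp_add, ← Real.exp_add, Real.exp_eq_one_iff]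
    simp only [logS]
    ring
  have hu : logS (φ, ε, c) = ε + lobe (c * Real.cos φ) / 2 := rfl
  generalize Real.exp (-(2 * logS (φ, ε, c))) = A at *
  rw [hu]
  linear_combination (b * (1 - lobe (c * Real.cos φ)) / 2) * he

theorem arc_add_two_pi (hμ : Continuous μ) (l : ℝ) (k : ℤ) (φ : ℝ) {x : ℝ × ℝ}
    (hx : x.2 ∈ Ioo (-1 : ℝ) 1) :
    arc μ l (φ + k * (2 * Real.pi), x) = arc μ l (φ, x) + k * avg 0 (weight μ l x.1) x.2 := by
  have hc := continuous_weight_mul_cos hμ l x.1 hx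
  have hp : Function.Periodic (fun t => weight μ l x.1 (x.2 * Real.cos t)) (2 * Real.pi) :=
    fun t => by simp
  rw [avg_zero_eq]
  simp only [arc]
  rw [← intervalIntegral.integral_add_adjacent_intervals (hc.intervalIntegrable 0 φ)
    (hc.intervalIntegrable φ _), ← zsmul_eq_mul (2 * Real.pi) k,
    hp.intervalIntegral_add_zsmul_eq k φ hc.intervalIntegrable, hp.intervalIntegral_add_eq φ 0]
  simp

theorem angle_add_two_pi (hb : 0 < b) (hμ : Continuous μ) (hpos : ∀ u, 0 < μ u) (k : ℤ) (φ : ℝ)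
    {x : ℝ × ℝ} (hx : x.2 ∈ Ioo (-1 : ℝ) 1) :
    angle b μ (φ + k * (2 * Real.pi), x) = angle b μ (φ, x) + k := by
  have hT := period_pos hb hμ hpos hx
  simp only [angle, arc_add_two_pi hμ 1 k φ hx]
  rw [div_eq_iff hT.ne', add_mul, div_mul_cancel₀ _ hT.ne', period]
  ring

/-- Over `k` turns the angle grows by `k` and the arc integral by `k` times its average; `drift` is
minus that average over `2R`, so the secular terms cancel. This makes the displacement of `q`
single-valued on the cycle. -/
theorem angleShift_add_two_pi (hb : 0 < b) (hμ : Continuous μ) (hpos : ∀ u, 0 < μ u) (k : ℤ)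
    (φ : ℝ) {x : ℝ × ℝ} (hx : x.2 ∈ Ioo (-1 : ℝ) 1) :
    angleShift b μ (φ + k * (2 * Real.pi), x) = angleShift b μ (φ, x) := by
  simp only [angleShift, arc_add_two_pi hμ 0 k φ hx, angle_add_two_pi hb hμ hpos k φ hx, drift]
  ring

theorem logS_add_two_pi (k : ℤ) (φ : ℝ) (x : ℝ × ℝ) :
    logS (φ + k * (2 * Real.pi), x) = logS (φ, x) := by
  simp [logS]

theorem logMom_add_two_pi (k : ℤ) (φ : ℝ) (x : ℝ × ℝ) :
    logMom b μ (φ + k * (2 * Real.pi), x) = logMom b μ (φ, x) := by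
  simp [logMom, logS]

theorem hasDerivAt_arc (hμ : Continuous μ) (l φ : ℝ) {x : ℝ × ℝ} (hx : x.2 ∈ Ioo (-1 : ℝ) 1) :
    HasDerivAt (fun φ => arc μ l (φ, x)) (weight μ l x.1 (x.2 * Real.cos φ)) φ := by
  have hc := continuous_weight_mul_cos hμ l x.1 hx
  exact intervalIntegral.integral_hasDerivAt_right (hc.intervalIntegrable _ _)
    (hc.stronglyMeasurableAtFilter _ _) hc.continuousAt

theorem hasDerivAt_angle (hμ : Continuous μ) (φ : ℝ) {x : ℝ × ℝ} (hx : x.2 ∈ Ioo (-1 : ℝ) 1) :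
    HasDerivAt (fun φ => angle b μ (φ, x))
      (rad b x.1 * weight μ 1 x.1 (x.2 * Real.cos φ) / period b μ x) φ :=
  ((hasDerivAt_arc hμ 1 φ hx).const_mul (rad b x.1)).div_const (period b μ x)

theorem strictMono_angle (hb : 0 < b) (hμ : Continuous μ) (hpos : ∀ u, 0 < μ u) {x : ℝ × ℝ}
    (hx : x.2 ∈ Ioo (-1 : ℝ) 1) : StrictMono fun φ => angle b μ (φ, x) := by
  refine strictMono_of_deriv_pos fun φ => ?_
  rw [(hasDerivAt_angle hμ φ hx).deriv]
  exact div_pos (mul_pos (rad_pos hb _) (weight_pos hpos _ _ (mul_cos_mem_Ioo hx φ)))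
    (period_pos hb hμ hpos hx)

/-- At `φ = 2πk` the angle equals `k`, so the range is unbounded on both sides and continuity fills
it. -/
theorem surjective_angle (hb : 0 < b) (hμ : Continuous μ) (hpos : ∀ u, 0 < μ u) {x : ℝ × ℝ}
    (hx : x.2 ∈ Ioo (-1 : ℝ) 1) : Function.Surjective fun φ => angle b μ (φ, x) := by
  have hcont : Continuous fun φ => angle b μ (φ, x) :=
    continuous_iff_continuousAt.2 fun φ => (hasDerivAt_angle hμ φ hx).continuousAt
  have hval : ∀ k : ℤ, angle b μ (k * (2 * Real.pi), x) = k := fun k => by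
    have := angle_add_two_pi hb hμ hpos k 0 hx
    simpa [angle, arc] using this
  intro t
  refine mem_range_of_exists_le_of_exists_ge hcont ⟨⌊t⌋ * (2 * Real.pi), ?_⟩
    ⟨⌈t⌉ * (2 * Real.pi), ?_⟩
  · rw [hval]
    exact Int.floor_le t
  · rw [hval]
    exact Int.le_ceil t

/-- The action and the square of the momentum on a cycle. -/
noncomputable def cycleMap (b : ℝ) (μ : ℝ → ℝ) (x : ℝ × ℝ) : ℝ × ℝ := (action b μ x, momSq b x)

theorem hasFDerivAt_cycleMap (hb : 0 < b) (hμ : ContDiff ℝ 1 μ) {x : ℝ × ℝ}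
    (hx : x.2 ∈ Ioo (-1 : ℝ) 1) :
    ∃ L : ℝ × ℝ →L[ℝ] ℝ × ℝ, HasFDerivAt (cycleMap b μ) L x ∧
      (∀ v, (L v).1 = period b μ x * v.1 + drift b μ x * (L v).2) ∧
      ∀ v, (L v).2 = 2 * momSq b x * v.1 - 2 * rad b x.1 ^ 2 * x.2 * v.2 := by
  refine ⟨_, (hasFDerivAt_action hb hμ hx).prodMk (hasFDerivAt_momSq b x), fun v => ?_,
    fun v => ?_⟩
  · simp
    ring
  · simp
    ring

/-- On a level curve of `a` with `c > 0`, the parameter `ε` determines `c = √(1 - a/R²)` and runs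
through a half-line. Along it the derivative of the action is the period, which is positive; hence
the action determines `ε`. -/
theorem injOn_cycleMap (hb : 0 < b) (hμ : ContDiff ℝ 1 μ) (hpos : ∀ u, 0 < μ u) :
    InjOn (cycleMap b μ) (univ ×ˢ Ioo (0 : ℝ) 1) := by
  rintro ⟨ε, c⟩ hx ⟨ε', c'⟩ hx' heq
  obtain ⟨hJ, ha⟩ := Prod.ext_iff.1 heq
  have hc : c ∈ Ioo (0 : ℝ) 1 := hx.2
  have hc' : c' ∈ Ioo (0 : ℝ) 1 := hx'.2
  have hmem : ∀ {c : ℝ}, c ∈ Ioo (0 : ℝ) 1 → c ∈ Ioo (-1 : ℝ) 1 :=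
    fun h => ⟨by linarith [h.1], h.2⟩
  set a := momSq b (ε, c) with hadef
  have ha0 : 0 < a := momSq_pos hb (hmem hc)
  set γ : ℝ → ℝ × ℝ := fun t => (t, √(1 - a / rad b t ^ 2)) with hγ
  set I : Set ℝ := {t | a < rad b t ^ 2} with hI
  have hmono : StrictMono fun t => rad b t ^ 2 := fun s t hst => by
    simp only [rad_sq hb]
    exact mul_lt_mul_of_pos_left (Real.exp_lt_exp.2 (by linarith)) hb
  have hIconv : Convex ℝ I := by
    refine OrdConnected.convex ⟨fun s hs t _ w hw => lt_of_lt_of_le hs (hmono.monotone hw.1)⟩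
  have hrange : ∀ t ∈ I, 0 < 1 - a / rad b t ^ 2 ∧ (γ t).2 ∈ Ioo (0 : ℝ) 1 := fun t ht => by
    have hR := pow_pos (rad_pos hb t) 2
    have h1 : a / rad b t ^ 2 < 1 := (div_lt_one hR).2 ht
    have h2 : 0 < a / rad b t ^ 2 := div_pos ha0 hR
    refine ⟨by linarith, Real.sqrt_pos.2 (by linarith), ?_⟩
    rw [hγ, Real.sqrt_lt' one_pos]
    linarith
  have hmomγ : ∀ t ∈ I, momSq b (γ t) = a := fun t ht => by
    have hR := pow_pos (rad_pos hb t) 2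
    simp only [momSq, hγ]
    rw [Real.sq_sqrt (hrange t ht).1.le, sub_sub_cancel, mul_div_cancel₀ _ hR.ne']
  have hIopen : IsOpen I := isOpen_lt continuous_const
    (((contDiff_rad (n := 0) b).continuous).pow 2)
  have hderiv : ∀ t ∈ I, HasDerivAt (fun t => action b μ (γ t)) (period b μ (γ t)) t := by
    intro t ht
    obtain ⟨L, hL, hL1, -⟩ := hasFDerivAt_cycleMap hb hμ (hmem (hrange t ht).2)
    have hRd := ((hasDerivAt_rad b t).fun_pow 2).fun_inv (pow_pos (rad_pos hb t) 2).ne'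
    have hs := ((hRd.const_mul a).const_sub 1).sqrt (by
      simpa [div_eq_mul_inv] using (hrange t ht).1.ne')
    have hγd : ∃ d, HasDerivAt γ (1, d) t := by
      simp only [hγ, div_eq_mul_inv]
      exact ⟨_, (hasDerivAt_id t).prodMk hs⟩
    obtain ⟨d, hγd⟩ := hγd
    have hcomp := hL.comp_hasDerivAt t hγd
    have h1 : HasDerivAt (fun t => action b μ (γ t)) (L (1, d)).1 t :=
      HasFDerivAt.comp_hasDerivAt (l := Prod.fst) (f := cycleMap b μ ∘ γ) t hasFDerivAt_fst hcomp
    have h2 : HasDerivAt (fun t => momSq b (γ t)) (L (1, d)).2 t :=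
      HasFDerivAt.comp_hasDerivAt (l := Prod.snd) (f := cycleMap b μ ∘ γ) t hasFDerivAt_snd hcomp
    have h3 : HasDerivAt (fun t => momSq b (γ t)) 0 t := by
      refine (hasDerivAt_const t a).congr_of_eventuallyEq ?_
      filter_upwards [hIopen.mem_nhds ht] with s hs
      exact hmomγ s hs
    have h4 := h2.unique h3
    have h5 := hL1 (1, d)
    rw [h4] at h5
    rw [h5] at h1
    simpa using h1
  have hmonoJ : StrictMonoOn (fun t => action b μ (γ t)) I := by
    refine strictMonoOn_of_deriv_pos hIconv
      (fun t ht => (hderiv t ht).continuousAt.continuousWithinAt) fun t ht => ?_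
    rw [hIopen.interior_eq] at ht
    rw [(hderiv t ht).deriv]
    exact period_pos hb hμ.continuous hpos (hmem (hrange t ht).2)
  have hcurve : ∀ {ε c : ℝ}, c ∈ Ioo (0 : ℝ) 1 → momSq b (ε, c) = a → ε ∈ I ∧ γ ε = (ε, c) := by
    intro ε c hc h
    have hR := pow_pos (rad_pos hb ε) 2
    simp only [momSq] at h
    have hc2 : 0 < c ^ 2 := pow_pos hc.1 2
    refine ⟨?_, ?_⟩
    · simp only [hI, mem_ofPred_eq]
      nlinarith
    · simp only [hγ, Prod.mk.injEq, true_and]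
      rw [← h, mul_div_cancel_left₀ _ hR.ne', sub_sub_cancel, Real.sqrt_sq hc.1.le]
  obtain ⟨hεI, hγε⟩ := hcurve hc hadef.symm
  obtain ⟨hεI', hγε'⟩ := hcurve hc' ha.symm
  have hee : ε = ε' := hmonoJ.injOn hεI hεI' (by simp only [hγε, hγε']; exact hJ)
  rw [← hγε, ← hγε', hee]

/-- A point of the phase space determines the cycle through it and its parameter. -/
theorem eq_of_logS_eq (hb : 0 < b) (hpos : ∀ u, 0 < μ u) {φ φ' : ℝ} {x x' : ℝ × ℝ}
    (hx : x.2 ∈ Ioo (0 : ℝ) 1) (hx' : x'.2 ∈ Ioo (0 : ℝ) 1) (hu : logS (φ, x) = logS (φ', x'))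
    (hP : logMom b μ (φ, x) = logMom b μ (φ', x')) (ha : momSq b x = momSq b x') :
    x = x' ∧ ∃ k : ℤ, φ' = φ + k * (2 * Real.pi) := by
  obtain ⟨ε, c⟩ := x
  obtain ⟨ε', c'⟩ := x'
  dsimp only at hx hx'
  have hc : c ∈ Ioo (-1 : ℝ) 1 := ⟨by linarith [hx.1], hx.2⟩
  have hc' : c' ∈ Ioo (-1 : ℝ) 1 := ⟨by linarith [hx'.1], hx'.2⟩
  have e1 := energy_eq hb hpos (z := (φ, ε, c)) hc
  have e2 := energy_eq hb hpos (z := (φ', ε', c')) hc'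
  rw [hu, hP, ha, e2] at e1
  -- Equal points have equal energy, which fixes `ε`; then `a` fixes `c > 0`, and the position on
  -- the circle fixes `φ` modulo `2π`.
  have hε : ε = ε' := by
    have : b * ε = b * ε' := by
      dsimp only at e1
      linarith
    exact mul_left_cancel₀ hb.ne' this
  subst hε
  have hR := rad_pos hb ε
  have hcc : c = c' := by
    have h := mul_left_cancel₀ (pow_pos hR 2).ne' ha
    have h2 : c ^ 2 = c' ^ 2 := by
      dsimp only at h
      linarith
    exact (pow_left_inj₀ hx.1.le hx'.1.le two_ne_zero).1 h2
  subst hcc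
  refine ⟨rfl, ?_⟩
  have hcos : Real.cos φ' = Real.cos φ := by
    have h : lobe (c * Real.cos φ) = lobe (c * Real.cos φ') := by
      simp only [logS] at hu
      linarith
    have h2 := congrArg lobeCoord h
    rw [lobeCoord_lobe (mul_cos_mem_Ioo hc _), lobeCoord_lobe (mul_cos_mem_Ioo hc _)] at h2
    exact (mul_left_cancel₀ hx.1.ne' h2).symm
  have hsin : Real.sin φ' = Real.sin φ := by
    simp only [logMom, hu] at hP
    have h := neg_injective (mul_left_cancel₀ (hpos _).ne' hP)
    exact (mul_left_cancel₀ (mul_pos hR hx.1).ne' h).symm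
  obtain ⟨k, hk⟩ := Real.Angle.angle_eq_iff_two_pi_dvd_sub.1 (Real.Angle.cos_sin_inj hcos hsin)
  exact ⟨k, by linarith⟩

/-- The cycle `(ε, c)` is the whole level set. -/
theorem exists_logS_eq (hb : 0 < b) (hpos : ∀ u, 0 < μ u) {ε c u P : ℝ} (hc : c ∈ Ioo (0 : ℝ) 1)
    (h : 1 / 2 * Real.exp (-(2 * u)) * (momSq b (ε, c) + (P / μ u) ^ 2) + b * u =
      b * ε + b / 2) : ∃ φ, logS (φ, ε, c) = u ∧ logMom b μ (φ, ε, c) = P := by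
  have hR := rad_pos hb ε
  have hc' : c ∈ Ioo (-1 : ℝ) 1 := ⟨by linarith [hc.1], hc.2⟩
  have ha : 0 < momSq b (ε, c) := momSq_pos hb hc'
  set w := P / μ u with hw
  set x := 2 * (u - ε) with hx
  have hE : Real.exp (2 * ε) * Real.exp x * Real.exp (-(2 * u)) = 1 := by
    rw [← Real.exp_add, ← Real.exp_add, Real.exp_eq_one_iff, hx]
    ring
  have hE0 := Real.exp_pos (-(2 * u))
  have h1 : momSq b (ε, c) + w ^ 2 = rad b ε ^ 2 * ((1 - x) * Real.exp x) := by
    refine mul_left_cancel₀ hE0.ne' ?_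
    rw [rad_sq hb]
    have hx' : b * (1 - x) = Real.exp (-(2 * u)) * (momSq b (ε, c) + w ^ 2) := by
      rw [hx]
      linarith
    linear_combination -hx' - b * (1 - x) * hE
  have h2 := lobeCoord_sq x
  set y := lobeCoord x with hy
  have h3 : y ^ 2 + (w / rad b ε) ^ 2 = c ^ 2 := by
    simp only [momSq] at h1
    rw [div_pow]
    field_simp
    linear_combination h1 + rad b ε ^ 2 * h2
  -- The point of the unit circle whose argument is the required `φ`; the minus sign matches `P = -μ
  -- R c sin φ`.
  set ζ : ℂ := ⟨y / c, -(w / (rad b ε * c))⟩ with hζ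
  have hc0 := hc.1
  have hnorm : ‖ζ‖ = 1 := by
    have hsq : ‖ζ‖ ^ 2 = 1 := by
      rw [Complex.sq_norm, Complex.normSq_apply, hζ]
      field_simp at h3 ⊢
      linear_combination h3
    exact (pow_eq_one_iff_of_nonneg (norm_nonneg _) two_ne_zero).1 hsq
  have hζ0 : ζ ≠ 0 := by
    intro h0
    rw [h0, norm_zero] at hnorm
    exact zero_ne_one hnorm
  have hcos : c * Real.cos ζ.arg = y := by
    rw [Complex.cos_arg hζ0, hnorm, hζ]
    field_simp
  have hsin : -(rad b ε * c * Real.sin ζ.arg) = w := by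
    rw [Complex.sin_arg, hnorm, hζ]
    field_simp
  have hu : logS (ζ.arg, ε, c) = u := by
    simp only [logS]
    rw [hcos, hy, lobe_lobeCoord, hx]
    ring
  refine ⟨ζ.arg, hu, ?_⟩
  rw [logMom, hu]
  dsimp only
  rw [hsin, hw, mul_div_cancel₀ _ (hpos u).ne']

end

/-! ### Inverting the action and angle maps; the energy as a function of the actions. -/

section

variable {b : ℝ} {μ : ℝ → ℝ}

theorem Ioo_zero_one_subset {c : ℝ} (hc : c ∈ Ioo (0 : ℝ) 1) : c ∈ Ioo (-1 : ℝ) 1 :=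
  ⟨by linarith [hc.1], hc.2⟩

theorem contDiffOn_cycleMap {n : ℕ∞} (hμ : ContDiff ℝ n μ) :
    ContDiffOn ℝ n (cycleMap b μ) (univ ×ˢ Ioo (0 : ℝ) 1) :=
  ((contDiffOn_action hμ).prodMk contDiff_momSq.contDiffOn).mono
    (prod_mono_right fun _ => Ioo_zero_one_subset)

/-- The set of values of the action and of the square of the momentum. -/
def cycleValues (b : ℝ) (μ : ℝ → ℝ) : Set (ℝ × ℝ) := cycleMap b μ '' (univ ×ˢ Ioo (0 : ℝ) 1)

/-- The cycle with given action and square of the momentum. -/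
noncomputable def cycleInv (b : ℝ) (μ : ℝ → ℝ) : ℝ × ℝ → ℝ × ℝ :=
  Function.invFunOn (cycleMap b μ) (univ ×ˢ Ioo (0 : ℝ) 1)

theorem leftInvOn_cycleInv (hb : 0 < b) (hμ : ContDiff ℝ 1 μ) (hpos : ∀ u, 0 < μ u) :
    LeftInvOn (cycleInv b μ) (cycleMap b μ) (univ ×ˢ Ioo (0 : ℝ) 1) :=
  (injOn_cycleMap hb hμ hpos).leftInvOn_invFunOn

/-- The differential is triangular: when `dJ` and `da` vanish on a vector, `T dε = 0` with `T > 0`,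
and then the coefficient `2R²c` of `dc` in `da` is nonzero. Here `c > 0` is essential. -/
theorem injective_fderiv_cycleMap (hb : 0 < b) (hμ : ContDiff ℝ 1 μ) (hpos : ∀ u, 0 < μ u)
    {x : ℝ × ℝ} (hx : x.2 ∈ Ioo (0 : ℝ) 1) : Function.Injective (fderiv ℝ (cycleMap b μ) x) := by
  obtain ⟨L, hL, h1, h2⟩ := hasFDerivAt_cycleMap hb hμ (Ioo_zero_one_subset hx)
  rw [hL.fderiv, injective_iff_map_eq_zero]
  intro v hv
  have hT := period_pos hb hμ.continuous hpos (Ioo_zero_one_subset hx)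
  have hR := rad_pos hb x.1
  have e1 := h1 v
  have e2 := h2 v
  simp only [hv, Prod.fst_zero, Prod.snd_zero, mul_zero, add_zero] at e1 e2
  have hv1 : v.1 = 0 := by simpa [hT.ne'] using e1.symm
  have hv2 : v.2 = 0 := by simpa [hv1, hR.ne', hx.1.ne'] using e2
  exact Prod.ext hv1 hv2

theorem isOpen_cycleValues (hb : 0 < b) (hμ : ContDiff ℝ 1 μ) (hpos : ∀ u, 0 < μ u) :
    IsOpen (cycleValues b μ) :=
  (isOpen_image_and_contDiffOn_inverse (isOpen_univ.prod isOpen_Ioo) one_ne_zero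
    (contDiffOn_cycleMap (n := 1) hμ) (leftInvOn_cycleInv hb hμ hpos)
    fun _ hx => injective_fderiv_cycleMap hb hμ hpos hx.2).1

theorem contDiffOn_cycleInv {n : ℕ∞} (hn : 1 ≤ n) (hb : 0 < b) (hμ : ContDiff ℝ n μ)
    (hpos : ∀ u, 0 < μ u) : ContDiffOn ℝ n (cycleInv b μ) (cycleValues b μ) := by
  have hμ1 : ContDiff ℝ 1 μ := hμ.of_le (by exact_mod_cast hn)
  have hn0 : (n : WithTop ℕ∞) ≠ 0 := by
    intro h
    have : n = 0 := by exact_mod_cast h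
    simp [this] at hn
  exact (isOpen_image_and_contDiffOn_inverse (isOpen_univ.prod isOpen_Ioo) hn0
    (contDiffOn_cycleMap hμ) (leftInvOn_cycleInv hb hμ1 hpos)
    fun _ hx => injective_fderiv_cycleMap hb hμ1 hpos hx.2).2

/-- Angle, action and square of the momentum in terms of `(φ, ε, c)`. -/
noncomputable def angleMap (b : ℝ) (μ : ℝ → ℝ) (z : ℝ × ℝ × ℝ) : ℝ × ℝ × ℝ :=
  (angle b μ z, cycleMap b μ z.2)

/-- The inverse of `angleMap`. -/
noncomputable def angleInv (b : ℝ) (μ : ℝ → ℝ) : ℝ × ℝ × ℝ → ℝ × ℝ × ℝ :=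
  Function.invFunOn (angleMap b μ) (univ ×ˢ (univ ×ˢ Ioo (0 : ℝ) 1))

theorem injOn_angleMap (hb : 0 < b) (hμ : ContDiff ℝ 1 μ) (hpos : ∀ u, 0 < μ u) :
    InjOn (angleMap b μ) (univ ×ˢ (univ ×ˢ Ioo (0 : ℝ) 1)) := by
  rintro ⟨φ, x⟩ hx ⟨φ', x'⟩ hx' h
  obtain ⟨h1, h2⟩ := Prod.ext_iff.1 h
  have hxx : x = x' := injOn_cycleMap hb hμ hpos hx.2 hx'.2 h2
  subst hxx
  rw [(strictMono_angle hb hμ.continuous hpos (Ioo_zero_one_subset hx.2.2)).injective h1]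

theorem leftInvOn_angleInv (hb : 0 < b) (hμ : ContDiff ℝ 1 μ) (hpos : ∀ u, 0 < μ u) :
    LeftInvOn (angleInv b μ) (angleMap b μ) (univ ×ˢ (univ ×ˢ Ioo (0 : ℝ) 1)) :=
  (injOn_angleMap hb hμ hpos).leftInvOn_invFunOn

theorem image_angleMap (hb : 0 < b) (hμ : ContDiff ℝ 1 μ) (hpos : ∀ u, 0 < μ u) :
    angleMap b μ '' (univ ×ˢ (univ ×ˢ Ioo (0 : ℝ) 1)) = univ ×ˢ cycleValues b μ := by
  ext ⟨θ, w⟩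
  constructor
  · rintro ⟨z, hz, hzw⟩
    obtain ⟨-, h2⟩ := Prod.ext_iff.1 hzw
    exact ⟨mem_univ _, z.2, hz.2, h2⟩
  · rintro ⟨-, x, hx, rfl⟩
    obtain ⟨φ, hφ⟩ := surjective_angle hb hμ.continuous hpos (Ioo_zero_one_subset hx.2) θ
    exact ⟨(φ, x), ⟨mem_univ _, hx⟩, Prod.ext hφ rfl⟩

theorem angleMap_angleInv (hb : 0 < b) (hμ : ContDiff ℝ 1 μ) (hpos : ∀ u, 0 < μ u) {w : ℝ × ℝ × ℝ}
    (hw : w.2 ∈ cycleValues b μ) :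
    (angleInv b μ w).2.2 ∈ Ioo (0 : ℝ) 1 ∧ angleMap b μ (angleInv b μ w) = w := by
  have h : ∃ z ∈ univ ×ˢ (univ ×ˢ Ioo (0 : ℝ) 1), angleMap b μ z = w := by
    have : w ∈ angleMap b μ '' (univ ×ˢ (univ ×ˢ Ioo (0 : ℝ) 1)) := by
      rw [image_angleMap hb hμ hpos]
      exact ⟨mem_univ _, hw⟩
    exact this
  exact ⟨(Function.invFunOn_mem h).2.2, Function.invFunOn_eq h⟩

theorem contDiffOn_angleMap {n : ℕ∞} (hb : 0 < b) (hμ : ContDiff ℝ n μ) (hpos : ∀ u, 0 < μ u) :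
    ContDiffOn ℝ n (angleMap b μ) (univ ×ˢ (univ ×ˢ Ioo (0 : ℝ) 1)) :=
  ((contDiffOn_angle hb hμ hpos).mono
    (prod_mono_right (prod_mono_right fun _ => Ioo_zero_one_subset))).prodMk
    ((contDiffOn_cycleMap hμ).comp contDiffOn_snd fun _ hz => hz.2)

theorem injective_fderiv_angleMap (hb : 0 < b) (hμ : ContDiff ℝ 1 μ) (hpos : ∀ u, 0 < μ u)
    {z : ℝ × ℝ × ℝ} (hz : z.2.2 ∈ Ioo (0 : ℝ) 1) :
    Function.Injective (fderiv ℝ (angleMap b μ) z) := by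
  obtain ⟨φ, ε, c⟩ := z
  have hc := Ioo_zero_one_subset hz
  obtain ⟨-, -, -, lΘ, -, -, -, -, -, hΘ, -, -, -, -, hpos1, -⟩ :=
    exists_differentials hb hμ hpos (φ := φ) (ε := ε) hc
  have hC : HasFDerivAt (cycleMap b μ) (fderiv ℝ (cycleMap b μ) (ε, c)) (ε, c) := by
    obtain ⟨L, hL, -⟩ := hasFDerivAt_cycleMap hb hμ (x := (ε, c)) hc
    rwa [hL.fderiv]
  have hG := hΘ.prodMk (HasFDerivAt.comp (g := cycleMap b μ) (f := fun z : ℝ × ℝ × ℝ => z.2)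
    (φ, ε, c) hC hasFDerivAt_snd)
  have hG' : fderiv ℝ (angleMap b μ) (φ, ε, c) = _ := HasFDerivAt.fderiv hG
  rw [hG', injective_iff_map_eq_zero]
  rintro ⟨t, v⟩ hv
  obtain ⟨h1, h2⟩ := Prod.ext_iff.1 hv
  have hv0 : v = 0 := (injective_iff_map_eq_zero _).1
    (injective_fderiv_cycleMap hb hμ hpos (x := (ε, c)) hz) v (by simpa using h2)
  subst hv0
  have h3 : lΘ (t, 0) = t * lΘ (1, 0) := by
    rw [← smul_eq_mul, ← map_smul]
    simp
  have h4 : lΘ (t, 0) = 0 := by simpa using h1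
  rw [h3, mul_eq_zero, or_iff_left hpos1.ne'] at h4
  rw [h4]
  rfl

theorem contDiffOn_angleInv {n : ℕ∞} (hn : 1 ≤ n) (hb : 0 < b) (hμ : ContDiff ℝ n μ)
    (hpos : ∀ u, 0 < μ u) : ContDiffOn ℝ n (angleInv b μ) (univ ×ˢ cycleValues b μ) := by
  have hμ1 : ContDiff ℝ 1 μ := hμ.of_le (by exact_mod_cast hn)
  have hn0 : (n : WithTop ℕ∞) ≠ 0 := by
    intro h
    have : n = 0 := by exact_mod_cast h
    simp [this] at hn
  rw [← image_angleMap hb hμ1 hpos]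
  exact (isOpen_image_and_contDiffOn_inverse (isOpen_univ.prod (isOpen_univ.prod isOpen_Ioo)) hn0
    (contDiffOn_angleMap hb hμ hpos) (leftInvOn_angleInv hb hμ1 hpos)
    fun _ hz => injective_fderiv_angleMap hb hμ1 hpos hz.2.2).2

/-- The energy parameter as a function of the action and of the square of the momentum. -/
noncomputable def energyLevel (b : ℝ) (μ : ℝ → ℝ) (w : ℝ × ℝ) : ℝ := (cycleInv b μ w).1

theorem contDiffOn_energyLevel {n : ℕ∞} (hn : 1 ≤ n) (hb : 0 < b) (hμ : ContDiff ℝ n μ)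
    (hpos : ∀ u, 0 < μ u) : ContDiffOn ℝ n (energyLevel b μ) (cycleValues b μ) :=
  (contDiffOn_cycleInv hn hb hμ hpos).fst

theorem energyLevel_cycleMap (hb : 0 < b) (hμ : ContDiff ℝ 1 μ) (hpos : ∀ u, 0 < μ u) {x : ℝ × ℝ}
    (hx : x.2 ∈ Ioo (0 : ℝ) 1) : energyLevel b μ (cycleMap b μ x) = x.1 := by
  rw [energyLevel, leftInvOn_cycleInv hb hμ hpos ⟨mem_univ _, hx⟩]

/-- Solve `dJ = T dε + K da` for `dε`. -/
theorem hasFDerivAt_energyLevel (hb : 0 < b) (hμ : ContDiff ℝ 1 μ) (hpos : ∀ u, 0 < μ u) {x : ℝ × ℝ}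
    (hx : x.2 ∈ Ioo (0 : ℝ) 1) :
    HasFDerivAt (energyLevel b μ) ((period b μ x)⁻¹ • ContinuousLinearMap.fst ℝ ℝ ℝ +
      (-(drift b μ x / period b μ x)) • ContinuousLinearMap.snd ℝ ℝ ℝ) (cycleMap b μ x) := by
  obtain ⟨L, hL, h1, h2⟩ := hasFDerivAt_cycleMap hb hμ (Ioo_zero_one_subset hx)
  have hT := period_pos hb hμ.continuous hpos (Ioo_zero_one_subset hx)
  have hR := rad_pos hb x.1
  have hmem : cycleMap b μ x ∈ cycleValues b μ := ⟨x, ⟨mem_univ _, hx⟩, rfl⟩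
  have he := (((contDiffOn_energyLevel (n := 1) le_rfl hb hμ hpos).contDiffAt
    ((isOpen_cycleValues hb hμ hpos).mem_nhds hmem)).differentiableAt one_ne_zero).hasFDerivAt
  have hcomp := HasFDerivAt.comp (g := energyLevel b μ) (f := cycleMap b μ) x he hL
  have hfst : HasFDerivAt (energyLevel b μ ∘ cycleMap b μ) (ContinuousLinearMap.fst ℝ ℝ ℝ) x := by
    refine hasFDerivAt_fst.congr_of_eventuallyEq ?_
    have hU : univ ×ˢ Ioo (0 : ℝ) 1 ∈ 𝓝 x :=
      (isOpen_univ.prod isOpen_Ioo).mem_nhds ⟨mem_univ _, hx⟩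
    filter_upwards [hU] with y hy
    exact energyLevel_cycleMap hb hμ hpos hy.2
  have heq := hcomp.unique hfst
  refine he.congr_fderiv (ContinuousLinearMap.ext fun w => ?_)
  -- The preimage of `w` under the differential of `cycleMap`.
  set v : ℝ × ℝ := ((w.1 - drift b μ x * w.2) / period b μ x,
    (2 * momSq b x * ((w.1 - drift b μ x * w.2) / period b μ x) - w.2) /
      (2 * rad b x.1 ^ 2 * x.2)) with hv
  have hLv2 : (L v).2 = w.2 := by
    have := hx.1
    rw [h2, hv]
    field_simp
    ring
  have hLv : L v = w := by
    refine Prod.ext ?_ hLv2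
    rw [h1, hLv2, hv]
    field_simp
    ring
  have h3 := congrArg (fun l : ℝ × ℝ →L[ℝ] ℝ => l v) heq
  simp only [ContinuousLinearMap.comp_apply, hLv, ContinuousLinearMap.coe_fst'] at h3
  rw [h3, hv]
  simp
  ring

/-- The differential of `energyLevel` in terms of the cycle. -/
theorem hasFDerivAt_fderiv_energyLevel (hb : 0 < b) (hμ : ContDiff ℝ 2 μ) (hpos : ∀ u, 0 < μ u)
    {x : ℝ × ℝ} (hx : x.2 ∈ Ioo (0 : ℝ) 1) {T' K' : ℝ × ℝ →L[ℝ] ℝ} {L : ℝ × ℝ →L[ℝ] ℝ × ℝ}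
    (hT' : HasFDerivAt (period b μ) T' x) (hK' : HasFDerivAt (drift b μ) K' x)
    (hL : HasFDerivAt (cycleMap b μ) L x) (v w : ℝ × ℝ) :
    period b μ x ^ 2 * fderiv ℝ (fderiv ℝ (energyLevel b μ)) (cycleMap b μ x) (L v) w =
      -T' v * w.1 - (K' v * period b μ x - drift b μ x * T' v) * w.2 := by
  have hμ1 : ContDiff ℝ 1 μ := hμ.of_le (by norm_num)
  have hT := period_pos hb hμ1.continuous hpos (Ioo_zero_one_subset hx)
  have hmem : cycleMap b μ x ∈ cycleValues b μ := ⟨x, ⟨mem_univ _, hx⟩, rfl⟩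
  have h2 : DifferentiableAt ℝ (fderiv ℝ (energyLevel b μ)) (cycleMap b μ x) :=
    (((contDiffOn_energyLevel (n := 2) (by norm_num) hb hμ hpos).contDiffAt
      ((isOpen_cycleValues hb hμ1 hpos).mem_nhds hmem)).fderiv_right (m := 1)
      (by norm_num)).differentiableAt one_ne_zero
  have hcomp := HasFDerivAt.comp (g := fderiv ℝ (energyLevel b μ)) (f := cycleMap b μ) x
    h2.hasFDerivAt hL
  have hTinv := (hasDerivAt_inv hT.ne').comp_hasFDerivAt x hT'
  have hE := (hTinv.smul (hasFDerivAt_const (ContinuousLinearMap.fst ℝ ℝ ℝ) x)).add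
    ((hK'.mul hTinv).neg.smul (hasFDerivAt_const (ContinuousLinearMap.snd ℝ ℝ ℝ) x))
  have hU : univ ×ˢ Ioo (0 : ℝ) 1 ∈ 𝓝 x :=
    (isOpen_univ.prod isOpen_Ioo).mem_nhds ⟨mem_univ _, hx⟩
  -- The first derivative is known explicitly at all nearby cycles, so the second is obtained by
  -- differentiating it along `cycleMap`.
  have heq := (hcomp.congr_of_eventuallyEq (f₁ := _) (by
    filter_upwards [hU] with y hy
    exact (hasFDerivAt_energyLevel hb hμ1 hpos hy.2).fderiv.symm)).unique hE
  have h3 := congrArg (fun l : ℝ × ℝ →L[ℝ] (ℝ × ℝ →L[ℝ] ℝ) => l v w) heq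
  simp only [ContinuousLinearMap.comp_apply] at h3
  rw [h3]
  simp
  field_simp
  ring

end

/-! ### The non-degeneracy conditions in terms of the discriminants. -/

section

variable {b : ℝ} {μ : ℝ → ℝ}

theorem integral_deriv_weight_mul_cos (hμ : ContDiff ℝ 2 μ) (l ε : ℝ) {c : ℝ}
    (hc : c ∈ Ioo (-1 : ℝ) 1) :
    ∫ t in (0 : ℝ)..(2 * Real.pi), deriv (weight μ l ε) (c * Real.cos t) * Real.cos t =
      c * avg 1 (deriv^[2] (weight μ l ε)) c := by
  have h := integral_deriv_mul_cos 0 (f := deriv (weight μ l ε))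
    ((contDiffOn_weight_right (n := 2) hμ l ε).deriv_of_isOpen isOpen_Ioo (by norm_num)) hc
  simpa using h

/-- The two non-degeneracy conditions on the Taylor polynomial of `energyLevel`. -/
theorem energyLevel_nondegenerate (hb : 0 < b) (hμ : ContDiff ℝ 2 μ) (hpos : ∀ u, 0 < μ u)
    {x : ℝ × ℝ} (hx : x.2 ∈ Ioo (0 : ℝ) 1) (hiso : isoDiscr μ x.1 x.2 ≠ 0)
    (hkol : kolDiscr μ x.1 x.2 ≠ 0) {D₁ : ℝ × ℝ →L[ℝ] ℝ} {D₂ : ℝ × ℝ →L[ℝ] ℝ × ℝ →L[ℝ] ℝ}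
    (hD₁ : D₁ = fderiv ℝ (energyLevel b μ) (cycleMap b μ x))
    (hD₂ : D₂ = fderiv ℝ (fderiv ℝ (energyLevel b μ)) (cycleMap b μ x)) :
    D₁ (0, 1) ≠ 0 ∧
    D₂ (0, 1) (1, 0) = D₂ (1, 0) (0, 1) ∧
    D₂ (1, 0) (1, 0) * (2 * momSq b x * D₂ (0, 1) (0, 1) + D₁ (0, 1)) -
      2 * momSq b x * D₂ (1, 0) (0, 1) ^ 2 ≠ 0 ∧
    D₁ (1, 0) ^ 2 * (2 * momSq b x * D₂ (0, 1) (0, 1) + D₁ (0, 1)) -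
      4 * momSq b x * D₁ (1, 0) * D₁ (0, 1) * D₂ (1, 0) (0, 1) +
      2 * momSq b x * D₁ (0, 1) ^ 2 * D₂ (1, 0) (1, 0) ≠ 0 := by
  have hc := Ioo_zero_one_subset hx
  have hc0 : x.2 ≠ 0 := hx.1.ne'
  have hμ1 : ContDiff ℝ 1 μ := hμ.of_le (by norm_num)
  have hR := rad_pos hb x.1
  have hT := period_pos hb hμ1.continuous hpos hc
  obtain ⟨L, hL, hL1, hL2⟩ := hasFDerivAt_cycleMap hb hμ1 hc
  have hT' := hasFDerivAt_period (b := b) hμ1 hc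
  have hK' := hasFDerivAt_drift hb hμ1 hc
  rw [integral_deriv_weight_mul_cos hμ _ _ hc] at hT' hK'
  have hmem : cycleMap b μ x ∈ cycleValues b μ := ⟨x, ⟨mem_univ _, hx⟩, rfl⟩
  have hsymm : IsSymmSndFDerivAt ℝ (energyLevel b μ) (cycleMap b μ x) :=
    ((contDiffOn_energyLevel (n := 2) (by norm_num) hb hμ hpos).contDiffAt
      ((isOpen_cycleValues hb hμ1 hpos).mem_nhds hmem)).isSymmSndFDerivAt (by simp)
  have key := hasFDerivAt_fderiv_energyLevel hb hμ hpos hx hT' hK' hL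
  have hsym : D₂ (0, 1) (1, 0) = D₂ (1, 0) (0, 1) := hD₂ ▸ hsymm (0, 1) (1, 0)
  rw [← hD₂] at key
  have h1 := (hasFDerivAt_energyLevel hb hμ1 hpos hx).fderiv
  rw [← hD₁] at h1
  have hα : D₁ (1, 0) = (period b μ x)⁻¹ := by simp [h1]
  have hβ : D₁ (0, 1) = -(drift b μ x / period b μ x) := by simp [h1]
  have hK : drift b μ x = -(avg 0 (weight μ 0 x.1) x.2 / (2 * rad b x.1)) := rfl
  have hK0 : drift b μ x ≠ 0 := by
    rw [hK]
    exact (neg_neg_of_pos (div_pos (avg_zero_weight_pos hμ1.continuous hpos 0 x.1 hc)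
      (by positivity))).ne
  have ha : momSq b x = rad b x.1 ^ 2 * (1 - x.2 ^ 2) := rfl
  -- `vJ` and `va` represent `∂/∂J` and `∂/∂a` in the coordinates `(ε, c)`: they are the columns of
  -- the inverse differential.
  set vJ : ℝ × ℝ := ((period b μ x)⁻¹, (period b μ x)⁻¹ * ((1 - x.2 ^ 2) / x.2)) with hvJ
  set va : ℝ × ℝ := (-(drift b μ x / period b μ x),
    -(drift b μ x / period b μ x) * ((1 - x.2 ^ 2) / x.2) - (2 * rad b x.1 ^ 2 * x.2)⁻¹) with hva
  have hLJ : L vJ = (1, 0) := by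
    have h2 : (L vJ).2 = 0 := by
      rw [hL2, hvJ, ha]
      field_simp
      ring
    refine Prod.ext ?_ h2
    rw [hL1, h2, hvJ]
    field_simp
    ring
  have hLa : L va = (0, 1) := by
    have h2 : (L va).2 = 1 := by
      rw [hL2, hva, ha]
      field_simp
      ring
    refine Prod.ext ?_ h2
    rw [hL1, h2, hva]
    field_simp
    ring
  have e1 := key vJ (1, 0)
  have e2 := key vJ (0, 1)
  have e3 := key va (1, 0)
  have e4 := key va (0, 1)
  rw [hLJ] at e1 e2
  rw [hLa, hsym] at e3
  rw [hLa] at e4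
  simp only [hvJ, hva, add_apply, smul_apply, ContinuousLinearMap.coe_fst',
    ContinuousLinearMap.coe_snd', smul_eq_mul] at e1 e2 e3 e4
  refine ⟨by rw [hβ]; exact neg_ne_zero.2 (div_ne_zero hK0 hT.ne'), hsym, fun h => hkol ?_,
    fun h => hiso ?_⟩
  all_goals
    rw [hβ] at h
    try rw [hα] at h
    rw [ha] at h
    simp only [kolDiscr, isoDiscr]
    clear hsymm key hT' hK' hL hLJ hLa hL1 hL2 h1 hD₁ hD₂ hα hβ ha hsym hkol hiso
    clear_value vJ va
    generalize D₂ (1, 0) (1, 0) = A at *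
    generalize D₂ (1, 0) (0, 1) = B at *
    generalize D₂ (0, 1) (0, 1) = C at *
    generalize avg 0 (weight μ 0 x.1) x.2 = K0 at *
    generalize avg 0 (weight (deriv μ) 0 x.1) x.2 = K1 at *
    generalize avg 1 (deriv^[2] (weight μ 0 x.1)) x.2 = K2 at *
    generalize avg 0 (weight μ 1 x.1) x.2 = T0 at *
    generalize avg 0 (weight (deriv μ) 1 x.1) x.2 = T1 at *
    generalize avg 1 (deriv^[2] (weight μ 1 x.1)) x.2 = T2 at *
    generalize period b μ x = T at *
    generalize rad b x.1 = R at *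
    generalize x.2 = c at *
    -- In the coordinates `(ε, a)`, `τε` and `τa` are the partial derivatives of the period, `κε`
    -- and `κa` those of the drift.
    obtain ⟨τε, hτε⟩ : ∃ τ, τ = R * (T0 + T1 + (1 - c ^ 2) * T2) := ⟨_, rfl⟩
    obtain ⟨κa, hκa⟩ : ∃ κ, κ = K2 / (4 * R ^ 3) := ⟨_, rfl⟩
    obtain ⟨τa, hτa⟩ : ∃ τ, τ = -(T2 / (2 * R)) := ⟨_, rfl⟩
    obtain ⟨κε, hκε⟩ : ∃ κ, κ = (K0 - K1) / (2 * R) - K2 * (1 - c ^ 2) / (2 * R) := ⟨_, rfl⟩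
    have f1 : T ^ 3 * A = -τε := by
      rw [show T ^ 3 * A = T * (T ^ 2 * A) by ring, e1, hτε]
      field_simp
      ring
    have f2 : T ^ 3 * B = drift b μ x * τε - T * κε := by
      rw [show T ^ 3 * B = T * (T ^ 2 * B) by ring, e2, hτε, hκε]
      field_simp
      ring
    have f3 : T ^ 3 * B = drift b μ x * τε - T * τa := by
      rw [show T ^ 3 * B = T * (T ^ 2 * B) by ring, e3, hτε, hτa]
      field_simp
      ring
    have f4 : T ^ 3 * C = -κa * T ^ 2 + drift b μ x * T * κε + drift b μ x * T * τa -
        drift b μ x ^ 2 * τε := by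
      rw [show T ^ 3 * C = T * (T ^ 2 * C) by ring, e4, hτε, hτa, hκε, hκa]
      field_simp
      ring
    -- Both are the mixed second derivative of the action; the equality follows from the symmetry of
    -- the second derivative of `energyLevel`.
    have f5 : κε = τa := mul_left_cancel₀ hT.ne' (by linear_combination f2 - f3)
    rw [f5] at f4
    clear e1 e2 e3 e4 f2 hκε
  -- The bracket `2aκa + K` is `isoDiscr / (2R)`, and `τε (2aκa + K) - 2aτa²` is `kolDiscr / 2`.
  · have h6 : T ^ 2 * (τε * (2 * (R ^ 2 * (1 - c ^ 2)) * κa + drift b μ x) -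
        2 * (R ^ 2 * (1 - c ^ 2)) * τa ^ 2) = 0 := by
      have h5 : T ^ 3 * A * (2 * (R ^ 2 * (1 - c ^ 2)) * (T ^ 3 * C) - drift b μ x * T ^ 2) -
          2 * (R ^ 2 * (1 - c ^ 2)) * (T ^ 3 * B) ^ 2 = 0 := by
        rw [← mul_zero (T ^ 6), ← h]
        field_simp
        ring
      rw [f1, f3, f4] at h5
      linear_combination h5
    have h7 := (mul_eq_zero.1 h6).resolve_left (pow_pos hT 2).ne'
    rw [hτε, hκa, hτa, hK] at h7
    field_simp at h7
    linear_combination h7 / 4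
  · have h6 : T ^ 2 * (2 * (R ^ 2 * (1 - c ^ 2)) * κa + drift b μ x) = 0 := by
      have h5 : 2 * (R ^ 2 * (1 - c ^ 2)) * (T ^ 3 * C) - drift b μ x * T ^ 2 +
          4 * (R ^ 2 * (1 - c ^ 2)) * drift b μ x * (T ^ 3 * B) +
          2 * (R ^ 2 * (1 - c ^ 2)) * drift b μ x ^ 2 * (T ^ 3 * A) = 0 := by
        rw [← mul_zero (T ^ 5), ← h]
        field_simp
        ring
      rw [f1, f3, f4] at h5
      linear_combination -h5
    have h7 := (mul_eq_zero.1 h6).resolve_left (pow_pos hT 2).ne'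
    rw [hκa, hK] at h7
    field_simp at h7
    linear_combination h7 / 4

end

/-! ### From the determinants to the second-order jet of the energy function. -/

theorem apply_eq_sum_single {m : ℕ} (l : (Fin m → ℝ) →L[ℝ] ℝ) (u : Fin m → ℝ) :
    l u = ∑ j, u j * l (Pi.single j 1) := by
  conv_lhs => rw [pi_eq_sum_univ' u]
  rw [map_sum]
  refine Finset.sum_congr rfl fun j _ => ?_
  rw [map_smul, smul_eq_mul]

theorem apply_apply_eq_sum_single {m : ℕ} (l : (Fin m → ℝ) →L[ℝ] (Fin m → ℝ) →L[ℝ] ℝ)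
    (x u : Fin m → ℝ) : l x u = ∑ i, x i * l (Pi.single i 1) u :=
  apply_eq_sum_single (l.flip u) x

theorem det_hessian_ne_zero {m : ℕ} {h : (Fin m → ℝ) → ℝ} {C : Fin m → ℝ}
    (H : ∀ x, (∀ u, fderiv ℝ (fderiv ℝ h) C x u = 0) → x = 0) : (hessian h C).det ≠ 0 := by
  intro hdet
  obtain ⟨x, hx0, hx⟩ := Matrix.exists_vecMul_eq_zero_iff.2 hdet
  refine hx0 (H x fun u => ?_)
  rw [apply_eq_sum_single]
  refine Finset.sum_eq_zero fun j _ => ?_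
  rw [apply_apply_eq_sum_single, mul_eq_zero]
  exact Or.inr (congrFun hx j)

/-- A kernel vector of the bordered matrix is a pair `(x, t)`, with `t` acting as a Lagrange
multiplier for the energy constraint. -/
theorem det_borderedHessian_ne_zero {m : ℕ} {h : (Fin m → ℝ) → ℝ} {C : Fin m → ℝ}
    (H : ∀ x t, (∀ u, fderiv ℝ (fderiv ℝ h) C x u + t * fderiv ℝ h C u = 0) →
      fderiv ℝ h C x = 0 → x = 0 ∧ t = 0) : (borderedHessian h C).det ≠ 0 := by
  intro hdet
  obtain ⟨y, hy0, hy⟩ := Matrix.exists_vecMul_eq_zero_iff.2 hdet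
  set x : Fin m → ℝ := fun i => y (Sum.inl i) with hx
  set t : ℝ := y (Sum.inr ()) with ht
  have hxt : x = 0 ∧ t = 0 := by
    refine H x t (fun u => ?_) ?_
    · rw [apply_eq_sum_single, apply_eq_sum_single, Finset.mul_sum, ← Finset.sum_add_distrib]
      refine Finset.sum_eq_zero fun j _ => ?_
      have h1 := congrFun hy (Sum.inl j)
      simp only [Matrix.vecMul, dotProduct, borderedHessian, Fintype.sum_sum_type,
        Matrix.fromBlocks_apply₁₁, Matrix.fromBlocks_apply₂₁, Finset.univ_unique,
        Finset.sum_singleton, Matrix.replicateRow_apply, frequency, hessian, Matrix.of_apply,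
        Pi.zero_apply] at h1
      rw [apply_apply_eq_sum_single]
      linear_combination u j * h1
    · have h1 := congrFun hy (Sum.inr ())
      simp only [Matrix.vecMul, dotProduct, borderedHessian, Fintype.sum_sum_type,
        Matrix.fromBlocks_apply₁₂, Matrix.fromBlocks_apply₂₂, Finset.univ_unique,
        Finset.sum_singleton, Matrix.replicateCol_apply, frequency, Matrix.zero_apply, mul_zero,
        add_zero, Pi.zero_apply] at h1
      rw [apply_eq_sum_single]
      exact h1
  refine hy0 (funext ?_)
  rintro (i | ⟨⟩)
  · exact congrFun hxt.1 i
  · exact hxt.2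

section

variable {n : ℕ} {B : (Fin n → ℝ) →L[ℝ] (Fin n → ℝ) →L[ℝ] ℝ}

/-- Forgetting the first coordinate. -/
noncomputable def tailL (n : ℕ) : (Fin (n + 1) → ℝ) →L[ℝ] (Fin n → ℝ) :=
  ContinuousLinearMap.pi fun i => ContinuousLinearMap.proj i.succ

@[simp]
theorem tailL_apply (I : Fin (n + 1) → ℝ) (i : Fin n) : tailL n I i = I i.succ := rfl

@[simp]
theorem tailL_cons (x : ℝ) (p : Fin n → ℝ) : tailL n (Fin.cons x p) = p := by
  ext i
  simp

theorem cons_tailL (I : Fin (n + 1) → ℝ) : (Fin.cons (I 0) (tailL n I) : Fin (n + 1) → ℝ) = I :=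
  Fin.cons_self_tail I

/-- The first action and the square of the norm of the remaining ones. -/
noncomputable def actionPair (B : (Fin n → ℝ) →L[ℝ] (Fin n → ℝ) →L[ℝ] ℝ) (I : Fin (n + 1) → ℝ) :
    ℝ × ℝ := (I 0, B (tailL n I) (tailL n I))

theorem contDiff_actionPair {r : WithTop ℕ∞} : ContDiff ℝ r (actionPair B) := by
  have h1 : ContDiff ℝ r fun I : Fin (n + 1) → ℝ => B (tailL n I) :=
    B.contDiff.comp (tailL n).contDiff
  have h2 : ContDiff ℝ r fun I : Fin (n + 1) → ℝ => I 0 := contDiff_apply ℝ ℝ 0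
  exact h2.prodMk (h1.clm_apply (tailL n).contDiff)

theorem hasFDerivAt_actionPair (hB : ∀ p q, B p q = B q p) (I : Fin (n + 1) → ℝ) :
    ∃ L : (Fin (n + 1) → ℝ) →L[ℝ] ℝ × ℝ, HasFDerivAt (actionPair B) L I ∧
      ∀ v, L v = (v 0, 2 * B (tailL n I) (tailL n v)) := by
  have h0 : HasFDerivAt (fun I : Fin (n + 1) → ℝ => I 0)
    (ContinuousLinearMap.proj (R := ℝ) (φ := fun _ => ℝ) 0) I := hasFDerivAt_apply 0 I
  have h1 : HasFDerivAt (fun I : Fin (n + 1) → ℝ => B (tailL n I)) _ I :=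
    (B.comp (tailL n)).hasFDerivAt
  refine ⟨_, h0.prodMk (h1.clm_apply (tailL n).hasFDerivAt), fun v => ?_⟩
  have := hB (tailL n v) (tailL n I)
  simp
  linarith

/-- The Hamiltonian in terms of the actions. -/
noncomputable def actionHam (B : (Fin n → ℝ) →L[ℝ] (Fin n → ℝ) →L[ℝ] ℝ) (b : ℝ) (e : ℝ × ℝ → ℝ)
    (I : Fin (n + 1) → ℝ) : ℝ := b * e (actionPair B I) + b / 2

variable {b : ℝ} {e : ℝ × ℝ → ℝ} {I : Fin (n + 1) → ℝ}

theorem contDiffAt_actionHam {r : WithTop ℕ∞} (he : ContDiffAt ℝ r e (actionPair B I)) :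
    ContDiffAt ℝ r (actionHam B b e) I :=
  (contDiffAt_const.mul (he.comp I contDiff_actionPair.contDiffAt)).add contDiffAt_const

theorem fderiv_actionHam (hB : ∀ p q, B p q = B q p)
    (he : DifferentiableAt ℝ e (actionPair B I)) (v : Fin (n + 1) → ℝ) :
    fderiv ℝ (actionHam B b e) I v =
      b * fderiv ℝ e (actionPair B I) (v 0, 2 * B (tailL n I) (tailL n v)) := by
  obtain ⟨L, hL, hLv⟩ := hasFDerivAt_actionPair hB I
  have h : HasFDerivAt (actionHam B b e) _ I :=
    ((he.hasFDerivAt.comp I hL).const_mul b).add_const (b / 2)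
  rw [h.fderiv]
  simp [hLv]

theorem fderiv_fderiv_actionHam (hB : ∀ p q, B p q = B q p)
    (he : ContDiffAt ℝ 2 e (actionPair B I)) (v u : Fin (n + 1) → ℝ) :
    fderiv ℝ (fderiv ℝ (actionHam B b e)) I v u =
      b * (fderiv ℝ (fderiv ℝ e) (actionPair B I) (v 0, 2 * B (tailL n I) (tailL n v))
        (u 0, 2 * B (tailL n I) (tailL n u)) +
        fderiv ℝ e (actionPair B I) (0, 2 * B (tailL n v) (tailL n u))) := by
  obtain ⟨L, hL, hLv⟩ := hasFDerivAt_actionPair hB I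
  have hd : DifferentiableAt ℝ (fderiv ℝ (actionHam B b e)) I :=
    ((contDiffAt_actionHam he).fderiv_right (m := 1) (by norm_num)).differentiableAt one_ne_zero
  have hde : DifferentiableAt ℝ (fderiv ℝ e) (actionPair B I) :=
    (he.fderiv_right (m := 1) (by norm_num)).differentiableAt one_ne_zero
  have h1 := hd.hasFDerivAt.clm_apply (hasFDerivAt_const u I)
  have h3 : HasFDerivAt (fun I : Fin (n + 1) → ℝ => B (tailL n I) (tailL n u)) _ I :=
    ((B.flip (tailL n u)).comp (tailL n)).hasFDerivAt
  have h2 := ((hde.hasFDerivAt.comp I hL).clm_apply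
    ((hasFDerivAt_const (u 0) I).prodMk (h3.const_mul 2))).const_mul b
  have hev : (fun y => fderiv ℝ (actionHam B b e) y u) =ᶠ[𝓝 I] fun y =>
      b * (fderiv ℝ e ∘ actionPair B) y (u 0, 2 * B (tailL n y) (tailL n u)) := by
    have hcont : ContinuousAt (actionPair B) I := (contDiff_actionPair (r := 0)).continuous.continuousAt
    have hev' := (he.eventually (by simp)).filter_mono hcont
    filter_upwards [hev'] with y hy
    have hy' : ContDiffAt ℝ 2 e (actionPair B y) := hy
    exact fderiv_actionHam hB (hy'.differentiableAt two_ne_zero) u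
  have h4 := congrArg (fun l : (Fin (n + 1) → ℝ) →L[ℝ] ℝ => l v)
    ((h2.congr_of_eventuallyEq hev).unique h1)
  simp [hLv] at h4
  rw [← h4]
  ring

theorem clm_apply_mk (l : ℝ × ℝ →L[ℝ] ℝ) (x y : ℝ) : l (x, y) = x * l (1, 0) + y * l (0, 1) := by
  have h : ((x, y) : ℝ × ℝ) = x • (1, 0) + y • (0, 1) := by simp
  rw [h, map_add, map_smul, map_smul, smul_eq_mul, smul_eq_mul]

theorem clm_apply_apply_mk (l : ℝ × ℝ →L[ℝ] ℝ × ℝ →L[ℝ] ℝ) (x y : ℝ) (v : ℝ × ℝ) :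
    l (x, y) v = x * l (1, 0) v + y * l (0, 1) v :=
  clm_apply_mk (l.flip v) x y

/-- Both determinants of the Hamiltonian, reduced to the two-dimensional Taylor polynomial. -/
theorem det_ne_zero_of_taylor (hb : b ≠ 0) (hB : ∀ p q, B p q = B q p)
    (hpos : ∀ p, p ≠ 0 → 0 < B p p) (he : ContDiffAt ℝ 2 e (actionPair B I))
    {D₁ : ℝ × ℝ →L[ℝ] ℝ} {D₂ : ℝ × ℝ →L[ℝ] ℝ × ℝ →L[ℝ] ℝ}
    (hD₁ : D₁ = fderiv ℝ e (actionPair B I)) (hD₂ : D₂ = fderiv ℝ (fderiv ℝ e) (actionPair B I))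
    {a : ℝ} (ha : a = B (tailL n I) (tailL n I))
    (hβ : D₁ (0, 1) ≠ 0) (hsym : D₂ (0, 1) (1, 0) = D₂ (1, 0) (0, 1))
    (hkol : D₂ (1, 0) (1, 0) * (2 * a * D₂ (0, 1) (0, 1) + D₁ (0, 1)) -
      2 * a * D₂ (1, 0) (0, 1) ^ 2 ≠ 0)
    (hiso : D₁ (1, 0) ^ 2 * (2 * a * D₂ (0, 1) (0, 1) + D₁ (0, 1)) -
      4 * a * D₁ (1, 0) * D₁ (0, 1) * D₂ (1, 0) (0, 1) +
      2 * a * D₁ (0, 1) ^ 2 * D₂ (1, 0) (1, 0) ≠ 0) :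
    (hessian (actionHam B b e) I).det ≠ 0 ∧ (borderedHessian (actionHam B b e) I).det ≠ 0 := by
  have h1 : ∀ v, fderiv ℝ (actionHam B b e) I v =
      b * (v 0 * D₁ (1, 0) + 2 * B (tailL n I) (tailL n v) * D₁ (0, 1)) := fun v => by
    rw [fderiv_actionHam hB (he.differentiableAt two_ne_zero), ← hD₁, clm_apply_mk]
  have h2 : ∀ v u, fderiv ℝ (fderiv ℝ (actionHam B b e)) I v u =
      b * (u 0 * (v 0 * D₂ (1, 0) (1, 0) + 2 * B (tailL n I) (tailL n v) * D₂ (1, 0) (0, 1)) +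
        2 * B (tailL n I) (tailL n u) * (v 0 * D₂ (1, 0) (0, 1) +
          2 * B (tailL n I) (tailL n v) * D₂ (0, 1) (0, 1)) +
        2 * B (tailL n v) (tailL n u) * D₁ (0, 1)) := fun v u => by
    rw [fderiv_fderiv_actionHam hB he, ← hD₁, ← hD₂, clm_apply_mk, clm_apply_apply_mk _ _ _ (1, 0),
      clm_apply_apply_mk _ _ _ (0, 1), clm_apply_mk D₁, hsym]
    ring
  have hzero : ∀ x : Fin (n + 1) → ℝ, x 0 = 0 → tailL n x = 0 → x = 0 := fun x h0 ht => by
    rw [← cons_tailL x, h0, ht]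
    ext i
    refine Fin.cases ?_ (fun i => ?_) i <;> simp
  set α := D₁ (1, 0)
  set β := D₁ (0, 1)
  set A := D₂ (1, 0) (1, 0)
  set M := D₂ (1, 0) (0, 1)
  set C := D₂ (0, 1) (0, 1)
  refine ⟨det_hessian_ne_zero fun x hx => ?_, det_borderedHessian_ne_zero fun x t hx hx' => ?_⟩
  -- Testing against the `J` direction and against `p` itself gives a linear system for `x 0` and `s
  -- = 2 B(p, x')`, whose determinant is the one in `hkol`. The third test, against the tail `x'` of
  -- `x`, handles what is orthogonal to `p`.
  · have e1 := hx (Fin.cons 1 0)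
    have e2 := hx (Fin.cons 0 (tailL n I))
    have e3 := hx (Fin.cons 0 (tailL n x))
    simp only [h2, tailL_cons, Fin.cons_zero, map_zero] at e1 e2 e3
    rw [mul_eq_zero, or_iff_right hb] at e1 e2 e3
    rw [hB (tailL n x) (tailL n I), ← ha] at e2
    set s := 2 * B (tailL n I) (tailL n x)
    have hs : s = 0 := by
      refine (mul_eq_zero.1 ?_).resolve_left hkol
      linear_combination A * e2 - 2 * a * M * e1
    have hx0 : x 0 = 0 := by
      refine (mul_eq_zero.1 ?_).resolve_left hkol
      linear_combination (2 * a * C + β) * e1 - M * e2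
    refine hzero x hx0 ?_
    -- Once `x 0` and `s` vanish, only `β B(x', x')` survives, and `B` is definite.
    by_contra hne
    have := hpos _ hne
    rw [hs, hx0] at e3
    have h5 : B (tailL n x) (tailL n x) * β = 0 := by linarith
    rcases mul_eq_zero.1 h5 with h | h
    · exact this.ne' h
    · exact hβ h
  · have e1 := hx (Fin.cons 1 0)
    have e2 := hx (Fin.cons 0 (tailL n I))
    have e3 := hx (Fin.cons 0 (tailL n x))
    simp only [h1, h2, tailL_cons, Fin.cons_zero, map_zero] at e1 e2 e3 hx'
    rw [mul_eq_zero, or_iff_right hb] at hx'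
    rw [mul_left_comm t, ← mul_add, mul_eq_zero, or_iff_right hb] at e1 e2 e3
    rw [hB (tailL n x) (tailL n I), ← ha] at e2
    set s := 2 * B (tailL n I) (tailL n x)
    -- Cramer's rule for the three unknowns `x 0`, `s`, `t`; up to sign the determinant is the one
    -- in `hiso`.
    have hs : s = 0 := by
      refine (mul_eq_zero.1 ?_).resolve_left hiso
      linear_combination (2 * a * (A * β - α * M)) * hx' - 2 * a * α * β * e1 + α ^ 2 * e2
    have hx0 : x 0 = 0 := by
      refine (mul_eq_zero.1 ?_).resolve_left hiso
      linear_combination (α * (2 * a * C + β) - 2 * a * M * β) * hx' + 2 * a * β ^ 2 * e1 -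
        α * β * e2
    have ht : t = 0 := by
      refine (mul_eq_zero.1 ?_).resolve_left hiso
      linear_combination -(A * (2 * a * C + β) - 2 * a * M ^ 2) * hx' +
        (α * (2 * a * C + β) - 2 * a * M * β) * e1 - (α * M - β * A) * e2
    refine ⟨hzero x hx0 ?_, ht⟩
    by_contra hne
    have := hpos _ hne
    rw [hs, hx0, ht] at e3
    have h5 : B (tailL n x) (tailL n x) * β = 0 := by linarith
    rcases mul_eq_zero.1 h5 with h | h
    · exact this.ne' h
    · exact hβ h

end

/-! ### The angle-action chart on the full phase space. -/

theorem coe_unitAddCircle_eq_iff {x y : ℝ} :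
    (x : UnitAddCircle) = (y : UnitAddCircle) ↔ ∃ k : ℤ, y = x + k := by
  rw [eq_comm, ← sub_eq_zero, ← AddCircle.coe_sub, AddCircle.coe_eq_zero_iff]
  refine exists_congr fun k => ?_
  rw [zsmul_eq_mul, mul_one]
  constructor <;> intro h <;> linarith

section

variable {n : ℕ} {B : (Fin n → ℝ) →L[ℝ] (Fin n → ℝ) →L[ℝ] ℝ} {b : ℝ} {μ : ℝ → ℝ}

/-- The vector dual to a covector. -/
noncomputable def sharp (B : (Fin n → ℝ) →L[ℝ] (Fin n → ℝ) →L[ℝ] ℝ) :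
    (Fin n → ℝ) →L[ℝ] (Fin n → ℝ) :=
  ContinuousLinearMap.pi fun i => B.flip (Pi.single i 1)

theorem sharp_dotProduct (p q : Fin n → ℝ) : sharp B p ⬝ᵥ q = B p q := by
  rw [apply_eq_sum_single (B p) q, dotProduct]
  exact Finset.sum_congr rfl fun i _ => mul_comm _ _

/-- The coordinates `(φ, ε, c)` of a point given by angles and actions. -/
noncomputable def cyclePoint (B : (Fin n → ℝ) →L[ℝ] (Fin n → ℝ) →L[ℝ] ℝ) (b : ℝ) (μ : ℝ → ℝ)
    (z : (Fin (n + 1) → ℝ) × (Fin (n + 1) → ℝ)) : ℝ × ℝ × ℝ :=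
  angleInv b μ (z.1 0, actionPair B z.2)

/-- The angle-action chart. -/
noncomputable def chart (B : (Fin n → ℝ) →L[ℝ] (Fin n → ℝ) →L[ℝ] ℝ) (b : ℝ) (μ : ℝ → ℝ)
    (z : (Fin (n + 1) → ℝ) × (Fin (n + 1) → ℝ)) : PhaseCover n :=
  ((Real.exp (logS (cyclePoint B b μ z)),
    tailL n z.1 + (2 * angleShift b μ (cyclePoint B b μ z)) • sharp B (tailL n z.2)),
  (logMom b μ (cyclePoint B b μ z) * Real.exp (-logS (cyclePoint B b μ z)), tailL n z.2))

/-- The domain of the actions. -/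
def actionDomain (B : (Fin n → ℝ) →L[ℝ] (Fin n → ℝ) →L[ℝ] ℝ) (b : ℝ) (μ : ℝ → ℝ) :
    Set (Fin (n + 1) → ℝ) := actionPair B ⁻¹' cycleValues b μ

theorem isOpen_actionDomain (hb : 0 < b) (hμ : ContDiff ℝ 1 μ) (hpos : ∀ u, 0 < μ u) :
    IsOpen (actionDomain B b μ) :=
  (isOpen_cycleValues hb hμ hpos).preimage (contDiff_actionPair (r := 0)).continuous

theorem angleMap_cyclePoint (hb : 0 < b) (hμ : ContDiff ℝ 1 μ) (hpos : ∀ u, 0 < μ u)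
    {z : (Fin (n + 1) → ℝ) × (Fin (n + 1) → ℝ)} (hz : z ∈ univ ×ˢ actionDomain B b μ) :
    (cyclePoint B b μ z).2.2 ∈ Ioo (0 : ℝ) 1 ∧
      angleMap b μ (cyclePoint B b μ z) = (z.1 0, actionPair B z.2) :=
  angleMap_angleInv hb hμ hpos (w := (z.1 0, actionPair B z.2)) hz.2

theorem contDiffOn_cyclePoint {r : ℕ∞} (hr : 1 ≤ r) (hb : 0 < b) (hμ : ContDiff ℝ r μ)
    (hpos : ∀ u, 0 < μ u) : ContDiffOn ℝ r (cyclePoint B b μ) (univ ×ˢ actionDomain B b μ) := by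
  have h1 : ContDiff ℝ r fun z : (Fin (n + 1) → ℝ) × (Fin (n + 1) → ℝ) =>
      (z.1 0, actionPair B z.2) :=
    ((contDiff_apply ℝ ℝ 0).comp contDiff_fst).prodMk (contDiff_actionPair.comp contDiff_snd)
  exact (contDiffOn_angleInv hr hb hμ hpos).comp h1.contDiffOn fun z hz => ⟨mem_univ _, hz.2⟩

theorem contDiffOn_chart {r : ℕ∞} (hr : 1 ≤ r) (hb : 0 < b) (hμ : ContDiff ℝ r μ)
    (hpos : ∀ u, 0 < μ u) : ContDiffOn ℝ r (chart B b μ) (univ ×ˢ actionDomain B b μ) := by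
  have hμ1 : ContDiff ℝ 1 μ := hμ.of_le (by exact_mod_cast hr)
  have hζ := contDiffOn_cyclePoint (B := B) hr hb hμ hpos
  have hmaps : MapsTo (cyclePoint B b μ) (univ ×ˢ actionDomain B b μ)
      (univ ×ˢ (univ ×ˢ Ioo (-1 : ℝ) 1)) := fun z hz =>
    ⟨mem_univ _, mem_univ _, Ioo_zero_one_subset (angleMap_cyclePoint hb hμ1 hpos hz).1⟩
  have hS := contDiffOn_logS.comp hζ hmaps
  have hM := (contDiffOn_logMom (b := b) hμ).comp hζ hmaps
  have hσ := (contDiffOn_angleShift hb hμ hpos).comp hζ hmaps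
  have ht : ContDiffOn ℝ r (fun z : (Fin (n + 1) → ℝ) × (Fin (n + 1) → ℝ) => tailL n z.1)
      (univ ×ˢ actionDomain B b μ) := ((tailL n).contDiff.comp contDiff_fst).contDiffOn
  have ht' : ContDiffOn ℝ r (fun z : (Fin (n + 1) → ℝ) × (Fin (n + 1) → ℝ) => tailL n z.2)
      (univ ×ˢ actionDomain B b μ) := ((tailL n).contDiff.comp contDiff_snd).contDiffOn
  exact (hS.exp.prodMk (ht.add ((contDiffOn_const.mul hσ).smul
    ((sharp B).contDiff.comp_contDiffOn ht')))).prodMk ((hM.mul hS.neg.exp).prodMk ht')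

/-- The displacement `2σ p♯` of `q` contributes `dσ∧da` to `dq∧dp`, since the remaining term `2σ
dp♯∧dp` vanishes by symmetry of `B`; moreover `ds∧dp_s = du∧dP`. Thus `exists_differentials`
applies. -/
theorem symplectic_chart (hb : 0 < b) (hμ : ContDiff ℝ 1 μ) (hpos : ∀ u, 0 < μ u)
    (hB : ∀ p q, B p q = B q p) {z : (Fin (n + 1) → ℝ) × (Fin (n + 1) → ℝ)}
    (hz : z ∈ univ ×ˢ actionDomain B b μ) (v w : (Fin (n + 1) → ℝ) × (Fin (n + 1) → ℝ)) :
    phaseForm (fderiv ℝ (chart B b μ) z v) (fderiv ℝ (chart B b μ) z w) =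
      angleActionForm v w := by
  obtain ⟨hc, heq⟩ := angleMap_cyclePoint hb hμ hpos hz
  have hopen : univ ×ˢ actionDomain B b μ ∈ 𝓝 z :=
    (isOpen_univ.prod (isOpen_actionDomain hb hμ hpos)).mem_nhds hz
  have hζ := (((contDiffOn_cyclePoint (r := 1) (B := B) le_rfl hb hμ hpos).contDiffAt
    hopen).differentiableAt one_ne_zero).hasFDerivAt
  -- `cyclePoint` is known only as an inverse, so its differential is controlled by differentiating
  -- this identity.
  have hev : ∀ᶠ y in 𝓝 z, angleMap b μ (cyclePoint B b μ y) = (y.1 0, actionPair B y.2) := by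
    filter_upwards [hopen] with y hy
    exact (angleMap_cyclePoint hb hμ hpos hy).2
  set ζ' := fderiv ℝ (cyclePoint B b μ) z with hζ'
  obtain ⟨φ, ε, c, hp⟩ : ∃ φ ε c, cyclePoint B b μ z = (φ, ε, c) := ⟨_, _, _, rfl⟩
  rw [hp] at hc
  obtain ⟨lu, lP, lσ, lΘ, lJ, la, hu, hP, hσ, hΘ, hJ, ha, -, -, -, hform⟩ :=
    exists_differentials hb hμ hpos (φ := φ) (ε := ε) (Ioo_zero_one_subset hc)
  rw [← hp] at hu hP hσ hΘ
  have hp2 : (ε, c) = (cyclePoint B b μ z).2 := by rw [hp]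
  rw [hp2] at hJ ha
  obtain ⟨A, hA, hAv⟩ := hasFDerivAt_actionPair hB z.2
  have hA' := HasFDerivAt.comp (g := actionPair B)
    (f := fun z : (Fin (n + 1) → ℝ) × (Fin (n + 1) → ℝ) => z.2) z hA hasFDerivAt_snd
  have hζ2 := HasFDerivAt.comp (g := fun y : ℝ × ℝ × ℝ => y.2) (f := cyclePoint B b μ) z
    hasFDerivAt_snd hζ
  have eΘ : ∀ v, lΘ (ζ' v) = v.1 0 := fun v => by
    have h1 := HasFDerivAt.comp (g := angle b μ) (f := cyclePoint B b μ) z hΘ hζ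
    have h2 : HasFDerivAt (fun y : (Fin (n + 1) → ℝ) × (Fin (n + 1) → ℝ) => y.1 0) _ z :=
      (hasFDerivAt_apply (𝕜 := ℝ) (F' := fun _ => ℝ) 0 z.1).comp z hasFDerivAt_fst
    have h3 := h2.congr_of_eventuallyEq (f₁ := angle b μ ∘ cyclePoint B b μ) (by
      filter_upwards [hev] with y hy
      exact congrArg Prod.fst hy)
    have h4 := congrArg (fun l : (Fin (n + 1) → ℝ) × (Fin (n + 1) → ℝ) →L[ℝ] ℝ => l v)
      (h1.unique h3)
    simpa using h4
  have eJ : ∀ v, lJ (ζ' v).2 = v.2 0 := fun v => by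
    have h1 := HasFDerivAt.comp (g := action b μ) (f := fun z => (cyclePoint B b μ z).2) z hJ hζ2
    have h3 := (hA'.fst).congr_of_eventuallyEq
      (f₁ := action b μ ∘ fun z => (cyclePoint B b μ z).2) (by
      filter_upwards [hev] with y hy
      exact congrArg (fun q => q.2.1) hy)
    have h4 := congrArg (fun l : (Fin (n + 1) → ℝ) × (Fin (n + 1) → ℝ) →L[ℝ] ℝ => l v)
      (h1.unique h3)
    simpa [hAv] using h4
  have ea : ∀ v, la (ζ' v).2 = 2 * B (tailL n z.2) (tailL n v.2) := fun v => by
    have h1 := HasFDerivAt.comp (g := momSq b) (f := fun z => (cyclePoint B b μ z).2) z ha hζ2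
    have h3 := (hA'.snd).congr_of_eventuallyEq
      (f₁ := momSq b ∘ fun z => (cyclePoint B b μ z).2) (by
      filter_upwards [hev] with y hy
      exact congrArg (fun q => q.2.2) hy)
    have h4 := congrArg (fun l : (Fin (n + 1) → ℝ) × (Fin (n + 1) → ℝ) →L[ℝ] ℝ => l v)
      (h1.unique h3)
    simpa [hAv] using h4
  have cu := HasFDerivAt.comp (g := logS) (f := cyclePoint B b μ) z hu hζ
  have cP := HasFDerivAt.comp (g := logMom b μ) (f := cyclePoint B b μ) z hP hζ
  have cσ := HasFDerivAt.comp (g := angleShift b μ) (f := cyclePoint B b μ) z hσ hζ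
  have ct : HasFDerivAt (fun z : (Fin (n + 1) → ℝ) × (Fin (n + 1) → ℝ) => tailL n z.1) _ z :=
    (tailL n).hasFDerivAt.comp z hasFDerivAt_fst
  have ct' : HasFDerivAt (fun z : (Fin (n + 1) → ℝ) × (Fin (n + 1) → ℝ) => tailL n z.2) _ z :=
    (tailL n).hasFDerivAt.comp z hasFDerivAt_snd
  have cG : HasFDerivAt (fun z : (Fin (n + 1) → ℝ) × (Fin (n + 1) → ℝ) =>
      sharp B (tailL n z.2)) _ z := (sharp B).hasFDerivAt.comp z ct'
  have hchart : HasFDerivAt (chart B b μ) _ z :=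
    (cu.exp.prodMk (ct.add ((cσ.const_mul 2).smul cG))).prodMk ((cP.mul cu.neg.exp).prodMk ct')
  have hf := hform (ζ' v) (ζ' w)
  rw [eΘ, eΘ, eJ, eJ, ea, ea] at hf
  rw [hchart.fderiv]
  have he : Real.exp (logS (cyclePoint B b μ z)) * Real.exp (-logS (cyclePoint B b μ z)) = 1 := by
    rw [← Real.exp_add, add_neg_cancel, Real.exp_zero]
  have hs := hB (tailL n v.2) (tailL n w.2)
  have hdot : ∀ x y : Fin (n + 1) → ℝ, x ⬝ᵥ y = x 0 * y 0 + tailL n x ⬝ᵥ tailL n y :=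
    fun x y => by simp [dotProduct, Fin.sum_univ_succ]
  simp [phaseForm, angleActionForm, add_dotProduct, smul_dotProduct, sharp_dotProduct, hdot]
  linear_combination hf + (lu (ζ' v) * lP (ζ' w) - lu (ζ' w) * lP (ζ' v)) * he +
    2 * angleShift b μ (cyclePoint B b μ z) * hs

/-- A point determines its cycle, and `φ` up to full turns. A full turn moves the first angle by `1`
and leaves the displacement of `q` unchanged, so the ambiguity is exactly the integer lattice. -/
theorem proj_chart_eq_iff (hb : 0 < b) (hμ : ContDiff ℝ 1 μ) (hpos : ∀ u, 0 < μ u)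
    {z w : (Fin (n + 1) → ℝ) × (Fin (n + 1) → ℝ)}
    (hz : z ∈ univ ×ˢ actionDomain B b μ) (hw : w ∈ univ ×ˢ actionDomain B b μ) :
    coverProj (chart B b μ z) = coverProj (chart B b μ w) ↔
      toTorus z.1 = toTorus w.1 ∧ z.2 = w.2 := by
  obtain ⟨hcz, hqz⟩ := angleMap_cyclePoint hb hμ hpos hz
  obtain ⟨hcw, hqw⟩ := angleMap_cyclePoint hb hμ hpos hw
  constructor
  · intro h
    simp only [coverProj, chart, Prod.mk.injEq] at h
    obtain ⟨⟨hs, hq⟩, hps, hp⟩ := h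
    have hu := Real.exp_injective hs
    rw [hu] at hps
    have hP := mul_right_cancel₀ (Real.exp_pos _).ne' hps
    have ha : momSq b (cyclePoint B b μ z).2 = momSq b (cyclePoint B b μ w).2 := by
      have h1 := congrArg (fun q : ℝ × ℝ × ℝ => q.2.2) hqz
      have h2 := congrArg (fun q : ℝ × ℝ × ℝ => q.2.2) hqw
      simp only [angleMap, cycleMap, actionPair] at h1 h2
      rw [h1, h2, hp]
    obtain ⟨hx, k, hk⟩ := eq_of_logS_eq hb hpos (φ := (cyclePoint B b μ z).1)
      (φ' := (cyclePoint B b μ w).1) (x := (cyclePoint B b μ z).2) (x' := (cyclePoint B b μ w).2)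
      hcz hcw hu hP ha
    have hpt : cyclePoint B b μ w =
        ((cyclePoint B b μ z).1 + k * (2 * Real.pi), (cyclePoint B b μ z).2) :=
      Prod.ext hk hx.symm
    have hc' := Ioo_zero_one_subset hcz
    have hσ : angleShift b μ (cyclePoint B b μ w) = angleShift b μ (cyclePoint B b μ z) := by
      rw [hpt, angleShift_add_two_pi hb hμ.continuous hpos k _ hc']
    have h0 : w.1 0 = z.1 0 + k := by
      have h1 := congrArg Prod.fst hqz
      have h2 := congrArg Prod.fst hqw
      simp only [angleMap] at h1 h2
      rw [← h1, ← h2, hpt, angle_add_two_pi hb hμ.continuous hpos k _ hc']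
    refine ⟨?_, ?_⟩
    · funext i
      refine Fin.cases ?_ (fun i => ?_) i
      · exact coe_unitAddCircle_eq_iff.2 ⟨k, h0⟩
      · have h3 := congrFun hq i
        simp only [toTorus, hσ, hp, Pi.add_apply, tailL_apply, AddCircle.coe_add] at h3
        exact add_right_cancel h3
    · have h1 := congrArg (fun q : ℝ × ℝ × ℝ => q.2.1) hqz
      have h2 := congrArg (fun q : ℝ × ℝ × ℝ => q.2.1) hqw
      simp only [angleMap, cycleMap, actionPair] at h1 h2
      rw [← cons_tailL z.2, ← cons_tailL w.2, hp, ← h1, ← h2, hx]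
  · rintro ⟨hθ, hI⟩
    obtain ⟨k, hk⟩ := coe_unitAddCircle_eq_iff.1 (congrFun hθ 0)
    have hc' := Ioo_zero_one_subset hcz
    have hpt : cyclePoint B b μ w =
        ((cyclePoint B b μ z).1 + k * (2 * Real.pi), (cyclePoint B b μ z).2) := by
      rw [cyclePoint, ← leftInvOn_angleInv hb hμ hpos (x := ((cyclePoint B b μ z).1 +
        k * (2 * Real.pi), (cyclePoint B b μ z).2)) ⟨mem_univ _, mem_univ _, hcz⟩]
      congr 1
      have h1 := Prod.ext_iff.1 hqz
      refine Prod.ext ?_ ?_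
      · simp only [angleMap, angle_add_two_pi hb hμ.continuous hpos k _ hc']
        rw [hk]
        congr 1
        exact h1.1.symm
      · simp only [angleMap]
        rw [← hI]
        exact h1.2.symm
    have e1 : logS (cyclePoint B b μ w) = logS (cyclePoint B b μ z) := by
      rw [hpt, logS_add_two_pi]
    have e2 : logMom b μ (cyclePoint B b μ w) = logMom b μ (cyclePoint B b μ z) := by
      rw [hpt, logMom_add_two_pi]
    have e3 : angleShift b μ (cyclePoint B b μ w) = angleShift b μ (cyclePoint B b μ z) := by
      rw [hpt, angleShift_add_two_pi hb hμ.continuous hpos k _ hc']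
    simp only [coverProj, chart, Prod.mk.injEq, e1, e2, e3, hI, true_and, and_true]
    funext i
    simp only [toTorus, Pi.add_apply, tailL_apply, AddCircle.coe_add]
    congr 1
    exact congrFun hθ i.succ

theorem isAngleActionChart {r : ℕ∞} (hr : 1 ≤ r) (hb : 0 < b) (hμ : ContDiff ℝ r μ)
    (hpos : ∀ u, 0 < μ u) (hB : ∀ p q, B p q = B q p) {F : PhaseSpace n → ℝ}
    (hF : ∀ u q P p, F ((Real.exp u, q), (P * Real.exp (-u), p)) =
      1 / 2 * Real.exp (-(2 * u)) * (B p p + (P / μ u) ^ 2) + b * u) :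
    IsAngleActionChart r F (actionDomain B b μ) (chart B b μ)
      (actionHam B b (energyLevel b μ)) where
  isOpen := isOpen_actionDomain hb (hμ.of_le (by exact_mod_cast hr)) hpos
  contDiffOn := contDiffOn_chart hr hb hμ hpos
  contDiffOn_action := by
    have hμ1 : ContDiff ℝ 1 μ := hμ.of_le (by exact_mod_cast hr)
    intro I hI
    exact (contDiffAt_actionHam ((contDiffOn_energyLevel hr hb hμ hpos).contDiffAt
      ((isOpen_cycleValues hb hμ1 hpos).mem_nhds hI))).contDiffWithinAt
  mem_physical z _ := Real.exp_pos _
  proj_eq_iff _ hz _ hw := proj_chart_eq_iff hb (hμ.of_le (by exact_mod_cast hr)) hpos hz hw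
  symplectic _ hz v w := symplectic_chart hb (hμ.of_le (by exact_mod_cast hr)) hpos hB hz v w
  energy z hz := by
    have hμ1 : ContDiff ℝ 1 μ := hμ.of_le (by exact_mod_cast hr)
    obtain ⟨hc, hq⟩ := angleMap_cyclePoint hb hμ1 hpos hz
    have h2 := congrArg Prod.snd hq
    have h3 := congrArg (fun q : ℝ × ℝ × ℝ => q.2.2) hq
    simp only [angleMap, cycleMap, actionPair] at h3
    have h4 : coverProj (chart B b μ z) = ((Real.exp (logS (cyclePoint B b μ z)),
        toTorus (chart B b μ z).1.2), (logMom b μ (cyclePoint B b μ z) *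
          Real.exp (-logS (cyclePoint B b μ z)), tailL n z.2)) := rfl
    rw [h4, hF, ← h3, energy_eq hb hpos (Ioo_zero_one_subset hc), actionHam]
    simp only [angleMap] at h2
    rw [← h2, energyLevel_cycleMap hb hμ1 hpos hc]

end

/-! ### The open set of non-degenerate points and its closure. -/

theorem contDiffOn_deriv_right {f : ℝ → ℝ → ℝ} {m n : WithTop ℕ∞} (hmn : m + 1 ≤ n)
    (hf : ContDiffOn ℝ n (Function.uncurry f) (univ ×ˢ Ioo (-1) 1)) :
    ContDiffOn ℝ m (Function.uncurry fun ε => deriv (f ε)) (univ ×ˢ Ioo (-1) 1) := by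
  have hU : IsOpen ((univ : Set ℝ) ×ˢ Ioo (-1 : ℝ) 1) := isOpen_univ.prod isOpen_Ioo
  have h := (hf.fderiv_of_isOpen hU hmn).clm_apply
    (contDiffOn_const (c := ((0 : ℝ), (1 : ℝ))))
  refine h.congr fun x hx => ?_
  have hn : n ≠ 0 := by
    rintro rfl
    simp at hmn
  have hd := ((hf.contDiffAt (hU.mem_nhds hx)).differentiableAt hn).hasFDerivAt
  have h2 : HasDerivAt (fun y : ℝ => (x.1, y)) (0, 1) x.2 :=
    (hasDerivAt_const x.2 x.1).prodMk (hasDerivAt_id x.2)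
  exact (hd.comp_hasDerivAt x.2 h2).deriv

theorem continuousOn_avg_deriv_two_weight {μ : ℝ → ℝ} (hμ : ContDiff ℝ 2 μ) (l : ℝ) :
    ContinuousOn (fun x : ℝ × ℝ => avg 1 (deriv^[2] (weight μ l x.1)) x.2)
      (univ ×ˢ Ioo (-1) 1) := by
  have h1 : ContDiffOn ℝ 0 (Function.uncurry fun ε => deriv (deriv (weight μ l ε)))
      (univ ×ˢ Ioo (-1) 1) :=
    contDiffOn_deriv_right (m := 0) (n := 1) (by norm_num)
      (contDiffOn_deriv_right (m := 1) (n := 2) (by norm_num) (contDiffOn_weight (n := 2) hμ l))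
  have h2 : ContDiff ℝ 0 fun z : (ℝ × ℝ) × ℝ => (z.1.1, z.1.2 * Real.cos z.2) := by fun_prop
  have h3 : ContDiff ℝ 0 (fun z : (ℝ × ℝ) × ℝ => Real.sin z.2 ^ (2 * 1)) := by fun_prop
  exact (contDiffOn_intervalIntegral (isOpen_univ.prod isOpen_Ioo) 0 _ _
    (f := fun (x : ℝ × ℝ) t => Real.sin t ^ (2 * 1) *
      deriv (deriv (weight μ l x.1)) (x.2 * Real.cos t))
    (h3.contDiffOn.mul (h1.comp h2.contDiffOn
      fun z hz => ⟨mem_univ _, mul_cos_mem_Ioo hz.1.2 z.2⟩))).continuousOn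

theorem continuousOn_avg_weight {μ : ℝ → ℝ} (hμ : Continuous μ) (l : ℝ) :
    ContinuousOn (fun x : ℝ × ℝ => avg 0 (weight μ l x.1) x.2) (univ ×ˢ Ioo (-1) 1) :=
  (contDiffOn_avg_weight (n := 0) (contDiff_zero.2 hμ) 0 l).continuousOn

/-- The cycles at which both determinants are nonzero. -/
def nondegenerateCycles (μ : ℝ → ℝ) : Set (ℝ × ℝ) :=
  {x | x.2 ∈ Ioo (0 : ℝ) 1 ∧ isoDiscr μ x.1 x.2 ≠ 0 ∧ kolDiscr μ x.1 x.2 ≠ 0}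

theorem isOpen_nondegenerateCycles {μ : ℝ → ℝ} (hμ : ContDiff ℝ 2 μ) :
    IsOpen (nondegenerateCycles μ) := by
  have hμ1 : ContDiff ℝ 1 μ := hμ.of_le (by norm_num)
  have hU : IsOpen ((univ : Set ℝ) ×ˢ Ioo (0 : ℝ) 1) := isOpen_univ.prod isOpen_Ioo
  have hsub : (univ : Set ℝ) ×ˢ Ioo (0 : ℝ) 1 ⊆ univ ×ˢ Ioo (-1 : ℝ) 1 :=
    prod_mono_right fun _ => Ioo_zero_one_subset
  have hc : ContinuousOn (fun x : ℝ × ℝ => 1 - x.2 ^ 2) (univ ×ˢ Ioo (0 : ℝ) 1) := by fun_prop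
  have h0 := (continuousOn_avg_weight hμ.continuous 0).mono hsub
  have h1 := (continuousOn_avg_weight hμ.continuous 1).mono hsub
  have h2 := (continuousOn_avg_weight (hμ1.continuous_deriv le_rfl) 1).mono hsub
  have h3 := (continuousOn_avg_deriv_two_weight hμ 0).mono hsub
  have h4 := (continuousOn_avg_deriv_two_weight hμ 1).mono hsub
  have hiso : ContinuousOn (fun x : ℝ × ℝ => isoDiscr μ x.1 x.2) (univ ×ˢ Ioo (0 : ℝ) 1) :=
    (hc.mul h3).sub h0
  have hkol : ContinuousOn (fun x : ℝ × ℝ => kolDiscr μ x.1 x.2) (univ ×ˢ Ioo (0 : ℝ) 1) :=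
    (((h1.add h2).add (hc.mul h4)).mul hiso).sub (hc.mul (h4.mul h4))
  have h := (hiso.prodMk hkol).isOpen_inter_preimage hU
    ((isOpen_compl_singleton (x := (0 : ℝ))).prod (isOpen_compl_singleton (x := (0 : ℝ))))
  convert h using 1
  ext x
  simp [nondegenerateCycles]

section

variable {n : ℕ}

/-- The bilinear form of a matrix. -/
noncomputable def matrixForm (G : Matrix (Fin n) (Fin n) ℝ) :
    (Fin n → ℝ) →L[ℝ] (Fin n → ℝ) →L[ℝ] ℝ :=
  ∑ i, ∑ j, G i j • ContinuousLinearMap.smulRight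
    (ContinuousLinearMap.proj (R := ℝ) (φ := fun _ : Fin n => ℝ) i)
    (ContinuousLinearMap.proj (R := ℝ) (φ := fun _ : Fin n => ℝ) j)

theorem matrixForm_apply (G : Matrix (Fin n) (Fin n) ℝ) (p q : Fin n → ℝ) :
    matrixForm G p q = p ⬝ᵥ G *ᵥ q := by
  simp only [matrixForm, sum_apply, smul_apply, ContinuousLinearMap.smulRight_apply,
    ContinuousLinearMap.proj_apply, smul_eq_mul, dotProduct, Matrix.mulVec, Finset.mul_sum]
  exact Finset.sum_congr rfl fun i _ => Finset.sum_congr rfl fun j _ => by ring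

theorem matrixForm_symm {G : Matrix (Fin n) (Fin n) ℝ} (hG : G.PosDef) (p q : Fin n → ℝ) :
    matrixForm G p q = matrixForm G q p := by
  have h : Gᵀ = G := by simpa using hG.isHermitian.eq
  rw [matrixForm_apply, matrixForm_apply, Matrix.dotProduct_mulVec, ← Matrix.mulVec_transpose, h,
    dotProduct_comm]

theorem matrixForm_pos {G : Matrix (Fin n) (Fin n) ℝ} (hG : G.PosDef) (p : Fin n → ℝ)
    (hp : p ≠ 0) : 0 < matrixForm G p p := by
  rw [matrixForm_apply]
  simpa using hG.dotProduct_mulVec_pos hp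

variable {B : (Fin n → ℝ) →L[ℝ] (Fin n → ℝ) →L[ℝ] ℝ} {b : ℝ} {μ : ℝ → ℝ} {F : PhaseSpace n → ℝ}

/-- The parameters of the cycle through a point. -/
noncomputable def cycleOf (B : (Fin n → ℝ) →L[ℝ] (Fin n → ℝ) →L[ℝ] ℝ) (b : ℝ)
    (F : PhaseSpace n → ℝ) (z : PhaseSpace n) : ℝ × ℝ :=
  ((F z - b / 2) / b, √(1 - B z.2.2 z.2.2 / rad b ((F z - b / 2) / b) ^ 2))

theorem cycleOf_eq (hb : 0 < b) {z : PhaseSpace n} {x : ℝ × ℝ} (hx : 0 < x.2)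
    (hE : F z = b * x.1 + b / 2) (ha : B z.2.2 z.2.2 = momSq b x) : cycleOf B b F z = x := by
  have h1 : (F z - b / 2) / b = x.1 := by
    rw [hE]
    field_simp
    ring
  rw [cycleOf, h1, ha, momSq, mul_div_cancel_left₀ _ (pow_pos (rad_pos hb x.1) 2).ne',
    sub_sub_cancel, Real.sqrt_sq hx.le]

theorem momSq_cycleOf (hb : 0 < b) {z : PhaseSpace n} (hx : 0 < (cycleOf B b F z).2) :
    F z = b * (cycleOf B b F z).1 + b / 2 ∧ B z.2.2 z.2.2 = momSq b (cycleOf B b F z) := by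
  -- The real square root is `0` on nonpositive numbers, so `c > 0` already forces a positive
  -- radicand.
  have h1 : 0 < 1 - B z.2.2 z.2.2 / rad b ((F z - b / 2) / b) ^ 2 := Real.sqrt_pos.1 hx
  have hR := (pow_pos (rad_pos hb ((F z - b / 2) / b)) 2).ne'
  refine ⟨?_, ?_⟩
  · simp only [cycleOf]
    field_simp
    ring
  · simp only [cycleOf, momSq]
    rw [Real.sq_sqrt h1.le, sub_sub_cancel, mul_div_cancel₀ _ hR]

theorem continuousOn_cycleOf (hb : 0 < b) (hF : ContinuousOn F (physical n)) :
    ContinuousOn (cycleOf B b F) (physical n) := by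
  have h1 : ContinuousOn (fun z => (F z - b / 2) / b) (physical n) :=
    (hF.sub continuousOn_const).div_const b
  have hR : Continuous (rad b) := (contDiff_rad (n := 0) b).continuous
  have hp : Continuous fun z : PhaseSpace n => B z.2.2 z.2.2 := by fun_prop
  exact h1.prodMk ((continuousOn_const.sub (hp.continuousOn.div ((hR.comp_continuousOn h1).pow 2)
    fun z _ => (pow_pos (rad_pos hb _) 2).ne')).sqrt)

/-- The set of points on non-degenerate cycles. -/
def nondegenerateSet (B : (Fin n → ℝ) →L[ℝ] (Fin n → ℝ) →L[ℝ] ℝ) (b : ℝ) (μ : ℝ → ℝ)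
    (F : PhaseSpace n → ℝ) : Set (PhaseSpace n) :=
  physical n ∩ cycleOf B b F ⁻¹' nondegenerateCycles μ

theorem isOpen_physical : IsOpen (physical n) :=
  isOpen_lt continuous_const (continuous_fst.comp continuous_fst)

theorem isOpen_nondegenerateSet (hb : 0 < b) (hμ : ContDiff ℝ 2 μ)
    (hF : ContinuousOn F (physical n)) : IsOpen (nondegenerateSet B b μ F) :=
  (continuousOn_cycleOf hb hF).isOpen_inter_preimage isOpen_physical
    (isOpen_nondegenerateCycles hμ)

/-- One global chart serves all points: `exists_logS_eq` places the point on its cycle, and the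
angles are found by undoing the displacement of `q`. -/
theorem nondegenerate_of_mem {r : ℕ∞} (hr : 2 ≤ r) (hb : 0 < b) (hμ : ContDiff ℝ r μ)
    (hpos : ∀ u, 0 < μ u) (hB : ∀ p q, B p q = B q p) (hBpos : ∀ p, p ≠ 0 → 0 < B p p)
    (hF : ∀ u q P p, F ((Real.exp u, q), (P * Real.exp (-u), p)) =
      1 / 2 * Real.exp (-(2 * u)) * (B p p + (P / μ u) ^ 2) + b * u)
    {z : PhaseSpace n} (hz : z ∈ nondegenerateSet B b μ F) :
    KolmogorovNondegenerateAt r F z ∧ IsoEnergeticallyNondegenerateAt r F z := by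
  have hr1 : 1 ≤ r := le_trans (by norm_num) hr
  have hμ1 : ContDiff ℝ 1 μ := hμ.of_le (by exact_mod_cast hr1)
  have hμ2 : ContDiff ℝ 2 μ := hμ.of_le (WithTop.coe_le_coe.2 hr)
  obtain ⟨hs, hx, hiso, hkol⟩ := hz
  obtain ⟨hE, ha⟩ := momSq_cycleOf hb hx.1
  set x := cycleOf B b F z with hxdef
  obtain ⟨⟨s, q⟩, ps, p⟩ := z
  have hs' : 0 < s := hs
  dsimp only at ha
  have hzz : (((s, q), (ps, p)) : PhaseSpace n) =
      ((Real.exp (Real.log s), q), ((s * ps) * Real.exp (-Real.log s), p)) := by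
    rw [Real.exp_neg, Real.exp_log hs', mul_comm s ps, mul_assoc, mul_inv_cancel₀ hs'.ne', mul_one]
  have hE' := hE
  rw [hzz, hF, ha] at hE'
  obtain ⟨φ, hφu, hφP⟩ := exists_logS_eq hb hpos (ε := x.1) (c := x.2) hx hE'
  have hchart := isAngleActionChart hr1 hb hμ hpos hB hF
  -- Any lift of `q` to the cover will do.
  choose lift hlift using fun i => QuotientAddGroup.mk_surjective (q i)
  set C : Fin (n + 1) → ℝ := Fin.cons (action b μ x) p with hC
  have hpair : actionPair B C = cycleMap b μ x := by
    rw [actionPair, hC, tailL_cons, ha, Fin.cons_zero, cycleMap]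
  set θ : Fin (n + 1) → ℝ := Fin.cons (angle b μ (φ, x))
    (lift - (2 * angleShift b μ (φ, x)) • sharp B p) with hθ
  have hCD : C ∈ actionDomain B b μ := by
    rw [actionDomain, mem_preimage, hpair]
    exact ⟨x, ⟨mem_univ _, hx⟩, rfl⟩
  have hpt : cyclePoint B b μ (θ, C) = (φ, x) := by
    rw [cyclePoint]
    dsimp only
    rw [hpair, hθ, Fin.cons_zero]
    exact leftInvOn_angleInv hb hμ1 hpos (x := (φ, x)) ⟨mem_univ _, mem_univ _, hx⟩
  have hproj : coverProj (chart B b μ (θ, C)) = ((s, q), (ps, p)) := by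
    rw [hzz, coverProj, chart, hpt]
    dsimp only
    rw [show logS (φ, x) = Real.log s from hφu, show logMom b μ (φ, x) = s * ps from hφP, hθ, hC,
      tailL_cons, tailL_cons, sub_add_cancel]
    simp only [Prod.mk.injEq, true_and, and_true]
    funext i
    exact hlift i
  have he : ContDiffAt ℝ 2 (energyLevel b μ) (actionPair B C) :=
    (contDiffOn_energyLevel (n := 2) (by norm_num) hb hμ2 hpos).contDiffAt
      ((isOpen_cycleValues hb hμ1 hpos).mem_nhds hCD)
  obtain ⟨n1, n2, n3, n4⟩ := energyLevel_nondegenerate hb hμ2 hpos hx hiso hkol rfl rfl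
  rw [← hpair] at n1 n2 n3 n4
  rw [← ha] at n3 n4
  obtain ⟨d1, d2⟩ := det_ne_zero_of_taylor (I := C) (a := B p p) hb.ne' hB hBpos he rfl rfl
    (by rw [hC, tailL_cons]) n1 n2 n3 n4
  exact ⟨⟨_, _, _, hchart, θ, C, hCD, hproj, d1⟩, ⟨_, _, _, hchart, θ, C, hCD, hproj, d2⟩⟩

/-- A point at rest in `s` with kinetic energy `b / 2` is a limit of points on non-degenerate
cycles. -/
theorem mem_closure_nondegenerateSet (hb : 0 < b) (hμ : ContDiff ℝ 5 μ) (hpos : ∀ u, 0 < μ u)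
    (hF : ∀ u q P p, F ((Real.exp u, q), (P * Real.exp (-u), p)) =
      1 / 2 * Real.exp (-(2 * u)) * (B p p + (P / μ u) ^ 2) + b * u)
    {s : ℝ} (hs : 0 < s) (q : UnitAddTorus (Fin n)) {p : Fin n → ℝ} (hp : B p p = b * s ^ 2) :
    (((s, q), (0, p)) : PhaseSpace n) ∈ closure (nondegenerateSet B b μ F) := by
  -- The point `φ = 0` of the cycle `(ε, c)`, with `p` rescaled to have square norm `momSq b (ε,
  -- c)`. At `(ln s, 0)` the factor is `1`, and `Y` carries non-degenerate cycles near `c = 0` to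
  -- points near the given equilibrium.
  set Y : ℝ × ℝ → PhaseSpace n := fun x => ((Real.exp (x.1 + lobe x.2 / 2), q),
    (0, (rad b x.1 * √(1 - x.2 ^ 2) / (√b * s)) • p)) with hY
  have hbs : 0 < √b * s := mul_pos (Real.sqrt_pos.2 hb) hs
  have hY0 : Y (Real.log s, 0) = ((s, q), (0, p)) := by
    simp only [hY, rad]
    rw [lobe_zero, Real.exp_log hs]
    simp [hbs.ne', Real.exp_log hs]
  have hcont : ContinuousAt Y (Real.log s, 0) := by
    have hl : ContinuousAt (fun x : ℝ × ℝ => lobe x.2) (Real.log s, 0) :=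
      ContinuousAt.comp (g := lobe) (f := Prod.snd) (x := (Real.log s, (0 : ℝ)))
        (hasDerivAt_lobe (y := 0) (by norm_num)).continuousAt continuousAt_snd
    have h1 : ContinuousAt (fun x : ℝ × ℝ => Real.exp (x.1 + lobe x.2 / 2)) (Real.log s, 0) :=
      Real.continuous_exp.continuousAt.comp (continuousAt_fst.add (hl.div_const 2))
    have hR : Continuous (rad b) := (contDiff_rad (n := 0) b).continuous
    have h2 : Continuous fun x : ℝ × ℝ => (rad b x.1 * √(1 - x.2 ^ 2) / (√b * s)) • p := by
      fun_prop
    exact (h1.prodMk continuousAt_const).prodMk (continuousAt_const.prodMk h2.continuousAt)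
  have hmaps : MapsTo Y (nondegenerateCycles μ) (nondegenerateSet B b μ F) := by
    rintro ⟨ε, c⟩ hx
    have hc : c ∈ Ioo (0 : ℝ) 1 := hx.1
    have hc' := Ioo_zero_one_subset hc
    have ha : B (Y (ε, c)).2.2 (Y (ε, c)).2.2 = momSq b (ε, c) := by
      have h1 : 0 ≤ 1 - c ^ 2 := by nlinarith [hc.1, hc.2]
      simp only [hY, map_smul, smul_apply, smul_eq_mul, hp, momSq]
      have h2 := Real.sq_sqrt h1
      have h3 := Real.sq_sqrt hb.le
      generalize √(1 - c ^ 2) = d at *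
      have hsb : √b ≠ 0 := (Real.sqrt_pos.2 hb).ne'
      rw [← h2]
      calc _ = rad b ε ^ 2 * d ^ 2 * (b / √b ^ 2) := by field_simp
        _ = _ := by rw [h3, div_self hb.ne', mul_one]
    have hE : F (Y (ε, c)) = b * ε + b / 2 := by
      have h1 := energy_eq hb hpos (z := (0, ε, c)) hc'
      have h2 : logMom b μ (0, ε, c) = 0 := by simp [logMom]
      have h3 : logS (0, ε, c) = ε + lobe c / 2 := by simp [logS]
      have h4 := hF (ε + lobe c / 2) q 0 (Y (ε, c)).2.2
      rw [zero_mul, ha] at h4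
      rw [h2, h3] at h1
      exact h4.trans h1
    refine ⟨Real.exp_pos _, ?_⟩
    rw [mem_preimage, cycleOf_eq hb (x := (ε, c)) hc.1 hE ha]
    exact hx
  rw [← hY0]
  exact hcont.continuousWithinAt.mem_closure
    (mem_closure_nondegenerate hμ hpos (Real.log s)) hmaps

end

end NoseThermostat

/-! ### Assembly for the given thermostat. -/

theorem theorem3 (n : ℕ) (hn : 1 ≤ n) (r : ℕ∞) (hr : ((2 * n + 2 : ℕ) : ℕ∞) < r)
    (V : UnitAddTorus (Fin n) → ℝ)
    (hV : ContDiff ℝ (r : WithTop ℕ∞) (fun x : Fin n → ℝ => V (toTorus x)))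
    (g : Matrix (Fin n) (Fin n) ℝ) (hg : g.PosDef)
    (k T : ℝ) (hk : 0 < k) (hT : 0 < T)
    (Ω : ℝ → ℝ) (hΩ : ContDiffOn ℝ (r : WithTop ℕ∞) Ω (Set.Ioi 0))
    (hΩpos : ∀ s : ℝ, 0 < s → 0 < Ω s)
    (F : ℝ → PhaseSpace n → ℝ)
    (hF : ∀ ε : ℝ, F ε = thermostated (mechanical g V ε) (variableMassThermostat n k T Ω)) :
    ∃ U : Set (PhaseSpace n), IsOpen U ∧ U ⊆ physical n ∧
      thermostaticEquilibria (F 0) ⊆ closure U ∧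
      ∀ P ∈ U, KolmogorovNondegenerateAt (r : WithTop ℕ∞) (F 0) P ∧
        IsoEnergeticallyNondegenerateAt (r : WithTop ℕ∞) (F 0) P := by
  have hn' : (0 : ℝ) < n := by exact_mod_cast hn
  have hb : 0 < n * k * T := by positivity
  -- From `n ≥ 1` one gets `r > 2n + 2 ≥ 4`, exactly the five derivatives needed for the jets.
  have hr5 : 5 ≤ r := by
    have h1 := Order.add_one_le_of_lt hr
    refine le_trans ?_ h1
    have : 5 ≤ 2 * n + 2 + 1 := by omega
    exact_mod_cast this
  set b : ℝ := n * k * T with hbdef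
  set B := matrixForm g⁻¹ with hBdef
  set μ : ℝ → ℝ := fun u => (√(Ω (Real.exp u)))⁻¹ with hμdef
  have hΩe : ∀ u, 0 < Ω (Real.exp u) := fun u => hΩpos _ (Real.exp_pos u)
  have hpos : ∀ u, 0 < μ u := fun u => inv_pos.2 (Real.sqrt_pos.2 (hΩe u))
  have hμ : ContDiff ℝ r μ :=
    ((hΩ.comp_contDiff Real.contDiff_exp fun u => Real.exp_pos u).sqrt
      fun u => (hΩe u).ne').inv fun u => (Real.sqrt_pos.2 (hΩe u)).ne'
  have hF0 : ∀ s q ps p, F 0 ((s, q), (ps, p)) =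
      1 / 2 * (s⁻¹ ^ 2 * B p p) + (1 / 2 * Ω s * ps ^ 2 + b * Real.log s) := by
    intro s q ps p
    rw [hF, thermostated, mechanical, variableMassThermostat, hBdef, matrixForm_apply]
    simp only [Matrix.mulVec_smul, smul_dotProduct, dotProduct_smul, smul_eq_mul]
    ring
  have hFu : ∀ u q P p, F 0 ((Real.exp u, q), (P * Real.exp (-u), p)) =
      1 / 2 * Real.exp (-(2 * u)) * (B p p + (P / μ u) ^ 2) + b * u := by
    intro u q P p
    have h1 : Real.exp (-(2 * u)) = Real.exp (-u) ^ 2 := by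
      rw [← Real.exp_nat_mul]
      congr 1
      push_cast
      ring
    have h2 : (P / μ u) ^ 2 = P ^ 2 * Ω (Real.exp u) := by
      rw [hμdef, div_inv_eq_mul, mul_pow, Real.sq_sqrt (hΩe u).le]
    rw [hF0, Real.log_exp, ← Real.exp_neg, h1, h2]
    ring
  have hFc : ContinuousOn (F 0) (physical n) := by
    have h1 : ContinuousOn (fun z : PhaseSpace n => 1 / 2 * (z.1.1⁻¹ ^ 2 * B z.2.2 z.2.2) +
        (1 / 2 * Ω z.1.1 * z.2.1 ^ 2 + b * Real.log z.1.1)) (physical n) := by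
      have hs : ContinuousOn (fun z : PhaseSpace n => z.1.1) (physical n) := by fun_prop
      have hi := hs.inv₀ fun z (hz : 0 < z.1.1) => hz.ne'
      have hl := hs.log fun z (hz : 0 < z.1.1) => hz.ne'
      have ho : ContinuousOn (fun z : PhaseSpace n => Ω z.1.1) (physical n) :=
        hΩ.continuousOn.comp hs fun z hz => hz
      have hp : ContinuousOn (fun z : PhaseSpace n => B z.2.2 z.2.2) (physical n) := by fun_prop
      have hps : ContinuousOn (fun z : PhaseSpace n => z.2.1) (physical n) := by fun_prop
      exact (continuousOn_const.mul ((hi.pow 2).mul hp)).add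
        (((continuousOn_const.mul ho).mul (hps.pow 2)).add (continuousOn_const.mul hl))
    exact h1.congr fun z _ => hF0 z.1.1 z.1.2 z.2.1 z.2.2
  refine ⟨nondegenerateSet B b μ (F 0), isOpen_nondegenerateSet hb
    (hμ.of_le (WithTop.coe_le_coe.2 (le_trans (by norm_num : (2 : ℕ∞) ≤ 5) hr5))) hFc, Set.inter_subset_left, ?_,
    fun P hP => nondegenerate_of_mem (le_trans (by norm_num) hr5) hb hμ hpos
      (matrixForm_symm hg.inv) (matrixForm_pos hg.inv) hFu hP⟩
  rintro ⟨⟨s, q⟩, ps, p⟩ ⟨hs, h1, h2⟩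
  have hs' : 0 < s := hs
  -- `∂F/∂p_s = Ω p_s` and `Ω > 0`.
  have hps : ps = 0 := by
    have h3 : HasDerivAt (fun x : ℝ => F 0 ((s, q), (x, p))) (Ω s * ps) ps := by
      simp only [hF0]
      refine ((((hasDerivAt_id ps).fun_pow 2).const_mul (1 / 2 * Ω s)).add_const
        (b * Real.log s)).const_add (1 / 2 * (s⁻¹ ^ 2 * B p p)) |>.congr_deriv ?_
      simp
      ring
    exact (mul_eq_zero.1 (h3.unique h1)).resolve_left (hΩpos s hs').ne'
  subst hps
  refine mem_closure_nondegenerateSet hb (hμ.of_le (WithTop.coe_le_coe.2 hr5)) hpos hFu hs' q ?_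
  -- With `p_s = 0` the mass `Ω` drops out, and `∂F/∂s = 0` becomes `|p|² = b s²`.
  have h3 : HasDerivAt (fun x : ℝ => F 0 ((x, q), (0, p)))
      (-(s⁻¹ ^ 3 * B p p) + b * s⁻¹) s := by
    have h4 := (((((hasDerivAt_inv hs'.ne').fun_pow 2).mul_const (B p p)).const_mul (1 / 2)).fun_add
      ((Real.hasDerivAt_log hs'.ne').const_mul b))
    refine (h4.congr_of_eventuallyEq (Filter.Eventually.of_forall fun x => ?_)).congr_deriv ?_
    · simp only [hF0]
      ring
    · rw [Nat.cast_ofNat, Nat.add_one_sub_one]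
      field_simp
  have h5 := h3.unique h2
  field_simp at h5
  linarith
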